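/- Let $X$ be a compact connected Riemann surface with canonical line bundle $K$. Let $G$ be a complex reductive Lie group, not necessarily connected, i.e. the complexification $G=H^{\mathbb C}=H\exp(i\mathfrak h)$ of a compact Lie group $H$ with Lie algebra $\mathfrak h$; every such group has a faithful holomorphic linear representation, and we take $G$ to be a closed subgroup of some $\mathrm{GL}(n,\mathbb C)$. Let $\mathfrak g$ be its Lie algebra and let $\langle\cdot,\cdot\rangle$ be a non-degenerate symmetric invariant $\mathbb C$-bilinear pairing on $\mathfrak g$ that extends the Killing form of $[\mathfrak g,\mathfrak g]$. A $G$-Higgs bundle is a pair $(E_G,\varphi)$ of a holomorphic principal $G$-bundle $E_G$ on $X$ and $\varphi\in H^0(X,\mathrm{ad}(E_G)\otimes K)$. If $G'\subset G$ is a complex reductive subgroup, a reduction of $(E_G,\varphi)$ to $G'$ is a $G'$-Higgs bundle $(E_{G'},\varphi')$ together with a $G'$-equivariant holomorphic embedding $E_{G'}\hookrightarrow E_G$ over $X$ such that $\varphi'$ maps to $\varphi$ under the induced embedding $\mathrm{ad}(E_{G'})\otimes K\hookrightarrow\mathrm{ad}(E_G)\otimes K$. For $s\in i\mathfrak h$,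 where $\mathfrak h$ is the Lie algebra of a maximal compact subgroup of $G$, put $$P_s=\{g\in G: e^{ts}ge^{-ts}\text{ remains bounded as }t\to\infty\},\qquad \mathfrak p_s=\{v\in\mathfrak g:\mathrm{Ad}(e^{ts})v\text{ remains bounded as }t\to\infty\},$$ $$\mathfrak l_s=\{v\in\mathfrak g:\mathrm{Ad}(e^{ts})v\to v\text{ as }t\to\infty\}.$$ The parabolic subgroups of $G$ are the groups $P=P_{s_0}$ with $s_0\in i\mathfrak h$. A holomorphic character $\chi:P\to\mathbb C^*$ has a differential $\chi_*:\mathfrak p\to\mathbb C$, which is represented by a unique element $s_{\chi_*}$ of the centre of $\mathfrak l_{s_0}$ through $\chi_*=\langle s_{\chi_*},\cdot\rangle$ on $\mathfrak p=\mathfrak p_{s_0}$. The character $\chi$ is antidominant if $\mathfrak p\subset\mathfrak p_{s_{\chi_*}}$. For a holomorphic reduction $\sigma$ of $E_G$ to a principal $P$-bundle $E_\sigma\subset E_G$ let $\deg_\chi(E_\sigma)$ be the degree of the line bundle $E_\sigma\times_\chi\mathbb C$. Let $\mathfrak z_{\mathfrak h}$ be the centre of $\mathfrak h$ and let $\alpha\in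 i\mathfrak z_{\mathfrak h}$. The $G$-Higgs bundle $(E_G,\varphi)$ is $\alpha$-stable if for every parabolic subgroup $P$ of $G$, every antidominant character $\chi$ of $P$ and every holomorphic reduction $\sigma$ of $E_G$ to $P$ with $\varphi\in H^0(X,\mathrm{ad}(E_\sigma)\otimes K)$ one has $$\deg_\chi(E_\sigma)-\langle\alpha,s_{\chi_*}\rangle\ \ge\ 0,$$ with strict inequality whenever $s_{\chi_*}$ does not lie in the centre of $\mathfrak g$. It is stable if it is $\alpha$-stable for some $\alpha\in i\mathfrak z_{\mathfrak h}$. The same definitions apply to $G'$, with a pairing of the same kind on its Lie algebra. **Proposition.** Let $(E_G,\varphi)$ be a stable $G$-Higgs bundle, let $G'\subset G$ be a complex reductive subgroup, and let $(E_{G'},\varphi')$ be a $G'$-Higgs bundle that is a reduction of $(E_G,\varphi)$ to $G'$. Then $(E_{G'},\varphi')$ is stable as a $G'$-Higgs bundle. -/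

import Mathlib

open scoped Manifold ContDiff Topology Matrix

universe u v v'

attribute [local instance 100] LieRing.ofAssociativeRing

noncomputable section

namespace GHiggs

/-! ### Complex reductive groups, as linear groups -/

/-- Square complex matrices of size `n`. -/
abbrev Mat (n : ℕ) := Matrix (Fin n) (Fin n) ℂ

/-- The matrix exponential, as an element of `GL(n, ℂ)`. -/
def expGL {n : ℕ} (A : Mat n) : GL (Fin n) ℂ := (Matrix.isUnit_exp A).unit

/-- The Lie algebra `{A | exp (tA) ∈ G for all real t}` of a closed subgroup `G` of `GL(n, ℂ)`,
as a set of matrices. -/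
def lieSet {n : ℕ} (G : Subgroup (GL (Fin n) ℂ)) : Set (Mat n) :=
  {A | ∀ t : ℝ, expGL (t • A) ∈ G}

/-- A complex reductive Lie group, given as a linear group: a subgroup of `GL(n, ℂ)` whose Lie
algebra is a complex Lie algebra and which is the complexification of a compact group `H`, in the
sense that every element is of the form `k * exp (i Y)` with `k ∈ H` and `Y ∈ Lie H`.
The group need not be connected. -/
structure ComplexReductiveGroup (n : ℕ) where
  /-- the underlying subgroup of `GL(n, ℂ)` -/
  carrier : Subgroup (GL (Fin n) ℂ)
  /-- the Lie algebra -/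
  lie : LieSubalgebra ℂ (Mat n)
  mem_lie : ∀ A : Mat n, A ∈ lie ↔ A ∈ lieSet carrier
  exists_compact_form : ∃ H : Subgroup (GL (Fin n) ℂ), H ≤ carrier ∧
    IsCompact (H : Set (GL (Fin n) ℂ)) ∧
    ∀ g ∈ carrier, ∃ k ∈ H, ∃ Y ∈ lieSet H, g = k * expGL (Complex.I • Y)

variable {n : ℕ}

/-- `H` is a maximal compact subgroup of `G`. -/
def IsMaximalCompact (G H : Subgroup (GL (Fin n) ℂ)) : Prop :=
  Maximal (fun K : Subgroup (GL (Fin n) ℂ) => K ≤ G ∧ IsCompact (K : Set (GL (Fin n) ℂ))) H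

/-- The elements of `i 𝔥`, where `𝔥` is the Lie algebra of some maximal compact subgroup
of `G`. -/
def iCompact (G : Subgroup (GL (Fin n) ℂ)) : Set (Mat n) :=
  {s | ∃ H, IsMaximalCompact G H ∧ Complex.I • s ∈ lieSet H}

/-- The subgroup `P_s` of those `g ∈ G` for which `exp (ts) g exp (-ts)` remains bounded, that is,
stays in a compact subset of `GL(n, ℂ)`, as `t → ∞`. -/
def parabolic (G : Subgroup (GL (Fin n) ℂ)) (s : Mat n) : Subgroup (GL (Fin n) ℂ) where
  carrier := {g | g ∈ G ∧ ∃ K : Set (GL (Fin n) ℂ), IsCompact K ∧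
    ∀ t : ℝ, 0 ≤ t → expGL (t • s) * g * (expGL (t • s))⁻¹ ∈ K}
  one_mem' := ⟨G.one_mem, {1}, isCompact_singleton, fun t _ => by simp⟩
  mul_mem' := by
    rintro a b ⟨ha, K, hK, hKa⟩ ⟨hb, L, hL, hLb⟩
    refine ⟨G.mul_mem ha hb, (fun p : GL (Fin n) ℂ × GL (Fin n) ℂ => p.1 * p.2) '' (K ×ˢ L),
      (hK.prod hL).image continuous_mul, fun t ht => ?_⟩
    exact ⟨(_, _), ⟨hKa t ht, hLb t ht⟩, by group⟩
  inv_mem' := by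
    rintro a ⟨ha, K, hK, hKa⟩
    refine ⟨G.inv_mem ha, (fun p : GL (Fin n) ℂ => p⁻¹) '' K, hK.image continuous_inv,
      fun t ht => ?_⟩
    exact ⟨_, hKa t ht, by group⟩

/-- `Ad (exp (ts)) v`. -/
def adExp (s : Mat n) (t : ℝ) (v : Mat n) : Mat n :=
  (expGL (t • s) : Mat n) * v * ((expGL (t • s))⁻¹ : GL (Fin n) ℂ)

namespace ComplexReductiveGroup

variable (G : ComplexReductiveGroup n)

/-- The parabolic subalgebra `𝔭_s` of those `v ∈ 𝔤` for which `Ad (exp (ts)) v` remains bounded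
as `t → ∞`. -/
def parabolicLie (s : Mat n) : Set (Mat n) :=
  {v | v ∈ G.lie ∧ ∃ K : Set (Mat n), IsCompact K ∧ ∀ t : ℝ, 0 ≤ t → adExp s t v ∈ K}

/-- The Levi subalgebra `𝔩_s` of those `v ∈ 𝔤` for which `Ad (exp (ts)) v → v` as `t → ∞`. -/
def leviLie (s : Mat n) : Set (Mat n) :=
  {v | v ∈ G.lie ∧ Filter.Tendsto (fun t : ℝ => adExp s t v) Filter.atTop (𝓝 v)}

/-- The centre of the Levi subalgebra `𝔩_s`. -/
def leviCentre (s : Mat n) : Set (Mat n) :=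
  {v | v ∈ G.leviLie s ∧ ∀ w ∈ G.leviLie s, ⁅v, w⁆ = 0}

/-- A non-degenerate invariant symmetric `ℂ`-bilinear pairing on `𝔤` that extends the Killing form
on the semisimple part `[𝔤, 𝔤]`. -/
structure IsInvariantPairing (B : LinearMap.BilinForm ℂ G.lie) : Prop where
  symm : ∀ x y, B x y = B y x
  nondegenerate : B.Nondegenerate
  invariant : ∀ x y z, B ⁅x, y⁆ z = B x ⁅y, z⁆
  killing : ∀ x ∈ LieAlgebra.derivedSeries ℂ G.lie 1, ∀ y ∈ LieAlgebra.derivedSeries ℂ G.lie 1,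
    B x y = killingForm ℂ G.lie x y

/-- The parameters of stability: the elements of `i 𝔷_𝔥`. -/
def IsParameter (α : G.lie) : Prop :=
  α ∈ LieAlgebra.center ℂ G.lie ∧ (α : Mat n) ∈ iCompact G.carrier

end ComplexReductiveGroup

/-! ### Characters -/

/-- A character `P → ℂ*` is holomorphic if near each point of `P` it is the restriction of a
holomorphic function of the matrix entries. -/
def IsHolomorphicCharacter {P : Subgroup (GL (Fin n) ℂ)} (χ : P →* ℂˣ) : Prop :=
  ∀ g : P, ∃ F : (Fin n → Fin n → ℂ) → ℂ,
    AnalyticAt ℂ F (fun i j => (g : GL (Fin n) ℂ) i j) ∧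
    ∀ᶠ h : P in 𝓝 g, F (fun i j => (h : GL (Fin n) ℂ) i j) = (χ h : ℂ)

/-- The character `χ_*` of the Lie algebra of `P` that is induced by `χ : P → ℂ*`. -/
def charDeriv {P : Subgroup (GL (Fin n) ℂ)} (χ : P →* ℂˣ) (A : lieSet P) : ℂ :=
  deriv (fun t : ℝ => (χ ⟨expGL (t • (A : Mat n)), A.2 t⟩ : ℂ)) 0

/-- For the parabolic subgroup `P = P_{s₀}`, the element `s` of the centre of the Levi subalgebra
is the element `s_{χ_*}` that corresponds to `χ_*` under the pairing `B`. -/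
def IsDualElement (G : ComplexReductiveGroup n) (B : LinearMap.BilinForm ℂ G.lie) (s₀ : Mat n)
    (χ : parabolic G.carrier s₀ →* ℂˣ) (s : G.lie) : Prop :=
  (s : Mat n) ∈ G.leviCentre s₀ ∧
    ∀ (A : G.lie) (hA : (A : Mat n) ∈ lieSet (parabolic G.carrier s₀)),
      B s A = charDeriv χ ⟨A, hA⟩

/-! ### Holomorphic principal bundles and reductions of the structure group -/

variable {X : Type u} [TopologicalSpace X] [ChartedSpace ℂ X]

/-- Holomorphy on `U` of a map from a Riemann surface to `GL(n, ℂ)`. -/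
def HolomorphicOn (f : X → GL (Fin n) ℂ) (U : Set X) : Prop :=
  ∀ i j, MDifferentiableOn 𝓘(ℂ, ℂ) 𝓘(ℂ, ℂ) (fun x => f x i j) U

/-- A holomorphic principal `G`-bundle over `X`: a set over `X` with a right action of `G` that is
simply transitive on the fibres, together with a family of local sections over an open cover of `X`
(equivalently, local trivialisations) whose transition functions are holomorphic. -/
structure PrincipalBundle (X : Type u) [TopologicalSpace X] [ChartedSpace ℂ X]
    (G : Subgroup (GL (Fin n) ℂ)) where
  /-- the total space -/
  E : Type v
  /-- the projection -/
  proj : E → X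
  /-- the right action of `G` -/
  act : E → G → E
  act_one : ∀ e, act e 1 = e
  act_mul : ∀ e g h, act e (g * h) = act (act e g) h
  proj_act : ∀ e g, proj (act e g) = proj e
  simply_transitive : ∀ e e', proj e = proj e' → ∃! g, act e g = e'
  /-- the distinguished local sections, each with its domain -/
  triv : Set (Set X × (X → E))
  isOpen_triv : ∀ a ∈ triv, IsOpen a.1
  proj_triv : ∀ a ∈ triv, ∀ x ∈ a.1, proj (a.2 x) = x
  cover : ∀ x, ∃ a ∈ triv, x ∈ a.1
  transition : ∀ a ∈ triv, ∀ b ∈ triv, ∃ g : X → G,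
    HolomorphicOn (fun x => (g x : GL (Fin n) ℂ)) (a.1 ∩ b.1) ∧
    ∀ x ∈ a.1 ∩ b.1, b.2 x = act (a.2 x) (g x)

namespace PrincipalBundle

variable {G : Subgroup (GL (Fin n) ℂ)} (E : PrincipalBundle.{u, v} X G)

/-- `s` is a holomorphic section of the bundle over the open set `U`. -/
def IsHolomorphicSection (s : X → E.E) (U : Set X) : Prop :=
  IsOpen U ∧ (∀ x ∈ U, E.proj (s x) = x) ∧
    ∀ a ∈ E.triv, ∃ g : X → G,
      HolomorphicOn (fun x => (g x : GL (Fin n) ℂ)) (a.1 ∩ U) ∧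
      ∀ x ∈ a.1 ∩ U, s x = E.act (a.2 x) (g x)

/-- A holomorphic reduction of the structure group of `E` to the subgroup `Q`, given as the
`Q`-subbundle of `E` (equivalently, as a holomorphic section of `E / Q`). -/
structure Reduction (Q : Subgroup (GL (Fin n) ℂ)) where
  /-- the total space of the subbundle -/
  F : Set E.E
  act_mem : ∀ e ∈ F, ∀ g : G, (g : GL (Fin n) ℂ) ∈ Q → E.act e g ∈ F
  mem_of_act_mem : ∀ e ∈ F, ∀ g : G, E.act e g ∈ F → (g : GL (Fin n) ℂ) ∈ Q
  exists_section : ∀ x : X, ∃ (U : Set X) (s : X → E.E),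
    x ∈ U ∧ E.IsHolomorphicSection s U ∧ ∀ y ∈ U, s y ∈ F

variable {E}

/-- The line bundle `E_σ ×_χ ℂ` has degree `d`: it has a meromorphic section that does not vanish
identically and whose divisor `D` has degree `d`. Sections are functions `f` on `E_σ` with
`f (e q) = χ (q)⁻¹ f (e)`, and their order at a point is computed in a holomorphic local section of
`E_σ` and a holomorphic coordinate. -/
def Reduction.HasDegree {Q : Subgroup (GL (Fin n) ℂ)} (σ : E.Reduction Q) (χ : Q →* ℂˣ)
    (d : ℤ) : Prop :=
  ∃ (f : E.E → ℂ) (D : X →₀ ℤ),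
    (∀ e ∈ σ.F, ∀ (g : G) (hg : (g : GL (Fin n) ℂ) ∈ Q),
      f (E.act e g) = ((χ ⟨g, hg⟩)⁻¹ : ℂˣ) * f e) ∧
    (∀ x : X, ∃ (U : Set X) (s : X → E.E),
      x ∈ U ∧ E.IsHolomorphicSection s U ∧ (∀ y ∈ U, s y ∈ σ.F) ∧
      MeromorphicAt (fun z : ℂ => f (s ((chartAt ℂ x).symm z))) (chartAt ℂ x x) ∧
      meromorphicOrderAt (fun z : ℂ => f (s ((chartAt ℂ x).symm z))) (chartAt ℂ x x)
        = ((D x : ℤ) : WithTop ℤ)) ∧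
    d = D.sum (fun _ k => k)

end PrincipalBundle

/-! ### Higgs bundles and stability -/

/-- A `G`-Higgs bundle over `X`: a holomorphic principal `G`-bundle with a holomorphic section `φ`
of `ad(E) ⊗ K`. In a holomorphic coordinate `c` of `X`, one has `φ = φ_c dc`, where `φ_c` is a section
of `ad(E)`, that is, an equivariant function from `E` to `𝔤`; this is `coeff c`. -/
structure HiggsBundle (X : Type u) [TopologicalSpace X] [ChartedSpace ℂ X]
    (G : ComplexReductiveGroup n) extends PrincipalBundle.{u, v} X G.carrier where
  /-- the coefficients of the Higgs field in the coordinates of `X` -/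
  coeff : OpenPartialHomeomorph X ℂ → E → Mat n
  coeff_mem : ∀ c ∈ atlas ℂ X, ∀ e, proj e ∈ c.source → coeff c e ∈ G.lie
  coeff_act : ∀ c ∈ atlas ℂ X, ∀ e, proj e ∈ c.source → ∀ g : G.carrier,
    coeff c (act e g) =
      (((g : GL (Fin n) ℂ)⁻¹ : GL (Fin n) ℂ) : Mat n) * coeff c e * ((g : GL (Fin n) ℂ) : Mat n)
  coeff_change : ∀ c ∈ atlas ℂ X, ∀ c' ∈ atlas ℂ X, ∀ e,
    proj e ∈ c.source → proj e ∈ c'.source →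
      coeff c' e = deriv (fun z : ℂ => c (c'.symm z)) (c' (proj e)) • coeff c e
  coeff_holomorphic : ∀ c ∈ atlas ℂ X, ∀ (s : X → E) (U : Set X),
    toPrincipalBundle.IsHolomorphicSection s U → ∀ i j,
      MDifferentiableOn 𝓘(ℂ, ℂ) 𝓘(ℂ, ℂ) (fun x => coeff c (s x) i j) (U ∩ c.source)

namespace HiggsBundle

variable {G : ComplexReductiveGroup n}

/-- The data that are tested in the stability condition: a parabolic subgroup `P = P_{s₀}` of `G`
with `s₀ ∈ i 𝔥`, a holomorphic character `χ` of `P` that is antidominant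
(`𝔭_{s₀} ⊆ 𝔭_s` for the element `s = s_{χ_*}`), and a holomorphic reduction `σ` of `E` to `P` such
that `φ` is a section of `ad(E_σ) ⊗ K`. -/
structure IsTestDatum (E : HiggsBundle.{u, v} X G) (B : LinearMap.BilinForm ℂ G.lie)
    (s₀ : Mat n) (χ : parabolic G.carrier s₀ →* ℂˣ) (s : G.lie)
    (σ : E.toPrincipalBundle.Reduction (parabolic G.carrier s₀)) : Prop where
  mem_iCompact : s₀ ∈ iCompact G.carrier
  holomorphic : IsHolomorphicCharacter χ
  dual : IsDualElement G B s₀ χ s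
  antidominant : G.parabolicLie s₀ ⊆ G.parabolicLie (s : Mat n)
  higgs_mem : ∀ c ∈ atlas ℂ X, ∀ e ∈ σ.F, E.proj e ∈ c.source →
    E.coeff c e ∈ G.parabolicLie s₀

/-- `α`-semistability: `deg_χ (E_σ) - ⟨α, s_{χ_*}⟩ ≥ 0`. -/
def IsSemistableWith (E : HiggsBundle.{u, v} X G) (B : LinearMap.BilinForm ℂ G.lie)
    (α : G.lie) : Prop :=
  ∀ s₀ χ s σ, E.IsTestDatum B s₀ χ s σ → ∀ d : ℤ, σ.HasDegree χ d → 0 ≤ (d : ℝ) - (B α s).re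

/-- `α`-stability: `α`-semistability, with strict inequality whenever `s_{χ_*}` does not lie in the
centre of `𝔤` (for central `s_{χ_*}`, both `χ` and `χ⁻¹` are antidominant, so that the inequality is
necessarily an equality). -/
def IsStableWith (E : HiggsBundle.{u, v} X G) (B : LinearMap.BilinForm ℂ G.lie)
    (α : G.lie) : Prop :=
  E.IsSemistableWith B α ∧
    ∀ s₀ χ s σ, E.IsTestDatum B s₀ χ s σ → s ∉ LieAlgebra.center ℂ G.lie →
      ∀ d : ℤ, σ.HasDegree χ d → 0 < (d : ℝ) - (B α s).re

/-- Stability: `α`-stability for some parameter `α ∈ i 𝔷_𝔥`. -/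
def IsStable (E : HiggsBundle.{u, v} X G) (B : LinearMap.BilinForm ℂ G.lie) : Prop :=
  ∃ α : G.lie, G.IsParameter α ∧ E.IsStableWith B α

/-- For `G' ⊆ G`, the `G'`-Higgs bundle `(E', φ')` is a reduction of the structure group of the
`G`-Higgs bundle `(E, φ)`, by means of the map `j : E' → E`. -/
structure IsReduction {G' : ComplexReductiveGroup n} (hG : G'.carrier ≤ G.carrier)
    (E' : HiggsBundle.{u, v'} X G') (E : HiggsBundle.{u, v} X G) (j : E'.E → E.E) : Prop where
  proj : ∀ e, E.proj (j e) = E'.proj e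
  act : ∀ e g, j (E'.act e g) = E.act (j e) (Subgroup.inclusion hG g)
  holomorphic : ∀ (s : X → E'.E) (U : Set X), E'.toPrincipalBundle.IsHolomorphicSection s U →
    E.toPrincipalBundle.IsHolomorphicSection (fun x => j (s x)) U
  higgs : ∀ c ∈ atlas ℂ X, ∀ e, E'.proj e ∈ c.source → E.coeff c (j e) = E'.coeff c e

end HiggsBundle

end GHiggs

end

/-! Every test of the G'-bundle, given by a parabolic P' = P_{s₀} of G', an antidominant character χ
and a reduction σ, is turned into a test of the G-bundle whose stability number is a positive
multiple M of the original one. Stability of the G-bundle then gives both the weak and the strict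
inequality.

The pairings `B` and `B'` need not be compatible, so the trace form tr(xy) of matrices mediates
between them. By conjugacy of compact subgroups, one matrix c makes a compact form of G and a
compact form of G' unitary at the same time (`exists_common_isPolar`). Both Lie algebras are then
closed under the adjoint † belonging to c, and tr(x x†) > 0 for x ≠ 0 makes the trace form
non-degenerate on each of them.

Let s₁ ∈ 𝔤' represent χ_* in the trace form. A character is bounded on a compact group, which makes
s₁ Hermitian (`IsPolar.dag_eq_self_of_charDeriv`). Because `B'` extends the Killing form, s₁ and
s_{χ_*} define the same parabolic subalgebra (`parabolicLie_eq_of_pairing`), so antidominance places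
the Lie algebra of P' in that of P_{s₁}. Invariance of χ_* under P' upgrades this to an inclusion of
the possibly disconnected groups (`blockTriangular_of_mem_parabolic`). Hence P' lies in the
parabolic P = P_{s₁} of G, and σ extends to P.

The eigenvalues of s₁ are rational (`exists_integral_weights`), so a multiple of them is the weight
of a product of powers of block determinants on P. This product and a power of χ have the same
differential on P', so they differ by a character of finite order, and some χ^M extends to P
(`exists_char_extension`). The degree is multiplied by M (`hasDegree_extend`).

For the parameter, α' is the trace-orthogonal projection of α to 𝔤' (`exists_parameter`). If t is
the `B`-dual of M tr(s₁ ·), then B(α,t) = M tr(s₁α) = M tr(s₁α') = M B'(α',s). If t is central in 𝔤,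
then s₁ commutes with 𝔤 ⊇ 𝔤' and s is central in 𝔤', so strictness transfers as well. -/

namespace GHiggs

/-! ### Matrix exponentials, the Frobenius norm and the unitary group. -/

variable {n : ℕ}

/-! ### Conjugation and the exponential -/

/-- Conjugation `A ↦ c A c⁻¹` by an invertible matrix. -/
noncomputable def cj (c : GL (Fin n) ℂ) : Mat n ≃ₐ[ℂ] Mat n where
  toFun A := (c : Mat n) * A * ((c⁻¹ : GL (Fin n) ℂ) : Mat n)
  invFun A := ((c⁻¹ : GL (Fin n) ℂ) : Mat n) * A * (c : Mat n)
  left_inv A := by simp [mul_assoc]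
  right_inv A := by simp [mul_assoc]
  map_mul' A B := by simp [mul_assoc]
  map_add' A B := by simp [mul_add, add_mul]
  commutes' r := by simp [Algebra.algebraMap_eq_smul_one]

theorem cj_apply (c : GL (Fin n) ℂ) (A : Mat n) :
    cj c A = (c : Mat n) * A * ((c⁻¹ : GL (Fin n) ℂ) : Mat n) := rfl

@[simp] theorem cj_one (A : Mat n) : cj 1 A = A := by simp [cj_apply]

theorem cj_mul (c d : GL (Fin n) ℂ) (A : Mat n) : cj (c * d) A = cj c (cj d A) := by
  simp [cj_apply, mul_assoc]

@[simp] theorem cj_inv_cj (c : GL (Fin n) ℂ) (A : Mat n) : cj c⁻¹ (cj c A) = A := by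
  rw [← cj_mul]; simp

@[simp] theorem cj_cj_inv (c : GL (Fin n) ℂ) (A : Mat n) : cj c (cj c⁻¹ A) = A := by
  rw [← cj_mul]; simp

theorem cj_real_smul (c : GL (Fin n) ℂ) (t : ℝ) (A : Mat n) : cj c (t • A) = t • cj c A := by
  rw [cj_apply, cj_apply, mul_smul_comm, smul_mul_assoc]

theorem coe_conj (c g : GL (Fin n) ℂ) : ((c * g * c⁻¹ : GL (Fin n) ℂ) : Mat n) = cj c g := rfl

@[simp] theorem trace_cj (c : GL (Fin n) ℂ) (A : Mat n) : (cj c A).trace = A.trace := by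
  rw [cj_apply, Matrix.trace_mul_comm, ← mul_assoc]; simp

theorem continuous_cj (c : GL (Fin n) ℂ) : Continuous (cj c) := by
  change Continuous fun A : Mat n => (c : Mat n) * A * ((c⁻¹ : GL (Fin n) ℂ) : Mat n)
  fun_prop

theorem adExp_eq (s : Mat n) (t : ℝ) (v : Mat n) : adExp s t v = cj (expGL (t • s)) v := rfl

@[simp] theorem coe_expGL (A : Mat n) : ((expGL A : GL (Fin n) ℂ) : Mat n) = NormedSpace.exp A :=
  rfl

@[simp] theorem expGL_zero : expGL (0 : Mat n) = 1 := by
  ext1; simp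

theorem expGL_add {A B : Mat n} (h : Commute A B) : expGL (A + B) = expGL A * expGL B := by
  ext1; simp [Matrix.exp_add_of_commute _ _ h]

theorem expGL_neg (A : Mat n) : expGL (-A) = (expGL A)⁻¹ := by
  rw [eq_inv_iff_mul_eq_one, ← expGL_add (Commute.refl A).neg_left]; simp

theorem expGL_add_smul (A : Mat n) (a b : ℝ) :
    expGL ((a + b) • A) = expGL (a • A) * expGL (b • A) := by
  rw [add_smul, expGL_add (((Commute.refl A).smul_left a).smul_right b)]

theorem expGL_nsmul (A : Mat n) (k : ℕ) : expGL (k • A) = expGL A ^ k := by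
  ext1; rw [coe_expGL, Matrix.exp_nsmul]; rfl

theorem conj_expGL (c : GL (Fin n) ℂ) (A : Mat n) : c * expGL A * c⁻¹ = expGL (cj c A) := by
  ext1
  rw [coe_conj, coe_expGL, coe_expGL, cj_apply, cj_apply]
  exact (Matrix.exp_units_conj c A).symm

theorem cj_exp (c : GL (Fin n) ℂ) (A : Mat n) :
    cj c (NormedSpace.exp A) = NormedSpace.exp (cj c A) := by
  rw [← coe_expGL, ← coe_conj, conj_expGL, coe_expGL]

open scoped Matrix.Norms.Operator in
theorem continuous_matExp : Continuous (NormedSpace.exp : Mat n → Mat n) :=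
  NormedSpace.exp_continuous

theorem continuous_expGL : Continuous (expGL : Mat n → GL (Fin n) ℂ) := by
  rw [Units.continuous_iff]
  refine ⟨continuous_matExp, ?_⟩
  have : (fun A : Mat n => ((expGL A)⁻¹ : GL (Fin n) ℂ).val) = fun A => NormedSpace.exp (-A) := by
    ext1 A; rw [← expGL_neg, coe_expGL]
  rw [this]
  exact continuous_matExp.comp continuous_neg

theorem lieSet_mono {G H : Subgroup (GL (Fin n) ℂ)} (h : G ≤ H) : lieSet G ⊆ lieSet H :=
  fun _ hA t => h (hA t)

theorem expGL_mem_of_mem_lieSet {G : Subgroup (GL (Fin n) ℂ)} {A : Mat n} (hA : A ∈ lieSet G) :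
    expGL A ∈ G := by simpa using hA 1

theorem cj_mem_lieSet {G : Subgroup (GL (Fin n) ℂ)} {A : Mat n} (hA : A ∈ lieSet G)
    {g : GL (Fin n) ℂ} (hg : g ∈ G) : cj g A ∈ lieSet G := by
  intro t
  rw [← cj_real_smul, ← conj_expGL]
  exact G.mul_mem (G.mul_mem hg (hA t)) (G.inv_mem hg)

theorem cj_expGL_of_commute {A B : Mat n} (h : Commute A B) : cj (expGL A) B = B := by
  rw [cj_apply, coe_expGL]
  have : Commute (NormedSpace.exp A) B := by
    open scoped Matrix.Norms.Operator in exact h.exp_left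
  rw [this.eq, mul_assoc, ← coe_expGL, Units.mul_inv, mul_one]

/-! ### The sum of the squares of the entries -/

/-- The square of the Frobenius norm. -/
noncomputable def nsq (A : Mat n) : ℝ := ∑ i, ∑ j, ‖A i j‖ ^ 2

theorem nsq_nonneg (A : Mat n) : 0 ≤ nsq A := by unfold nsq; positivity

theorem trace_mul_conjTranspose (A : Mat n) : (A * Aᴴ).trace = nsq A := by
  simp [nsq, Matrix.trace, Matrix.mul_apply, Complex.mul_conj, Complex.normSq_eq_norm_sq]

theorem trace_conjTranspose_mul (A : Mat n) : (Aᴴ * A).trace = nsq A := by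
  rw [Matrix.trace_mul_comm, trace_mul_conjTranspose]

theorem sq_norm_apply_le_nsq (A : Mat n) (i j : Fin n) : ‖A i j‖ ^ 2 ≤ nsq A := by
  unfold nsq
  calc ‖A i j‖ ^ 2 ≤ ∑ j, ‖A i j‖ ^ 2 :=
        Finset.single_le_sum (f := fun j => ‖A i j‖ ^ 2) (fun _ _ => by positivity)
          (Finset.mem_univ j)
    _ ≤ _ := Finset.single_le_sum (f := fun i => ∑ j, ‖A i j‖ ^ 2) (fun _ _ => by positivity)
          (Finset.mem_univ i)

theorem nsq_eq_zero {A : Mat n} : nsq A = 0 ↔ A = 0 := by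
  constructor
  · intro h
    ext i j
    have := sq_norm_apply_le_nsq A i j
    rw [h] at this
    have h2 : ‖A i j‖ ^ 2 = 0 := le_antisymm this (by positivity)
    simpa using h2
  · rintro rfl; simp [nsq]

@[simp] theorem nsq_zero : nsq (0 : Mat n) = 0 := nsq_eq_zero.2 rfl

theorem nsq_smul (t : ℝ) (A : Mat n) : nsq (t • A) = t ^ 2 * nsq A := by
  simp [nsq, Finset.mul_sum, mul_pow]

theorem continuous_nsq : Continuous (nsq : Mat n → ℝ) := by
  unfold nsq; fun_prop

theorem isCompact_nsq_le (R : ℝ) : IsCompact {A : Mat n | nsq A ≤ R} := by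
  have hK : IsCompact (Set.univ.pi fun _ : Fin n => Set.univ.pi fun _ : Fin n =>
      Metric.closedBall (0 : ℂ) (Real.sqrt R)) :=
    isCompact_univ_pi fun _ => isCompact_univ_pi fun _ => isCompact_closedBall _ _
  refine hK.of_isClosed_subset
    (isClosed_le continuous_nsq continuous_const) ?_
  intro A hA
  simp only [Set.mem_pi, Set.mem_univ, forall_true_left, mem_closedBall_zero_iff]
  intro i j
  exact Real.le_sqrt_of_sq_le ((sq_norm_apply_le_nsq A i j).trans hA)

theorem isCompact_GL_nsq_le (R S : ℝ) :
    IsCompact {g : GL (Fin n) ℂ | nsq (g : Mat n) ≤ R ∧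
      nsq ((g⁻¹ : GL (Fin n) ℂ) : Mat n) ≤ S} := by
  have h := (Units.isClosedEmbedding_embedProduct (α := Mat n)).isCompact_preimage
    ((isCompact_nsq_le R).prod ((isCompact_nsq_le S).image MulOpposite.continuous_op))
  convert h using 1
  ext g
  refine and_congr Iff.rfl ⟨fun h => ⟨_, h, rfl⟩, ?_⟩
  rintro ⟨x, hx, hxg⟩
  have : x = ((g⁻¹ : GL (Fin n) ℂ) : Mat n) := MulOpposite.op_injective hxg
  exact this ▸ hx

/-! ### Unitary matrices -/

/-- The unitary group, as a subgroup of `GL(n, ℂ)`. -/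
def unitaryGL (n : ℕ) : Subgroup (GL (Fin n) ℂ) where
  carrier := {g | (g : Mat n)ᴴ * g = 1}
  one_mem' := by simp
  mul_mem' := by
    intro a b ha hb
    simp only [Set.mem_ofPred_eq] at *
    rw [Units.val_mul, Matrix.conjTranspose_mul, mul_assoc, ← mul_assoc (a : Mat n)ᴴ, ha, one_mul,
      hb]
  inv_mem' := by
    intro a ha
    simp only [Set.mem_ofPred_eq] at *
    have h1 : ((a⁻¹ : GL (Fin n) ℂ) : Mat n) = (a : Mat n)ᴴ := by
      rw [← mul_one (a : Mat n)ᴴ, ← Units.mul_inv a, ← mul_assoc, ha, one_mul]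
    rw [h1, Matrix.conjTranspose_conjTranspose, ← h1, Units.mul_inv]

theorem mem_unitaryGL {g : GL (Fin n) ℂ} : g ∈ unitaryGL n ↔ (g : Mat n)ᴴ * g = 1 := Iff.rfl

theorem coe_inv_of_mem_unitaryGL {g : GL (Fin n) ℂ} (hg : g ∈ unitaryGL n) :
    ((g⁻¹ : GL (Fin n) ℂ) : Mat n) = (g : Mat n)ᴴ := by
  rw [← mul_one (g : Mat n)ᴴ, ← Units.mul_inv g, ← mul_assoc, mem_unitaryGL.1 hg, one_mul]

theorem mul_conjTranspose_of_mem_unitaryGL {g : GL (Fin n) ℂ} (hg : g ∈ unitaryGL n) :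
    (g : Mat n) * (g : Mat n)ᴴ = 1 := by
  rw [← coe_inv_of_mem_unitaryGL hg, Units.mul_inv]

theorem nsq_unitary_mul {g : GL (Fin n) ℂ} (hg : g ∈ unitaryGL n) (A : Mat n) :
    nsq ((g : Mat n) * A) = nsq A := by
  have : ((nsq ((g : Mat n) * A) : ℝ) : ℂ) = nsq A := by
    rw [← trace_conjTranspose_mul, ← trace_conjTranspose_mul, Matrix.conjTranspose_mul,
      mul_assoc, ← mul_assoc (g : Mat n)ᴴ, mem_unitaryGL.1 hg, one_mul]
  exact_mod_cast this

theorem nsq_mul_unitary {g : GL (Fin n) ℂ} (hg : g ∈ unitaryGL n) (A : Mat n) :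
    nsq (A * (g : Mat n)) = nsq A := by
  have : ((nsq (A * (g : Mat n)) : ℝ) : ℂ) = nsq A := by
    rw [← trace_mul_conjTranspose, ← trace_mul_conjTranspose, Matrix.conjTranspose_mul,
      mul_assoc, ← mul_assoc (g : Mat n), mul_conjTranspose_of_mem_unitaryGL hg, one_mul]
  exact_mod_cast this

theorem cj_conjTranspose {g : GL (Fin n) ℂ} (hg : g ∈ unitaryGL n) (A : Mat n) :
    cj g Aᴴ = (cj g A)ᴴ := by
  rw [cj_apply, cj_apply, coe_inv_of_mem_unitaryGL hg]
  simp [mul_assoc]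

theorem nsq_unitary {g : GL (Fin n) ℂ} (hg : g ∈ unitaryGL n) :
    nsq (g : Mat n) = nsq (1 : Mat n) := by
  simpa using nsq_unitary_mul hg 1

theorem isClosed_unitaryGL : IsClosed (unitaryGL n : Set (GL (Fin n) ℂ)) := by
  have : Continuous fun g : GL (Fin n) ℂ => (g : Mat n)ᴴ * g :=
    (Units.continuous_val.matrix_conjTranspose).mul Units.continuous_val
  exact isClosed_eq this continuous_const

theorem isCompact_unitaryGL : IsCompact (unitaryGL n : Set (GL (Fin n) ℂ)) := by
  refine (isCompact_GL_nsq_le (nsq (1 : Mat n)) (nsq (1 : Mat n))).of_isClosed_subset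
    isClosed_unitaryGL ?_
  intro g hg
  exact ⟨(nsq_unitary hg).le, (nsq_unitary (inv_mem hg)).le⟩

theorem expGL_mem_unitaryGL {A : Mat n} (hA : Aᴴ = -A) : expGL A ∈ unitaryGL n := by
  rw [mem_unitaryGL, coe_expGL, ← Matrix.exp_conjTranspose, hA, ← coe_expGL, expGL_neg,
    ← coe_expGL, Units.inv_mul]

/-! ### Diagonalisation -/

/-- A real diagonal matrix. -/
noncomputable def rdiag (d : Fin n → ℝ) : Mat n := Matrix.diagonal fun i => (d i : ℂ)

theorem rdiag_conjTranspose (d : Fin n → ℝ) : (rdiag d)ᴴ = rdiag d := by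
  simp [rdiag, Matrix.diagonal_conjTranspose, Pi.star_def]

theorem rdiag_mul_apply (d : Fin n → ℝ) (A : Mat n) (i j : Fin n) :
    (rdiag d * A) i j = d i * A i j := by simp [rdiag]

theorem mul_rdiag_apply (d : Fin n → ℝ) (A : Mat n) (i j : Fin n) :
    (A * rdiag d) i j = A i j * d j := by simp [rdiag]

theorem smul_rdiag (t : ℝ) (d : Fin n → ℝ) : t • rdiag d = rdiag (t • d) := by
  ext i j; by_cases h : i = j <;> simp [rdiag, h, Matrix.diagonal]

theorem exp_rdiag (d : Fin n → ℝ) : NormedSpace.exp (rdiag d) = rdiag fun i => Real.exp (d i) := by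
  rw [rdiag, Matrix.exp_diagonal, rdiag]
  congr 1
  ext i
  rw [Pi.coe_exp]
  simp [← Complex.exp_eq_exp_ℂ]

theorem bracket_rdiag_apply (d : Fin n → ℝ) (A : Mat n) (i j : Fin n) :
    (⁅rdiag d, A⁆ : Mat n) i j = (d i - d j : ℝ) * A i j := by
  rw [LieRing.of_associative_ring_bracket, Matrix.sub_apply, rdiag_mul_apply, mul_rdiag_apply]
  push_cast; ring

theorem cj_expGL_rdiag_apply (d : Fin n → ℝ) (A : Mat n) (i j : Fin n) :
    cj (expGL (rdiag d)) A i j = (Real.exp (d i - d j) : ℝ) * A i j := by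
  rw [cj_apply, ← expGL_neg, coe_expGL, coe_expGL, exp_rdiag,
    show -rdiag d = rdiag fun i => - d i by
      have := smul_rdiag (-1) d
      simpa [Pi.neg_def] using this,
    exp_rdiag, mul_rdiag_apply, rdiag_mul_apply, sub_eq_add_neg, Real.exp_add]
  push_cast; ring

end GHiggs

/-! ### Unitary diagonalisation, and invariant Hermitian forms of compact groups. -/

namespace GHiggs

variable {n : ℕ}

/-- The unitary matrix with a given orthonormal basis as its columns, as an element of
`GL(n, ℂ)`. -/
noncomputable def glOfBasis (b : OrthonormalBasis (Fin n) ℂ (EuclideanSpace ℂ (Fin n))) :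
    GL (Fin n) ℂ where
  val := (EuclideanSpace.basisFun (Fin n) ℂ).toBasis.toMatrix b
  inv := ((EuclideanSpace.basisFun (Fin n) ℂ).toBasis.toMatrix b)ᴴ
  val_inv := (EuclideanSpace.basisFun (Fin n) ℂ).toMatrix_orthonormalBasis_self_mul_conjTranspose b
  inv_val := (EuclideanSpace.basisFun (Fin n) ℂ).toMatrix_orthonormalBasis_conjTranspose_mul_self b

theorem glOfBasis_mem (b : OrthonormalBasis (Fin n) ℂ (EuclideanSpace ℂ (Fin n))) :
    glOfBasis b ∈ unitaryGL n :=
  (EuclideanSpace.basisFun (Fin n) ℂ).toMatrix_orthonormalBasis_conjTranspose_mul_self b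

theorem glOfBasis_apply (b : OrthonormalBasis (Fin n) ℂ (EuclideanSpace ℂ (Fin n)))
    (i j : Fin n) : (glOfBasis b : Mat n) i j = b j i := by
  simp [glOfBasis, Module.Basis.toMatrix_apply]

theorem cj_inv_glOfBasis_of_eigen {A : Mat n} (hA : Aᴴ = A)
    (b : OrthonormalBasis (Fin n) ℂ (EuclideanSpace ℂ (Fin n)))
    (h : ∀ i, ∃ z : ℂ, A.toEuclideanLin (b i) = z • b i) :
    ∃ d : Fin n → ℝ, cj (glOfBasis b)⁻¹ A = rdiag d := by
  choose z hz using h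
  have key : A * (glOfBasis b : Mat n) = (glOfBasis b : Mat n) * Matrix.diagonal z := by
    ext i j
    rw [Matrix.mul_diagonal, glOfBasis_apply, Matrix.mul_apply]
    simp only [glOfBasis_apply]
    have := congrArg (fun v : EuclideanSpace ℂ (Fin n) => v i) (hz j)
    simp only [Matrix.toLpLin_apply, Matrix.mulVec, dotProduct, PiLp.smul_apply, smul_eq_mul] at this
    rw [this, mul_comm]
  have h2 : cj (glOfBasis b)⁻¹ A = Matrix.diagonal z := by
    rw [cj_apply, inv_inv, mul_assoc, key, ← mul_assoc, Units.inv_mul, one_mul]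
  have h3 : (Matrix.diagonal z)ᴴ = Matrix.diagonal z := by
    rw [← h2, ← cj_conjTranspose (inv_mem (glOfBasis_mem b)), hA]
  refine ⟨fun i => (z i).re, ?_⟩
  rw [h2, rdiag]
  congr 1
  ext i
  have := congrFun (congrFun h3 i) i
  simp only [Matrix.conjTranspose_apply, Matrix.diagonal_apply_eq] at this
  exact (Complex.conj_eq_iff_re.1 this).symm

/-- Commuting Hermitian matrices can be diagonalised simultaneously by a unitary matrix. -/
theorem exists_unitary_diag₂ {A B : Mat n} (hA : Aᴴ = A) (hB : Bᴴ = B) (hAB : A * B = B * A) :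
    ∃ u ∈ unitaryGL n, ∃ d e : Fin n → ℝ, cj u A = rdiag d ∧ cj u B = rdiag e := by
  classical
  have sA : A.toEuclideanLin.IsSymmetric := Matrix.isSymmetric_toEuclideanLin_iff.2 hA
  have sB : B.toEuclideanLin.IsSymmetric := Matrix.isSymmetric_toEuclideanLin_iff.2 hB
  have hc : Commute A.toEuclideanLin B.toEuclideanLin := by
    rw [commute_iff_eq, Module.End.mul_eq_comp, Module.End.mul_eq_comp]
    refine LinearMap.ext fun x => ?_
    simp [Matrix.toLpLin_apply, Matrix.mulVec_mulVec, hAB]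
  have hint := LinearMap.IsSymmetric.directSum_isInternal_of_commute sA sB hc
  have hort := LinearMap.IsSymmetric.orthogonalFamily_eigenspace_inf_eigenspace sA sB
  set V := fun i : ℂ × ℂ => Module.End.eigenspace A.toEuclideanLin i.2 ⊓
    Module.End.eigenspace B.toEuclideanLin i.1
  have hfin : {i | V i ≠ ⊥}.Finite :=
    WellFoundedGT.finite_ne_bot_of_iSupIndep hint.submodule_iSupIndep
  have : Fintype {i // V i ≠ ⊥} := hfin.fintype
  have hint' := DirectSum.isInternal_ne_bot_iff.2 hint
  have hort' : OrthogonalFamily ℂ (fun i : {i // V i ≠ ⊥} => V i) fun i => (V i.1).subtypeₗᵢ :=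
    hort.comp Subtype.val_injective
  have hrank : Module.finrank ℂ (EuclideanSpace ℂ (Fin n)) = n := by simp
  set b := hint'.subordinateOrthonormalBasis hrank hort'
  have hb : ∀ a, ∃ i : ℂ × ℂ, b a ∈ V i := fun a =>
    ⟨_, hint'.subordinateOrthonormalBasis_subordinate hrank a hort'⟩
  obtain ⟨d, hd⟩ := cj_inv_glOfBasis_of_eigen hA b fun i =>
    ⟨_, Module.End.mem_eigenspace_iff.1 (hb i).choose_spec.1⟩
  obtain ⟨e, he⟩ := cj_inv_glOfBasis_of_eigen hB b fun i =>
    ⟨_, Module.End.mem_eigenspace_iff.1 (hb i).choose_spec.2⟩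
  exact ⟨_, inv_mem (glOfBasis_mem b), d, e, hd, he⟩

theorem exists_unitary_diag {A : Mat n} (hA : Aᴴ = A) :
    ∃ u ∈ unitaryGL n, ∃ d : Fin n → ℝ, cj u A = rdiag d := by
  obtain ⟨u, hu, d, -, hd, -⟩ := exists_unitary_diag₂ hA hA rfl
  exact ⟨u, hu, d, hd⟩

/-! ### Hermitian exponentials -/

theorem nsq_cj_unitary {g : GL (Fin n) ℂ} (hg : g ∈ unitaryGL n) (A : Mat n) :
    nsq (cj g A) = nsq A := by
  rw [cj_apply, nsq_mul_unitary (inv_mem hg), nsq_unitary_mul hg]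

theorem nsq_rdiag (d : Fin n → ℝ) : nsq (rdiag d) = ∑ i, d i ^ 2 := by
  unfold nsq rdiag
  refine Finset.sum_congr rfl fun i _ => ?_
  rw [Finset.sum_eq_single i]
  · simp
  · intro j _ hj; simp [Matrix.diagonal_apply_ne' _ hj]
  · simp

/-- On real eigenvalues this is x² ≤ exp(x)² + exp(-x)². It turns a bound on a positive definite
matrix and its inverse into a bound on the logarithm, which is the source of properness of the polar
decomposition. -/
theorem nsq_le_of_hermitian {A : Mat n} (hA : Aᴴ = A) :
    nsq A ≤ nsq (NormedSpace.exp A) + nsq (NormedSpace.exp (-A)) := by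
  obtain ⟨u, hu, d, hd⟩ := exists_unitary_diag hA
  have hd' : cj u (-A) = rdiag (-d) := by
    rw [map_neg, hd, ← neg_one_smul ℝ (rdiag d), smul_rdiag]; simp
  rw [← nsq_cj_unitary hu A, ← nsq_cj_unitary hu (NormedSpace.exp A),
    ← nsq_cj_unitary hu (NormedSpace.exp (-A)), cj_exp, cj_exp, hd, hd', exp_rdiag, exp_rdiag,
    nsq_rdiag, nsq_rdiag, nsq_rdiag, ← Finset.sum_add_distrib]
  refine Finset.sum_le_sum fun i _ => ?_
  have h1 := Real.add_one_le_exp (d i)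
  have h2 := Real.add_one_le_exp (-d i)
  have p1 := Real.exp_pos (d i)
  have p2 := Real.exp_pos (-d i)
  simp only [Pi.neg_apply]
  rcases le_total 0 (d i) with h | h <;> nlinarith

/-- The real exponential is injective, so A and exp A have the same eigenspaces. -/
theorem commute_of_commute_exp {A S : Mat n} (hA : Aᴴ = A)
    (h : Commute S (NormedSpace.exp A)) : Commute S A := by
  obtain ⟨u, hu, d, hd⟩ := exists_unitary_diag hA
  have h1 : cj u S * rdiag (fun i => Real.exp (d i)) = rdiag (fun i => Real.exp (d i)) * cj u S := by
    rw [← exp_rdiag, ← hd, ← cj_exp, ← map_mul, h.eq, map_mul]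
  apply (cj u).injective
  rw [map_mul, map_mul, hd]
  ext i j
  have h2 := congrFun (congrFun h1 i) j
  rw [mul_rdiag_apply, rdiag_mul_apply] at h2 ⊢
  by_cases hij : d i = d j
  · rw [hij, mul_comm]
  · have h3 : cj u S i j * ((Real.exp (d j) : ℂ) - (Real.exp (d i) : ℂ)) = 0 := by
      rw [mul_sub, h2]; ring
    have h4 : ((Real.exp (d j) : ℂ) - (Real.exp (d i) : ℂ)) ≠ 0 := by
      rw [sub_ne_zero]
      intro h5
      exact hij (Real.exp_injective (Complex.ofReal_injective h5)).symm
    simp [(mul_eq_zero.1 h3).resolve_right h4]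

open scoped Matrix.Norms.Operator in
theorem hasDerivAt_exp_smul_apply (A : Mat n) (i j : Fin n) :
    HasDerivAt (fun t : ℝ => NormedSpace.exp (t • A) i j) (A i j) 0 := by
  have h1 := hasDerivAt_exp_smul_const (𝕂 := ℝ) A (0 : ℝ)
  let L : Mat n →ₗ[ℝ] ℂ :=
    { toFun := fun A => A i j, map_add' := fun _ _ => rfl, map_smul' := fun _ _ => rfl }
  have h2 := (LinearMap.toContinuousLinearMap L).hasFDerivAt.comp_hasDerivAt (0 : ℝ) h1
  simpa [L] using! h2

/-- Differentiate exp(tAᴴ) exp(tA) = 1 at t = 0, entry by entry. -/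
theorem conjTranspose_eq_neg_of_expGL_mem_unitaryGL {A : Mat n}
    (h : ∀ t : ℝ, expGL (t • A) ∈ unitaryGL n) : Aᴴ = -A := by
  ext i j
  have h3 : HasDerivAt (fun t : ℝ => ∑ k, NormedSpace.exp (t • Aᴴ) i k *
      NormedSpace.exp (t • A) k j) (∑ k, (Aᴴ i k * NormedSpace.exp ((0 : ℝ) • A) k j +
        NormedSpace.exp ((0 : ℝ) • Aᴴ) i k * A k j)) 0 :=
    HasDerivAt.fun_sum fun k _ =>
      (hasDerivAt_exp_smul_apply Aᴴ i k).mul (hasDerivAt_exp_smul_apply A k j)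
  have h4 : (fun t : ℝ => ∑ k, NormedSpace.exp (t • Aᴴ) i k * NormedSpace.exp (t • A) k j) =
      fun _ => (1 : Mat n) i j := by
    ext1 t
    have := mem_unitaryGL.1 (h t)
    rw [coe_expGL, ← Matrix.exp_conjTranspose, Matrix.conjTranspose_smul, star_trivial] at this
    rw [← this, Matrix.mul_apply]
  rw [h4] at h3
  have := h3.unique (hasDerivAt_const _ _)
  simp only [zero_smul, NormedSpace.exp_zero, Finset.sum_add_distrib, ← Matrix.mul_apply, mul_one,
    one_mul] at this
  exact eq_neg_of_add_eq_zero_left this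

/-! ### Compact linear groups are unitarizable -/

theorem exists_invariant_form {K : Subgroup (GL (Fin n) ℂ)}
    (hK : IsCompact (K : Set (GL (Fin n) ℂ))) :
    ∃ M : Mat n, Mᴴ = M ∧ (∀ k ∈ K, (k : Mat n)ᴴ * M * k = M) ∧
      ∀ A : Mat n, A ≠ 0 → 0 < (Aᴴ * M * A).trace.re := by
  open scoped Matrix.Norms.Operator in
  have : CompactSpace K := isCompact_iff_compactSpace.1 hK
  let _ : MeasurableSpace K := borel K
  have : BorelSpace K := ⟨rfl⟩
  let μ : MeasureTheory.Measure K := MeasureTheory.Measure.haar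
  -- The inverse makes gᴴ f(k) g equal to f(g⁻¹k), so left invariance of Haar measure suffices.
  let f : K → Mat n := fun k => ((k⁻¹ : K) : GL (Fin n) ℂ).valᴴ * ((k⁻¹ : K) : GL (Fin n) ℂ).val
  have hf : Continuous f := by
    have : Continuous fun k : K => ((k⁻¹ : K) : GL (Fin n) ℂ).val :=
      Units.continuous_val.comp (continuous_subtype_val.comp continuous_inv)
    exact this.matrix_conjTranspose.mul this
  have hint : ∀ {F : Type} [NormedAddCommGroup F] (f : K → F), Continuous f →
      MeasureTheory.Integrable f μ := fun f hf =>
    hf.integrable_of_hasCompactSupport (HasCompactSupport.of_compactSpace f)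
  let M : Mat n := ∫ k, f k ∂μ
  have hlin : ∀ A B : Mat n, A * M * B = ∫ k, A * f k * B ∂μ := by
    intro A B
    let L : Mat n →ₗ[ℂ] Mat n := LinearMap.mulRight ℂ B ∘ₗ LinearMap.mulLeft ℂ A
    exact ((LinearMap.toContinuousLinearMap L).integral_comp_comm (hint f hf)).symm
  have htr : ∀ A B : Mat n, (A * M * B).trace.re = ∫ k, (A * f k * B).trace.re ∂μ := by
    intro A B
    let L : Mat n →ₗ[ℝ] ℝ := Complex.reLm ∘ₗ
      ((Matrix.traceLinearMap (Fin n) ℂ ℂ ∘ₗ LinearMap.mulRight ℂ B ∘ₗ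
        LinearMap.mulLeft ℂ A).restrictScalars ℝ)
    exact ((LinearMap.toContinuousLinearMap L).integral_comp_comm (hint f hf)).symm
  refine ⟨M, ?_, ?_, ?_⟩
  · let L : Mat n →ₗ[ℝ] Mat n :=
      { toFun := fun A => Aᴴ
        map_add' := fun A B => Matrix.conjTranspose_add A B
        map_smul' := fun r A => by simp [Matrix.conjTranspose_smul] }
    have h1 : Mᴴ = ∫ k, (f k)ᴴ ∂μ :=
      ((LinearMap.toContinuousLinearMap L).integral_comp_comm (hint f hf)).symm
    rw [h1]
    refine MeasureTheory.integral_congr_ae (Filter.Eventually.of_forall fun k => ?_)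
    simp [f]
  · intro g hg
    rw [hlin]
    have h1 := MeasureTheory.integral_mul_left_eq_self (μ := μ)
      (fun k : K => (g : Mat n)ᴴ * f k * g) ⟨g, hg⟩
    rw [← h1]
    refine MeasureTheory.integral_congr_ae (Filter.Eventually.of_forall fun k => ?_)
    have h2 : (((⟨g, hg⟩ * k : K)⁻¹ : K) : GL (Fin n) ℂ).val * (g : Mat n) =
        ((k⁻¹ : K) : GL (Fin n) ℂ).val := by
      rw [← Units.val_mul]
      congr 1
      simp
    change (g : Mat n)ᴴ * (_ᴴ * _) * (g : Mat n) = _ᴴ * _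
    rw [mul_assoc, mul_assoc, h2, ← mul_assoc, ← Matrix.conjTranspose_mul, h2]
  · intro A hA
    rw [htr]
    have h1 : ∀ k, (Aᴴ * f k * A).trace.re = nsq (((k⁻¹ : K) : GL (Fin n) ℂ).val * A) := by
      intro k
      have : Aᴴ * f k * A = (((k⁻¹ : K) : GL (Fin n) ℂ).val * A)ᴴ *
          (((k⁻¹ : K) : GL (Fin n) ℂ).val * A) := by
        simp only [f, Matrix.conjTranspose_mul, mul_assoc]
      rw [this, trace_conjTranspose_mul, Complex.ofReal_re]
    simp only [h1]
    have hcont : Continuous fun k : K => nsq (((k⁻¹ : K) : GL (Fin n) ℂ).val * A) := by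
      have : Continuous fun k : K => ((k⁻¹ : K) : GL (Fin n) ℂ).val :=
        Units.continuous_val.comp (continuous_subtype_val.comp continuous_inv)
      exact continuous_nsq.comp (this.mul continuous_const)
    refine hcont.integral_pos_of_hasCompactSupport_nonneg_nonzero
      (HasCompactSupport.of_compactSpace _) (fun k => nsq_nonneg _) (x := 1) ?_
    simpa [nsq_eq_zero] using hA

/-- A positive definite K-invariant M factors as mᴴ m, and conjugation by m carries its isometries
to unitary matrices. -/
theorem exists_unitarizer {K : Subgroup (GL (Fin n) ℂ)}
    (hK : IsCompact (K : Set (GL (Fin n) ℂ))) :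
    ∃ m : GL (Fin n) ℂ, ∀ k ∈ K, m * k * m⁻¹ ∈ unitaryGL n := by
  obtain ⟨M, hM, hinv, hpos⟩ := exists_invariant_form hK
  obtain ⟨u, hu, d, hd⟩ := exists_unitary_diag hM
  have hd0 : ∀ i, 0 < d i := by
    intro i
    let A : Mat n := ((u⁻¹ : GL (Fin n) ℂ) : Mat n) * Matrix.single i i 1
    have hA : A ≠ 0 := by
      intro h
      have h2 : (u : Mat n) * A = 0 := by rw [h, mul_zero]
      rw [← mul_assoc, Units.mul_inv, one_mul] at h2
      simpa using congrFun (congrFun h2 i) i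
    have h1 := hpos A hA
    have h2 : Aᴴ * M * A = (Matrix.single i i 1)ᴴ * rdiag d * Matrix.single i i 1 := by
      rw [← hd, cj_apply, Matrix.conjTranspose_mul, coe_inv_of_mem_unitaryGL hu,
        Matrix.conjTranspose_conjTranspose]
      simp only [A, mul_assoc, coe_inv_of_mem_unitaryGL hu]
    rw [h2] at h1
    simpa [rdiag, Matrix.trace] using h1
  -- The square root of the diagonal form of M, written as an exponential so that it is visibly
  -- invertible.
  let r : GL (Fin n) ℂ := expGL (rdiag fun i => Real.log (d i) / 2)
  have hr : (r : Mat n) = rdiag fun i => Real.sqrt (d i) := by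
    rw [coe_expGL, exp_rdiag]
    congr 1; ext i
    rw [Real.sqrt_eq_rpow, Real.rpow_def_of_pos (hd0 i)]
    ring_nf
  have hrr : (r : Mat n)ᴴ * r = rdiag d := by
    rw [hr, rdiag_conjTranspose]
    ext i j
    rw [mul_rdiag_apply]
    by_cases h : i = j
    · subst h
      simp only [rdiag, Matrix.diagonal_apply_eq, ← Complex.ofReal_mul,
        Real.mul_self_sqrt (hd0 i).le]
    · simp [rdiag, h]
  have hMr : ((r * u : GL (Fin n) ℂ) : Mat n)ᴴ * ((r * u : GL (Fin n) ℂ) : Mat n) = M := by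
    rw [Units.val_mul, Matrix.conjTranspose_mul, mul_assoc, ← mul_assoc (r : Mat n)ᴴ, hrr, ← hd,
      ← coe_inv_of_mem_unitaryGL hu, ← mul_assoc]
    have := cj_inv_cj u M
    rwa [cj_apply, inv_inv] at this
  refine ⟨r * u, fun k hk => ?_⟩
  set m := r * u
  rw [mem_unitaryGL, Units.val_mul, Units.val_mul, Matrix.conjTranspose_mul,
    Matrix.conjTranspose_mul]
  calc _ = ((m⁻¹ : GL (Fin n) ℂ) : Mat n)ᴴ * ((k : Mat n)ᴴ * ((m : Mat n)ᴴ * m) * k) *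
        ((m⁻¹ : GL (Fin n) ℂ) : Mat n) := by simp only [mul_assoc]
    _ = ((m : Mat n) * ((m⁻¹ : GL (Fin n) ℂ) : Mat n))ᴴ *
        ((m : Mat n) * ((m⁻¹ : GL (Fin n) ℂ) : Mat n)) := by
        rw [hMr, hinv k hk, ← hMr, Matrix.conjTranspose_mul]
        simp only [mul_assoc]
    _ = 1 := by rw [Units.mul_inv]; simp

end GHiggs

/-! ### Compact forms: closedness of G, conjugacy and maximality. -/

namespace GHiggs

variable {n : ℕ}

/-! ### Polar decompositions and maximal compact subgroups -/

/-- `c` polarizes `G`: after conjugation by `c`, every element of `G` is the product of a unitary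
element of `G` and the exponential of a Hermitian element of its Lie algebra. -/
def IsPolar (G : ComplexReductiveGroup n) (c : GL (Fin n) ℂ) : Prop :=
  ∀ g ∈ G.carrier, ∃ k ∈ G.carrier, c * k * c⁻¹ ∈ unitaryGL n ∧
    ∃ Y ∈ G.lie, (cj c Y)ᴴ = cj c Y ∧ g = k * expGL Y

/-- The elements of `G` that become unitary after conjugation by `c`. -/
def unitaryForm (G : ComplexReductiveGroup n) (c : GL (Fin n) ℂ) : Subgroup (GL (Fin n) ℂ) :=
  G.carrier ⊓ (unitaryGL n).comap (MulAut.conj c).toMonoidHom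

variable {G G' : ComplexReductiveGroup n} {c : GL (Fin n) ℂ}

theorem mem_unitaryForm {g : GL (Fin n) ℂ} :
    g ∈ unitaryForm G c ↔ g ∈ G.carrier ∧ c * g * c⁻¹ ∈ unitaryGL n := Iff.rfl

theorem expGL_mem_of_mem_lie {A : Mat n} (hA : A ∈ G.lie) : expGL A ∈ G.carrier :=
  expGL_mem_of_mem_lieSet ((G.mem_lie A).1 hA)

theorem real_smul_mem_lie {A : Mat n} (hA : A ∈ G.lie) (t : ℝ) : t • A ∈ G.lie := by
  have : t • A = (t : ℂ) • A := by ext; simp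
  rw [this]
  exact G.lie.smul_mem _ hA

theorem expGL_smul_mem {A : Mat n} (hA : A ∈ G.lie) (t : ℝ) : expGL (t • A) ∈ G.carrier :=
  expGL_mem_of_mem_lie (real_smul_mem_lie hA t)

theorem cj_mem_lie {A : Mat n} (hA : A ∈ G.lie) {g : GL (Fin n) ℂ} (hg : g ∈ G.carrier) :
    cj g A ∈ G.lie :=
  (G.mem_lie _).2 (cj_mem_lieSet ((G.mem_lie A).1 hA) hg)

theorem lie_le (hG : G'.carrier ≤ G.carrier) {A : Mat n} (hA : A ∈ G'.lie) : A ∈ G.lie :=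
  (G.mem_lie A).2 (lieSet_mono hG ((G'.mem_lie A).1 hA))

theorem isClosed_lie (G : ComplexReductiveGroup n) : IsClosed {A : Mat n | A ∈ G.lie} :=
  Submodule.closed_of_finiteDimensional G.lie.toSubmodule

theorem hermitian_of_I_smul_mem_lieSet {H : Subgroup (GL (Fin n) ℂ)} {Y : Mat n}
    (hH : ∀ k ∈ H, c * k * c⁻¹ ∈ unitaryGL n) (hY : Complex.I • Y ∈ lieSet H) :
    (cj c Y)ᴴ = cj c Y := by
  have h1 : (cj c (Complex.I • Y))ᴴ = -cj c (Complex.I • Y) := by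
    refine conjTranspose_eq_neg_of_expGL_mem_unitaryGL fun t => ?_
    rw [← cj_real_smul, ← conj_expGL]
    exact hH _ (hY t)
  rw [map_smul, Matrix.conjTranspose_smul, ← smul_neg, Complex.star_def, Complex.conj_I, neg_smul,
    smul_neg, neg_inj] at h1
  exact smul_right_injective _ Complex.I_ne_zero h1

theorem skew_of_mem_lieSet {H : Subgroup (GL (Fin n) ℂ)} {Y : Mat n}
    (hH : ∀ k ∈ H, c * k * c⁻¹ ∈ unitaryGL n) (hY : Y ∈ lieSet H) :
    (cj c Y)ᴴ = -cj c Y := by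
  refine conjTranspose_eq_neg_of_expGL_mem_unitaryGL fun t => ?_
  rw [← cj_real_smul, ← conj_expGL]
  exact hH _ (hY t)

theorem I_smul_hermitian {Y : Mat n} (hY : (cj c Y)ᴴ = -cj c Y) :
    (cj c (Complex.I • Y))ᴴ = cj c (Complex.I • Y) := by
  rw [map_smul, Matrix.conjTranspose_smul, hY, Complex.star_def, Complex.conj_I, neg_smul,
    smul_neg, neg_neg]

theorem I_smul_skew {Y : Mat n} (hY : (cj c Y)ᴴ = cj c Y) :
    (cj c (Complex.I • Y))ᴴ = -cj c (Complex.I • Y) := by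
  rw [map_smul, Matrix.conjTranspose_smul, hY, Complex.star_def, Complex.conj_I, neg_smul]

theorem isPolar_of_compact_form {H : Subgroup (GL (Fin n) ℂ)} (hHG : H ≤ G.carrier)
    (hH : ∀ k ∈ H, c * k * c⁻¹ ∈ unitaryGL n)
    (hG : ∀ g ∈ G.carrier, ∃ k ∈ H, ∃ Y ∈ lieSet H, g = k * expGL (Complex.I • Y)) :
    IsPolar G c := by
  intro g hg
  obtain ⟨k, hk, Y, hY, rfl⟩ := hG g hg
  exact ⟨k, hHG hk, hH k hk, _, G.lie.smul_mem _ ((G.mem_lie Y).2 (lieSet_mono hHG hY)),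
    I_smul_hermitian (skew_of_mem_lieSet hH hY), rfl⟩

theorem exists_isPolar (G : ComplexReductiveGroup n) : ∃ c, IsPolar G c := by
  obtain ⟨H, hHG, hc, hG⟩ := G.exists_compact_form
  obtain ⟨c, hH⟩ := exists_unitarizer hc
  exact ⟨c, isPolar_of_compact_form hHG hH hG⟩

theorem coe_conj_mul_exp (k : GL (Fin n) ℂ) (Y : Mat n) :
    ((c * (k * expGL Y) * c⁻¹ : GL (Fin n) ℂ) : Mat n) =
      ((c * k * c⁻¹ : GL (Fin n) ℂ) : Mat n) * NormedSpace.exp (cj c Y) := by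
  rw [← coe_expGL, ← Units.val_mul, ← conj_expGL]
  congr 1; group

theorem coe_conj_mul_exp_inv (k : GL (Fin n) ℂ) (Y : Mat n) :
    ((c * (k * expGL Y)⁻¹ * c⁻¹ : GL (Fin n) ℂ) : Mat n) =
      NormedSpace.exp (-cj c Y) * ((c * k⁻¹ * c⁻¹ : GL (Fin n) ℂ) : Mat n) := by
  rw [← coe_expGL, ← Units.val_mul, expGL_neg, ← conj_expGL]
  congr 1; group

/-- Near a limit point g, both x and x⁻¹ are bounded, so by `nsq_le_of_hermitian` the Hermitian
factor of x stays in a compact set. Hence g lies in the closure of a subset of a compact set of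
products, and this compact set is contained in G. -/
theorem isClosed_carrier (G : ComplexReductiveGroup n) :
    IsClosed (G.carrier : Set (GL (Fin n) ℂ)) := by
  obtain ⟨H, hHG, hHc, hG⟩ := G.exists_compact_form
  obtain ⟨c, hH⟩ := exists_unitarizer hHc
  rw [← closure_subset_iff_isClosed]
  intro g hg
  have hcont1 : Continuous fun x : GL (Fin n) ℂ => nsq ((c * x * c⁻¹ : GL (Fin n) ℂ) : Mat n) :=
    continuous_nsq.comp (Units.continuous_val.comp (by fun_prop))
  have hcont2 : Continuous fun x : GL (Fin n) ℂ => nsq ((c * x⁻¹ * c⁻¹ : GL (Fin n) ℂ) : Mat n) :=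
    continuous_nsq.comp (Units.continuous_val.comp
      ((continuous_const.mul continuous_inv).mul continuous_const))
  obtain ⟨a, ha⟩ := exists_gt (nsq ((c * g * c⁻¹ : GL (Fin n) ℂ) : Mat n))
  obtain ⟨b, hb⟩ := exists_gt (nsq ((c * g⁻¹ * c⁻¹ : GL (Fin n) ℂ) : Mat n))
  let N : Set (GL (Fin n) ℂ) := {x | nsq ((c * x * c⁻¹ : GL (Fin n) ℂ) : Mat n) < a} ∩
    {x | nsq ((c * x⁻¹ * c⁻¹ : GL (Fin n) ℂ) : Mat n) < b}
  have hN : IsOpen N :=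
    (isOpen_lt hcont1 continuous_const).inter (isOpen_lt hcont2 continuous_const)
  have hgN : g ∈ N := ⟨ha, hb⟩
  let S : Set (Mat n) := (cj c⁻¹ '' {A | nsq A ≤ a + b}) ∩ {A | A ∈ G.lie}
  have hS : IsCompact S :=
    ((isCompact_nsq_le _).image (continuous_cj _)).inter_right (isClosed_lie G)
  have hI : IsCompact ((fun p : GL (Fin n) ℂ × Mat n => p.1 * expGL p.2) ''
      ((H : Set (GL (Fin n) ℂ)) ×ˢ S)) :=
    (hHc.prod hS).image (continuous_fst.mul (continuous_expGL.comp continuous_snd))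
  have hsub : N ∩ G.carrier ⊆ (fun p : GL (Fin n) ℂ × Mat n => p.1 * expGL p.2) ''
      ((H : Set (GL (Fin n) ℂ)) ×ˢ S) := by
    rintro x ⟨⟨hx1, hx2⟩, hx⟩
    obtain ⟨k, hk, Y, hY, rfl⟩ := hG x hx
    refine ⟨(k, Complex.I • Y), ⟨hk, ⟨cj c (Complex.I • Y), ?_, cj_inv_cj _ _⟩,
      G.lie.smul_mem _ ((G.mem_lie Y).2 (lieSet_mono hHG hY))⟩, rfl⟩
    rw [Set.mem_ofPred_eq, coe_conj_mul_exp, nsq_unitary_mul (hH k hk)] at hx1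
    rw [Set.mem_ofPred_eq, coe_conj_mul_exp_inv, nsq_mul_unitary (hH _ (inv_mem hk))] at hx2
    have := nsq_le_of_hermitian (I_smul_hermitian (skew_of_mem_lieSet hH hY))
    change nsq _ ≤ _
    linarith
  have h1 : g ∈ closure (N ∩ G.carrier) := hN.inter_closure ⟨hgN, hg⟩
  obtain ⟨⟨k, Y⟩, ⟨hk, -, hY⟩, rfl⟩ := (closure_minimal hsub hI.isClosed) h1
  exact G.carrier.mul_mem (hHG hk) (expGL_mem_of_mem_lie hY)

/-- This freedom allows c to be changed so that given Hermitian elements become diagonal. -/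
theorem IsPolar.unitary_mul (h : IsPolar G c) {u : GL (Fin n) ℂ} (hu : u ∈ unitaryGL n) :
    IsPolar G (u * c) := by
  intro g hg
  obtain ⟨k, hk, hkc, Y, hY, hYc, rfl⟩ := h g hg
  refine ⟨k, hk, ?_, Y, hY, ?_, rfl⟩
  · have : u * c * k * (u * c)⁻¹ = u * (c * k * c⁻¹) * u⁻¹ := by group
    rw [this]
    exact mul_mem (mul_mem hu hkc) (inv_mem hu)
  · rw [cj_mul, ← cj_conjTranspose hu, hYc]

theorem IsPolar.mul_mem (h : IsPolar G c) {γ : GL (Fin n) ℂ} (hγ : γ ∈ G.carrier) :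
    IsPolar G (c * γ) := by
  intro g hg
  obtain ⟨k, hk, hkc, Y, hY, hYc, hgk⟩ := h (γ * g * γ⁻¹)
    (G.carrier.mul_mem (G.carrier.mul_mem hγ hg) (G.carrier.inv_mem hγ))
  refine ⟨γ⁻¹ * k * γ, G.carrier.mul_mem (G.carrier.mul_mem (G.carrier.inv_mem hγ) hk) hγ, ?_,
    cj γ⁻¹ Y, cj_mem_lie hY (G.carrier.inv_mem hγ), ?_, ?_⟩
  · convert hkc using 1; group
  · rw [cj_mul, cj_cj_inv, hYc]
  · rw [← conj_expGL]
    calc g = γ⁻¹ * (γ * g * γ⁻¹) * γ := by group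
      _ = _ := by rw [hgk]; group

/-- Convexity of the squared norm along a geodesic: the second difference at a, aq, aq² is itself a
squared norm. -/
theorem nsq_midpoint {q : Mat n} (hq : qᴴ = q) (a : Mat n) :
    nsq a + nsq (a * (q * q)) - 2 * nsq (a * q) = nsq (a * (1 - q * q)) := by
  have : ((nsq a + nsq (a * (q * q)) - 2 * nsq (a * q) : ℝ) : ℂ) = nsq (a * (1 - q * q)) := by
    push_cast
    rw [← trace_mul_conjTranspose, ← trace_mul_conjTranspose, ← trace_mul_conjTranspose,
      ← trace_mul_conjTranspose, ← Matrix.trace_add, two_mul, ← Matrix.trace_add,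
      ← Matrix.trace_sub]
    congr 1
    simp only [Matrix.conjTranspose_mul, Matrix.conjTranspose_sub, hq, Matrix.conjTranspose_one]
    noncomm_ring
  exact_mod_cast this

theorem nsq_conjTranspose (A : Mat n) : nsq Aᴴ = nsq A := by
  have : ((nsq Aᴴ : ℝ) : ℂ) = nsq A := by
    rw [← trace_mul_conjTranspose, Matrix.conjTranspose_conjTranspose, trace_conjTranspose_mul]
  exact_mod_cast this

theorem nsq_midpoint_left {q : Mat n} (hq : qᴴ = q) (a : Mat n) :
    nsq a + nsq (q * q * a) - 2 * nsq (q * a) = nsq ((1 - q * q) * a) := by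
  have := nsq_midpoint hq aᴴ
  rw [← nsq_conjTranspose a, ← nsq_conjTranspose (q * q * a), ← nsq_conjTranspose (q * a),
    ← nsq_conjTranspose ((1 - q * q) * a)]
  simpa [Matrix.conjTranspose_mul, hq, Matrix.conjTranspose_sub] using this

/-- Every compact subgroup of `G` is conjugate in `G` to a group of unitary elements. -/
theorem IsPolar.exists_conj (h : IsPolar G c) {K : Subgroup (GL (Fin n) ℂ)}
    (hK : IsCompact (K : Set (GL (Fin n) ℂ))) (hKG : K ≤ G.carrier) :
    ∃ γ ∈ G.carrier, ∀ k ∈ K, (c * γ) * k * (c * γ)⁻¹ ∈ unitaryGL n := by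
  obtain ⟨m, hm⟩ := exists_unitarizer hK
  -- Cartan's fixed point argument: Φ is proper on G, invariant under left multiplication by K and
  -- convex along geodesics g exp(tY) with `cj c Y` Hermitian. A minimiser g₀ provides the
  -- conjugating element g₀⁻¹.
  let Φ : GL (Fin n) ℂ → ℝ := fun g => nsq ((m * g * c⁻¹ : GL (Fin n) ℂ) : Mat n) +
    nsq (((m * g * c⁻¹)⁻¹ : GL (Fin n) ℂ) : Mat n)
  have hΦ : Continuous Φ :=
    (continuous_nsq.comp (Units.continuous_val.comp (by fun_prop))).add
      (continuous_nsq.comp (Units.continuous_val.comp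
        ((continuous_const.mul continuous_id).mul continuous_const).inv))
  let S : Set (GL (Fin n) ℂ) := {g | Φ g ≤ Φ 1} ∩ G.carrier
  have hS : IsCompact S := by
    have h1 : IsCompact ((fun x : GL (Fin n) ℂ => m⁻¹ * x * c) ''
        {g : GL (Fin n) ℂ | nsq (g : Mat n) ≤ Φ 1 ∧ nsq ((g⁻¹ : GL (Fin n) ℂ) : Mat n) ≤ Φ 1}) :=
      (isCompact_GL_nsq_le _ _).image (by fun_prop)
    refine h1.of_isClosed_subset
      ((isClosed_le hΦ continuous_const).inter (isClosed_carrier G)) ?_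
    rintro g ⟨hg, -⟩
    have hg' : nsq ((m * g * c⁻¹ : GL (Fin n) ℂ) : Mat n) +
      nsq (((m * g * c⁻¹)⁻¹ : GL (Fin n) ℂ) : Mat n) ≤ Φ 1 := hg
    refine ⟨m * g * c⁻¹, ⟨?_, ?_⟩, by group⟩
    · linarith [nsq_nonneg (((m * g * c⁻¹)⁻¹ : GL (Fin n) ℂ) : Mat n)]
    · linarith [nsq_nonneg ((m * g * c⁻¹ : GL (Fin n) ℂ) : Mat n)]
  obtain ⟨g₀, hg₀S, hmin⟩ := hS.exists_isMinOn ⟨1, (le_refl (Φ 1) : Φ 1 ≤ Φ 1), G.carrier.one_mem⟩ hΦ.continuousOn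
  have hg₀ : g₀ ∈ G.carrier := hg₀S.2
  have hmin' : ∀ g ∈ G.carrier, Φ g₀ ≤ Φ g := by
    intro g hg
    by_cases h1 : Φ g ≤ Φ 1
    · exact hmin ⟨h1, hg⟩
    · exact hg₀S.1.trans (not_le.1 h1).le
  have hinv : ∀ k ∈ K, ∀ g, Φ (k * g) = Φ g := by
    intro k hk g
    have e1 : m * (k * g) * c⁻¹ = (m * k * m⁻¹) * (m * g * c⁻¹) := by group
    simp only [Φ]
    rw [e1, mul_inv_rev, Units.val_mul (m * k * m⁻¹), Units.val_mul (m * g * c⁻¹)⁻¹, nsq_unitary_mul (hm k hk),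
      nsq_mul_unitary (inv_mem (hm k hk))]
  refine ⟨g₀⁻¹, G.carrier.inv_mem hg₀, fun k hk => ?_⟩
  obtain ⟨k', hk', hk'c, Y, hY, hYc, hk'Y⟩ := h (g₀⁻¹ * k * g₀)⁻¹ (G.carrier.inv_mem
    (G.carrier.mul_mem (G.carrier.mul_mem (G.carrier.inv_mem hg₀) (hKG hk)) hg₀))
  -- the polar decomposition, with the factors in the opposite order
  have hpol : k * g₀ = g₀ * expGL (-Y) * k'⁻¹ := by
    have : g₀⁻¹ * k * g₀ = expGL (-Y) * k'⁻¹ := by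
      rw [expGL_neg, ← mul_inv_rev, ← hk'Y, inv_inv]
    rw [mul_assoc, ← this]; group
  set y := cj c Y
  set q : Mat n := NormedSpace.exp ((1 / 2 : ℝ) • (-y))
  have hq : qᴴ = q := by
    rw [← Matrix.exp_conjTranspose, Matrix.conjTranspose_smul, Matrix.conjTranspose_neg, hYc]
    simp [q]
  -- Up to a unitary factor on the right, which Φ ignores, g₀e is the midpoint of the geodesic from
  -- g₀ to kg₀.
  set e := expGL ((1 / 2 : ℝ) • (-Y))
  have hee : e * e = expGL (-Y) := by
    rw [← expGL_add_smul]; norm_num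
  have heq : ((c * e * c⁻¹ : GL (Fin n) ℂ) : Mat n) = q := by
    rw [conj_expGL, cj_real_smul, map_neg]; rfl
  set r : Mat n := ((c * e⁻¹ * c⁻¹ : GL (Fin n) ℂ) : Mat n)
  have hr : rᴴ = r := by
    have : r = NormedSpace.exp (-((1 / 2 : ℝ) • (-y))) := by
      simp only [r, e]
      rw [← expGL_neg, conj_expGL, map_neg, cj_real_smul, map_neg]; rfl
    rw [this, ← Matrix.exp_conjTranspose, Matrix.conjTranspose_neg, Matrix.conjTranspose_smul,
      Matrix.conjTranspose_neg, hYc]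
    simp
  set a : Mat n := ((m * g₀ * c⁻¹ : GL (Fin n) ℂ) : Mat n)
  set b : Mat n := (((m * g₀ * c⁻¹)⁻¹ : GL (Fin n) ℂ) : Mat n)
  have hΦ0 : Φ g₀ = nsq a + nsq b := rfl
  have hΦ1 : Φ (k * g₀) = nsq (a * (q * q)) + nsq (r * r * b) := by
    have e1 : m * (k * g₀) * c⁻¹ = (m * g₀ * c⁻¹) * ((c * e * c⁻¹) * (c * e * c⁻¹)) *
        (c * k'⁻¹ * c⁻¹) := by
      rw [hpol, ← hee]; group
    have e2 : (m * (k * g₀) * c⁻¹)⁻¹ = (c * k' * c⁻¹) * ((c * e⁻¹ * c⁻¹) * (c * e⁻¹ * c⁻¹) *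
        (m * g₀ * c⁻¹)⁻¹) := by
      rw [e1]; group
    simp only [Φ]
    rw [e2, e1, Units.val_mul _ (c * k'⁻¹ * c⁻¹),
      nsq_mul_unitary (by simpa [mul_assoc] using inv_mem hk'c), Units.val_mul (m * g₀ * c⁻¹),
      Units.val_mul (c * e * c⁻¹), heq, Units.val_mul (c * k' * c⁻¹), nsq_unitary_mul hk'c,
      Units.val_mul _ (m * g₀ * c⁻¹)⁻¹, Units.val_mul (c * e⁻¹ * c⁻¹)]
  have hΦm : Φ (g₀ * e) = nsq (a * q) + nsq (r * b) := by
    have e1 : m * (g₀ * e) * c⁻¹ = (m * g₀ * c⁻¹) * (c * e * c⁻¹) := by group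
    have e2 : (m * (g₀ * e) * c⁻¹)⁻¹ = (c * e⁻¹ * c⁻¹) * (m * g₀ * c⁻¹)⁻¹ := by group
    simp only [Φ]
    rw [e2, e1, Units.val_mul _ (c * e * c⁻¹), heq, Units.val_mul _ (m * g₀ * c⁻¹)⁻¹]
  have he : e ∈ G.carrier := expGL_mem_of_mem_lie (real_smul_mem_lie (G.lie.neg_mem hY) _)
  have hle := hmin' _ (G.carrier.mul_mem hg₀ he)
  have heqΦ := hinv k hk g₀
  have m1 := nsq_midpoint hq a
  have m2 := nsq_midpoint_left hr b
  have p1 := nsq_nonneg (a * (1 - q * q))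
  have p2 := nsq_nonneg ((1 - r * r) * b)
  -- Both endpoints g₀ and kg₀ attain the minimum and the midpoint is not below it, so the second
  -- difference, a sum of two non-negative terms, vanishes.
  have hz : nsq (a * (1 - q * q)) = 0 := by linarith
  have hz2 : 1 - q * q = 0 := by
    have h1 : a * (1 - q * q) = 0 := nsq_eq_zero.1 hz
    have h2 : b * (a * (1 - q * q)) = 0 := by rw [h1, mul_zero]
    rwa [← mul_assoc, Units.inv_mul, one_mul] at h2
  have hexp : expGL (-Y) = 1 := by
    have h1 : (c * e * c⁻¹) * (c * e * c⁻¹) = 1 := by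
      ext1
      rw [Units.val_mul, heq, Units.val_one]
      exact (sub_eq_zero.1 hz2).symm
    rw [← hee]
    calc e * e = c⁻¹ * ((c * e * c⁻¹) * (c * e * c⁻¹)) * c := by group
      _ = 1 := by rw [h1]; group
  have hfin : c * g₀⁻¹ * k * (c * g₀⁻¹)⁻¹ = (c * k' * c⁻¹)⁻¹ := by
    have h1 : g₀⁻¹ * (k * g₀) = k'⁻¹ := by rw [hpol, hexp]; group
    calc _ = c * (g₀⁻¹ * (k * g₀)) * c⁻¹ := by group
      _ = _ := by rw [h1]; group
  rw [hfin]
  exact inv_mem hk'c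

theorem isCompact_unitaryForm (G : ComplexReductiveGroup n) (c : GL (Fin n) ℂ) :
    IsCompact (unitaryForm G c : Set (GL (Fin n) ℂ)) := by
  have h1 : IsCompact ((fun x : GL (Fin n) ℂ => c⁻¹ * x * c) ''
      (unitaryGL n : Set (GL (Fin n) ℂ))) := isCompact_unitaryGL.image (by fun_prop)
  refine h1.of_isClosed_subset ?_ ?_
  · exact (isClosed_carrier G).inter (isClosed_unitaryGL.preimage
      (f := fun x : GL (Fin n) ℂ => c * x * c⁻¹) (by fun_prop))
  · rintro g ⟨-, hg⟩
    exact ⟨c * g * c⁻¹, hg, by group⟩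

theorem I_smul_mem_lieSet_unitaryForm {s : Mat n} (hs : s ∈ G.lie) (h : (cj c s)ᴴ = cj c s) :
    Complex.I • s ∈ lieSet (unitaryForm G c) := by
  intro t
  refine ⟨expGL_smul_mem (G.lie.smul_mem _ hs) t, ?_⟩
  change c * _ * c⁻¹ ∈ unitaryGL n
  rw [conj_expGL, cj_real_smul]
  refine expGL_mem_unitaryGL ?_
  rw [Matrix.conjTranspose_smul, I_smul_skew h]
  simp

/-- If a larger compact group contained k exp Y, it would contain all powers of exp Y. These are
unbounded in at least one direction unless Y = 0. -/
theorem IsPolar.isMaximalCompact (h : IsPolar G c) :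
    IsMaximalCompact G.carrier (unitaryForm G c) := by
  refine ⟨⟨inf_le_left, isCompact_unitaryForm G c⟩, ?_⟩
  rintro K ⟨hKG, hK⟩ hle g hg
  obtain ⟨k, hk, hkc, Y, hY, hYc, rfl⟩ := h g (hKG hg)
  have hYK : expGL Y ∈ K := by
    have := K.mul_mem (K.inv_mem (hle (mem_unitaryForm.2 ⟨hk, hkc⟩))) hg
    simpa using this
  have hb : ∃ C : ℝ, ∀ x ∈ K, nsq (cj c x) ≤ C := by
    obtain ⟨C, hC⟩ := (hK.image_of_continuousOn (f := fun x : GL (Fin n) ℂ => nsq (cj c x))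
      (continuous_nsq.comp ((continuous_cj c).comp Units.continuous_val)).continuousOn).bddAbove
    exact ⟨C, fun x hx => hC ⟨x, hx, rfl⟩⟩
  obtain ⟨C, hC⟩ := hb
  have hY0 : nsq (cj c Y) = 0 := by
    by_contra hne
    have hpos : 0 < nsq (cj c Y) := lt_of_le_of_ne (nsq_nonneg _) (Ne.symm hne)
    -- The squared norm of (N+1)Y grows quadratically in N, while the exponentials of ±(N+1)Y lie in
    -- K and contribute at most C each.
    obtain ⟨N, hN⟩ := exists_nat_gt ((C + C) / nsq (cj c Y))
    rw [div_lt_iff₀ hpos] at hN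
    have hN1 : (1 : ℝ) ≤ (N : ℝ) + 1 := by linarith [N.cast_nonneg (α := ℝ)]
    have h1 := nsq_le_of_hermitian (A := ((N : ℝ) + 1) • cj c Y) (by
      rw [Matrix.conjTranspose_smul, hYc, star_trivial])
    have e1 : ((N : ℝ) + 1) • cj c Y = cj c ((N + 1 : ℕ) • Y) := by
      rw [map_nsmul, ← Nat.cast_smul_eq_nsmul ℝ]; push_cast; rfl
    have e2 : NormedSpace.exp (cj c ((N + 1 : ℕ) • Y)) = cj c ((expGL Y ^ (N + 1)  :
        GL (Fin n) ℂ) : Mat n) := by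
      rw [← expGL_nsmul, coe_expGL, cj_exp]
    have e3 : NormedSpace.exp (-cj c ((N + 1 : ℕ) • Y)) = cj c (((expGL Y ^ (N + 1))⁻¹  :
        GL (Fin n) ℂ) : Mat n) := by
      rw [← expGL_nsmul, ← expGL_neg, coe_expGL, cj_exp, map_neg]
    have h2 := hC _ (K.pow_mem hYK (N + 1))
    have h3 := hC _ (K.inv_mem (K.pow_mem hYK (N + 1)))
    rw [nsq_smul, e1, e2, e3] at h1
    have h4 : (N : ℝ) * nsq (cj c Y) ≤ ((N : ℝ) + 1) ^ 2 * nsq (cj c Y) :=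
      mul_le_mul_of_nonneg_right (by nlinarith [N.cast_nonneg (α := ℝ)]) hpos.le
    linarith
  have : Y = 0 := (cj c).injective (by rw [nsq_eq_zero.1 hY0, map_zero])
  rw [this, expGL_zero, mul_one]
  exact ⟨hk, hkc⟩

theorem IsPolar.mem_iCompact (h : IsPolar G c) {s : Mat n} (hs : s ∈ G.lie)
    (hsc : (cj c s)ᴴ = cj c s) : s ∈ iCompact G.carrier :=
  ⟨_, h.isMaximalCompact, I_smul_mem_lieSet_unitaryForm hs hsc⟩

/-- A compact form of `G'` is contained in a compact form of `G`; the former can be chosen so that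
a given element of `i 𝔥'` is Hermitian. -/
theorem exists_common_isPolar (hG : G'.carrier ≤ G.carrier) {s : Mat n}
    (hs : s ∈ iCompact G'.carrier) :
    ∃ c, IsPolar G c ∧ IsPolar G' c ∧ (cj c s)ᴴ = cj c s := by
  obtain ⟨H, hH, hsH⟩ := hs
  obtain ⟨c₀, hc₀⟩ := exists_isPolar G'
  obtain ⟨γ, hγ, hγH⟩ := hc₀.exists_conj hH.prop.2 hH.prop.1
  have hc₁ := hc₀.mul_mem hγ
  -- Maximality of H forces it to contain the unitary form into which it has been conjugated.
  have hle : unitaryForm G' (c₀ * γ) ≤ H :=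
    hH.2 ⟨inf_le_left, isCompact_unitaryForm _ _⟩ fun k hk => ⟨hH.prop.1 hk, hγH k hk⟩
  obtain ⟨c₂, hc₂⟩ := exists_isPolar G
  obtain ⟨δ, hδ, hδH⟩ := hc₂.exists_conj hH.prop.2 (hH.prop.1.trans hG)
  -- The polar decomposition of G' with respect to c₀γ serves for c₂δ too: its factors come from H
  -- and i Lie H, and c₂δ makes H unitary.
  refine ⟨c₂ * δ, hc₂.mul_mem hδ, ?_, hermitian_of_I_smul_mem_lieSet hδH hsH⟩
  intro g hg
  obtain ⟨k, hk, hkc, Y, hY, hYc, rfl⟩ := hc₁ g hg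
  exact ⟨k, hk, hδH k (hle ⟨hk, hkc⟩), Y, hY, hermitian_of_I_smul_mem_lieSet hδH
    (lieSet_mono hle (I_smul_mem_lieSet_unitaryForm hY hYc)), rfl⟩

/-- The maximal compact subgroup behind α may differ from the one belonging to c. The conjugating
element is k exp Y, where exp Y fixes the central α and k is unitary with respect to c, so being
Hermitian is preserved. -/
theorem IsPolar.hermitian_of_central (h : IsPolar G c) {α : Mat n}
    (hα : α ∈ iCompact G.carrier) (hcen : ∀ w ∈ G.lie, Commute w α) :
    (cj c α)ᴴ = cj c α := by
  obtain ⟨H, hH, hαH⟩ := hα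
  obtain ⟨γ, hγ, hγH⟩ := h.exists_conj hH.prop.2 hH.prop.1
  have h1 := hermitian_of_I_smul_mem_lieSet hγH hαH
  obtain ⟨k, hk, hkc, Y, hY, -, rfl⟩ := h γ hγ
  have h2 : cj (c * (k * expGL Y)) α = cj (c * k * c⁻¹) (cj c α) := by
    rw [← cj_mul, cj_mul, cj_mul, cj_expGL_of_commute (hcen Y hY), ← cj_mul]
    congr 2; group
  rw [h2, ← cj_conjTranspose hkc] at h1
  exact (cj _).injective h1

end GHiggs

/-! ### The adjoint, the trace form, the Killing form and weight components. -/

namespace GHiggs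

variable {n : ℕ} {G G' : ComplexReductiveGroup n} {c : GL (Fin n) ℂ}

/-! ### The Hermitian adjoint on the Lie algebra -/

/-- The conjugate transpose with respect to the Hermitian form that `c` makes standard. -/
noncomputable def dag (c : GL (Fin n) ℂ) (A : Mat n) : Mat n := cj c⁻¹ (cj c A)ᴴ

theorem cj_dag (c : GL (Fin n) ℂ) (A : Mat n) : cj c (dag c A) = (cj c A)ᴴ := cj_cj_inv _ _

@[simp] theorem dag_dag (A : Mat n) : dag c (dag c A) = A := by
  rw [dag, cj_dag, Matrix.conjTranspose_conjTranspose, cj_inv_cj]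

theorem dag_mul (A B : Mat n) : dag c (A * B) = dag c B * dag c A := by
  simp [dag, Matrix.conjTranspose_mul]

theorem dag_add (A B : Mat n) : dag c (A + B) = dag c A + dag c B := by simp [dag]

theorem dag_sub (A B : Mat n) : dag c (A - B) = dag c A - dag c B := by simp [dag]

theorem dag_real_smul (t : ℝ) (A : Mat n) : dag c (t • A) = t • dag c A := by
  simp [dag, cj_real_smul, Matrix.conjTranspose_smul]

theorem dag_lie (A B : Mat n) : dag c ⁅A, B⁆ = ⁅dag c B, dag c A⁆ := by
  simp only [LieRing.of_associative_ring_bracket, dag_sub, dag_mul]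

theorem dag_eq_self_iff {A : Mat n} : dag c A = A ↔ (cj c A)ᴴ = cj c A := by
  constructor
  · intro h; rw [← cj_dag, h]
  · intro h; rw [dag, h, cj_inv_cj]

theorem trace_dag (A : Mat n) : (dag c A).trace = star A.trace := by
  rw [dag, trace_cj, Matrix.trace_conjTranspose, trace_cj]

theorem trace_mul_dag (A : Mat n) : (A * dag c A).trace = nsq (cj c A) := by
  rw [← trace_cj c, map_mul, cj_dag, trace_mul_conjTranspose]

theorem trace_dag_mul (A : Mat n) : (dag c A * A).trace = nsq (cj c A) := by
  rw [Matrix.trace_mul_comm, trace_mul_dag]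

theorem nsq_cj_eq_zero {A : Mat n} : nsq (cj c A) = 0 ↔ A = 0 := by
  rw [nsq_eq_zero, EmbeddingLike.map_eq_zero_iff]

theorem trace_lie_mul (A B C : Mat n) : (⁅A, B⁆ * C).trace = (A * ⁅B, C⁆).trace := by
  simp only [LieRing.of_associative_ring_bracket, mul_sub, sub_mul, Matrix.trace_sub]
  rw [mul_assoc B A C, Matrix.trace_mul_comm B (A * C), mul_assoc, mul_assoc]

theorem lie_eq_zero_iff_commute {A B : Mat n} : ⁅A, B⁆ = 0 ↔ Commute A B := by
  rw [LieRing.of_associative_ring_bracket, sub_eq_zero]; rfl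

/-- The adjoint of k exp Y is exp Y · k⁻¹, because k is unitary and Y Hermitian with respect to c.
-/
theorem dag_expGL_mem (h : IsPolar G c) {g : GL (Fin n) ℂ} (hg : g ∈ G.carrier) :
    ∃ g' ∈ G.carrier, (g' : Mat n) = dag c g := by
  obtain ⟨k, hk, hkc, Y, hY, hYc, rfl⟩ := h g hg
  refine ⟨expGL Y * k⁻¹, G.carrier.mul_mem (expGL_mem_of_mem_lie hY) (G.carrier.inv_mem hk), ?_⟩
  apply (cj c).injective
  rw [cj_dag, Units.val_mul, Units.val_mul, map_mul, map_mul, Matrix.conjTranspose_mul, coe_expGL,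
    cj_exp, ← Matrix.exp_conjTranspose, hYc, ← coe_conj c k, ← coe_inv_of_mem_unitaryGL hkc,
    ← coe_conj c k⁻¹]
  congr 2
  group

theorem IsPolar.dag_mem (h : IsPolar G c) {A : Mat n} (hA : A ∈ G.lie) : dag c A ∈ G.lie := by
  rw [G.mem_lie]
  intro t
  obtain ⟨g', hg', he⟩ := dag_expGL_mem h (expGL_smul_mem hA t)
  have : expGL (t • dag c A) = g' := by
    ext1
    rw [he, coe_expGL, coe_expGL, ← dag_real_smul, dag, dag, cj_exp, ← Matrix.exp_conjTranspose, cj_exp]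
  exact this ▸ hg'

/-- The adjoint, as a map of the Lie algebra to itself. -/
noncomputable def IsPolar.adj (h : IsPolar G c) (v : G.lie) : G.lie :=
  ⟨dag c v, h.dag_mem v.2⟩

@[simp] theorem IsPolar.coe_adj (h : IsPolar G c) (v : G.lie) :
    (h.adj v : Mat n) = dag c v := rfl

theorem IsPolar.adj_adj (h : IsPolar G c) (v : G.lie) : h.adj (h.adj v) = v :=
  Subtype.ext (dag_dag _)

theorem IsPolar.adj_lie (h : IsPolar G c) (v w : G.lie) :
    h.adj ⁅v, w⁆ = ⁅h.adj w, h.adj v⁆ := Subtype.ext (dag_lie _ _)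

/-- Every linear functional on the Lie algebra is represented by the trace form. -/
theorem IsPolar.exists_trace_dual (h : IsPolar G c) (ℓ : G.lie →ₗ[ℂ] ℂ) :
    ∃ a : G.lie, ∀ y : G.lie, ℓ y = ((a : Mat n) * y).trace := by
  let Φ : G.lie →ₗ[ℂ] (G.lie →ₗ[ℂ] ℂ) := LinearMap.mk₂ ℂ
    (fun a y => ((a : Mat n) * y).trace)
    (fun a b y => by simp [add_mul, Matrix.trace_add])
    (fun r a y => by simp [Matrix.trace_smul])
    (fun a b y => by simp [mul_add, Matrix.trace_add])
    (fun r a y => by simp [Matrix.trace_smul])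
  have hinj : Function.Injective Φ := by
    rw [← LinearMap.ker_eq_bot, LinearMap.ker_eq_bot']
    intro a ha
    -- Testing against the adjoint gives the squared norm of a.
    have h1 : Φ a (h.adj a) = 0 := by rw [ha]; rfl
    have h2 : ((a : Mat n) * dag c a).trace = 0 := h1
    rw [trace_mul_dag] at h2
    exact Subtype.ext (nsq_cj_eq_zero.1 (by exact_mod_cast h2))
  have hsurj : Function.Surjective Φ :=
    (LinearMap.injective_iff_surjective_of_finrank_eq_finrank
      (by rw [← Subspace.dual_finrank_eq (K := ℂ) (V := G.lie)])).1 hinj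
  obtain ⟨a, ha⟩ := hsurj ℓ
  exact ⟨a, fun y => by rw [← ha]; rfl⟩

theorem IsPolar.eq_zero_of_trace (h : IsPolar G c) {a : Mat n} (ha : a ∈ G.lie)
    (h0 : ∀ y ∈ G.lie, (a * y).trace = 0) : a = 0 := by
  have h2 := h0 _ (h.dag_mem ha)
  rw [trace_mul_dag] at h2
  exact nsq_cj_eq_zero.1 (by exact_mod_cast h2)

/-- Traces of endomorphisms of the Lie algebra, computed in an orthonormal basis. -/
theorem exists_orthonormal_basis (G : ComplexReductiveGroup n) (c : GL (Fin n) ℂ) :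
    ∃ (m : ℕ) (b : Module.Basis (Fin m) ℂ G.lie), ∀ T : G.lie →ₗ[ℂ] G.lie,
      LinearMap.trace ℂ G.lie T = ∑ i, (dag c (b i) * T (b i)).trace := by
  -- The entries after conjugation by c embed 𝔤 in a Euclidean space with inner product tr(y† z).
  let L : G.lie →ₗ[ℂ] EuclideanSpace ℂ (Fin n × Fin n) :=
    { toFun := fun x => WithLp.toLp 2 fun p => cj c x p.1 p.2
      map_add' := fun x y => by ext p; simp
      map_smul' := fun r x => by ext p; simp }
  have hL : Function.Injective L := by
    intro x y hxy
    apply Subtype.ext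
    apply (cj c).injective
    ext i j
    exact congrArg (fun v : EuclideanSpace ℂ (Fin n × Fin n) => v (i, j)) hxy
  let e : G.lie ≃ₗ[ℂ] LinearMap.range L := LinearEquiv.ofInjective L hL
  let b := stdOrthonormalBasis ℂ (LinearMap.range L)
  refine ⟨_, b.toBasis.map e.symm, fun T => ?_⟩
  have h1 := LinearMap.trace_conj' T e
  rw [← h1, LinearMap.trace_eq_sum_inner _ b]
  refine Finset.sum_congr rfl fun i => ?_
  intro _
  obtain ⟨x, hx⟩ := e.surjective (b i)
  have h2 : (b.toBasis.map e.symm) i = x := by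
    rw [Module.Basis.map_apply, OrthonormalBasis.coe_toBasis, ← hx, LinearEquiv.symm_apply_apply]
  rw [h2, ← hx, LinearEquiv.conj_apply_apply, LinearEquiv.symm_apply_apply]
  have h3 : ∀ y z : G.lie, inner ℂ (e y) (e z) = (dag c y * z).trace := by
    intro y z
    rw [← trace_cj c, map_mul, cj_dag]
    change inner ℂ (L y) (L z) = _
    simp only [L, PiLp.inner_apply, LinearMap.coe_mk, AddHom.coe_mk, RCLike.inner_apply,
      Matrix.trace, Matrix.diag, Matrix.mul_apply, Matrix.conjTranspose_apply]
    rw [Fintype.sum_prod_type, Finset.sum_comm]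
    simp only [mul_comm, Complex.star_def]
  exact h3 _ _

/-- For the inner product tr(y† z), the adjoint of ad(v) is ad(v†). -/
theorem killingForm_eq_sum {m : ℕ} {b : Module.Basis (Fin m) ℂ G.lie}
    (hb : ∀ T : G.lie →ₗ[ℂ] G.lie,
      LinearMap.trace ℂ G.lie T = ∑ i, (dag c (b i) * T (b i)).trace) (v w : G.lie) :
    killingForm ℂ G.lie v w = ∑ i, (dag c ⁅dag c v, (b i : Mat n)⁆ * ⁅(w : Mat n), (b i : Mat n)⁆).trace := by
  rw [killingForm_apply_apply, hb]
  refine Finset.sum_congr rfl fun i _ => ?_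
  rw [dag_lie, dag_dag, trace_lie_mul]
  rfl

/-- The value is the sum of the squared norms of the brackets [v†, bᵢ]. If it vanishes, v† is
central, and hence so is v. -/
theorem IsPolar.killingForm_adj (h : IsPolar G c) (v : G.lie) :
    ∃ r : ℝ, 0 ≤ r ∧ killingForm ℂ G.lie v (h.adj v) = r ∧
      (r = 0 → v ∈ LieAlgebra.center ℂ G.lie) := by
  obtain ⟨m, b, hb⟩ := exists_orthonormal_basis G c
  refine ⟨∑ i, nsq (cj c ⁅dag c v, (b i : Mat n)⁆), Finset.sum_nonneg fun _ _ => nsq_nonneg _,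
    ?_, ?_⟩
  · rw [killingForm_eq_sum hb]
    push_cast
    refine Finset.sum_congr rfl fun i _ => ?_
    rw [h.coe_adj, trace_dag_mul]
  · intro h0
    have h1 : ∀ i, ⁅h.adj v, b i⁆ = 0 := by
      intro i
      have := (Finset.sum_eq_zero_iff_of_nonneg fun _ _ => nsq_nonneg _).1 h0 i (Finset.mem_univ i)
      exact Subtype.ext (nsq_cj_eq_zero.1 this)
    have h2 : LieAlgebra.ad ℂ G.lie (h.adj v) = 0 := b.ext fun i => by simpa using h1 i
    rw [LieModule.mem_maxTrivSubmodule]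
    intro x
    have h3 : ⁅h.adj v, h.adj x⁆ = 0 := by
      rw [← LieAlgebra.ad_apply ℂ, h2]; rfl
    rw [← h.adj_lie] at h3
    have h4 := congrArg h.adj h3
    rw [h.adj_adj] at h4
    rw [h4]
    exact Subtype.ext (by simp [dag])

theorem IsPolar.killingForm_adj_adj (h : IsPolar G c) (v w : G.lie) :
    killingForm ℂ G.lie (h.adj v) (h.adj w) = star (killingForm ℂ G.lie v w) := by
  obtain ⟨m, b, hb⟩ := exists_orthonormal_basis G c
  rw [LieModule.traceForm_comm, killingForm_eq_sum hb, killingForm_eq_sum hb, star_sum]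
  refine Finset.sum_congr rfl fun i _ => ?_
  rw [← trace_dag (c := c), dag_mul, dag_dag, h.coe_adj, h.coe_adj, dag_dag]

/-! ### Weight components -/

/-- When s is diagonal, ad(s) multiplies the entry (i, j) by dᵢ - dⱼ, so A' is q(ad s) applied to A.
-/
theorem exists_polynomial_component {s A : Mat n} (hs : s ∈ G.lie) {d : Fin n → ℝ}
    (hd : cj c s = rdiag d) (hA : A ∈ G.lie) (q : Polynomial ℂ) :
    ∃ A' ∈ G.lie, ∀ i j, cj c A' i j = q.eval ((d i - d j : ℝ) : ℂ) * cj c A i j := by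
  induction q using Polynomial.induction_on' with
  | add p q hp hq =>
    obtain ⟨P, hP, hP'⟩ := hp
    obtain ⟨Q, hQ, hQ'⟩ := hq
    exact ⟨P + Q, G.lie.add_mem hP hQ, fun i j => by
      rw [map_add, Matrix.add_apply, hP', hQ', Polynomial.eval_add, add_mul]⟩
  | monomial k a =>
    induction k with
    | zero => exact ⟨a • A, G.lie.smul_mem _ hA, fun i j => by simp⟩
    | succ k ih =>
      obtain ⟨P, hP, hP'⟩ := ih
      refine ⟨⁅s, P⁆, G.lie.lie_mem hs hP, fun i j => ?_⟩
      have : cj c ⁅s, P⁆ = ⁅rdiag d, cj c P⁆ := by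
        simp only [LieRing.of_associative_ring_bracket, map_sub, map_mul, hd]
      rw [this, bracket_rdiag_apply, hP']
      simp only [Polynomial.eval_monomial]
      ring

open Classical in
/-- The Lie algebra contains the weight components of its elements. -/
theorem exists_component {s A : Mat n} (hs : s ∈ G.lie) {d : Fin n → ℝ}
    (hd : cj c s = rdiag d) (hA : A ∈ G.lie) (p : ℝ → Prop) :
    ∃ A' ∈ G.lie, ∀ i j, cj c A' i j = if p (d i - d j) then cj c A i j else 0 := by
  let S : Finset ℂ := Finset.univ.image fun x : Fin n × Fin n => ((d x.1 - d x.2 : ℝ) : ℂ)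
  -- Lagrange interpolation on the finitely many weights turns the indicator of p into a polynomial
  -- in ad(s).
  let r : ℂ → ℂ := fun z => if p z.re then 1 else 0
  obtain ⟨A', hA', h⟩ := exists_polynomial_component hs hd hA (Lagrange.interpolate S id r)
  refine ⟨A', hA', fun i j => ?_⟩
  have hmem : ((d i - d j : ℝ) : ℂ) ∈ S := Finset.mem_image.2 ⟨(i, j), Finset.mem_univ _, rfl⟩
  rw [h]
  have := Lagrange.eval_interpolate_at_node r (Set.injOn_id (S : Set ℂ)) hmem
  simp only [id] at this
  rw [this]
  simp only [r, Complex.ofReal_re]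
  split_ifs <;> simp

end GHiggs

/-! ### Parabolics in coordinates, and their independence of the pairing. -/

namespace GHiggs

variable {n : ℕ} {G G' : ComplexReductiveGroup n} {c : GL (Fin n) ℂ}

/-! ### Parabolic subgroups and subalgebras in coordinates -/

theorem cj_cj_expGL_smul {s : Mat n} {d : Fin n → ℝ} (hd : cj c s = rdiag d) (t : ℝ) (A : Mat n)
    (i j : Fin n) :
    cj c (cj (expGL (t • s)) A) i j = (Real.exp (t * (d i - d j)) : ℝ) * cj c A i j := by
  have h1 : cj c (cj (expGL (t • s)) A) = cj (expGL (rdiag (t • d))) (cj c A) := by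
    rw [← smul_rdiag, ← hd, ← cj_real_smul, ← conj_expGL, ← cj_mul, ← cj_mul]
    congr 2; group
  rw [h1, cj_expGL_rdiag_apply]
  congr 4
  simp [mul_sub]

theorem eq_zero_of_exp_bounded {a C : ℝ} {z : ℂ} (ha : 0 < a)
    (h : ∀ t : ℝ, 0 ≤ t → ‖((Real.exp (t * a) : ℝ) : ℂ) * z‖ ^ 2 ≤ C) : z = 0 := by
  by_contra hz
  have hpos : 0 < ‖z‖ ^ 2 := by positivity
  have hC : 0 ≤ C := le_trans (by positivity) (h 0 le_rfl)
  have h1 := h (C / (‖z‖ ^ 2) / a) (by positivity)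
  rw [div_mul_cancel₀ _ ha.ne', norm_mul, mul_pow, Complex.norm_real, Real.norm_eq_abs,
    Real.abs_exp] at h1
  have h2 := Real.add_one_le_exp (C / ‖z‖ ^ 2)
  have h3 : 0 ≤ C / ‖z‖ ^ 2 := by positivity
  have h4 : C / ‖z‖ ^ 2 + 1 ≤ Real.exp (C / ‖z‖ ^ 2) ^ 2 := by nlinarith
  have h5 : (C / ‖z‖ ^ 2 + 1) * ‖z‖ ^ 2 ≤ C := le_trans (by gcongr) h1
  rw [add_mul, div_mul_cancel₀ _ hpos.ne'] at h5
  linarith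

/-- Ad(exp(ts)) scales the entry (i, j) by exp(t(dᵢ - dⱼ)), so boundedness kills the entries of
positive weight. -/
theorem blockTriangular_of_bounded {s : Mat n} {d : Fin n → ℝ} (hd : cj c s = rdiag d)
    {A : Mat n} {K : Set (Mat n)} (hK : IsCompact K)
    (h : ∀ t : ℝ, 0 ≤ t → cj (expGL (t • s)) A ∈ K) : (cj c A).BlockTriangular d := by
  obtain ⟨C, hC⟩ := (hK.image (continuous_nsq.comp (continuous_cj c))).bddAbove
  intro i j hij
  refine eq_zero_of_exp_bounded (sub_pos.2 hij) (C := C) fun t ht => ?_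
  rw [← cj_cj_expGL_smul hd]
  exact (sq_norm_apply_le_nsq _ i j).trans (hC ⟨_, h t ht, rfl⟩)

theorem nsq_cj_expGL_le {s : Mat n} {d : Fin n → ℝ} (hd : cj c s = rdiag d)
    {A : Mat n} (hA : (cj c A).BlockTriangular d) {t : ℝ} (ht : 0 ≤ t) :
    nsq (cj c (cj (expGL (t • s)) A)) ≤ nsq (cj c A) := by
  unfold nsq
  refine Finset.sum_le_sum fun i _ => Finset.sum_le_sum fun j _ => ?_
  rw [cj_cj_expGL_smul hd]
  by_cases hij : d j < d i
  · rw [hA hij, mul_zero]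
  · rw [norm_mul, Complex.norm_real, Real.norm_eq_abs, Real.abs_exp]
    have : Real.exp (t * (d i - d j)) ≤ 1 :=
      Real.exp_le_one_iff.2 (mul_nonpos_of_nonneg_of_nonpos ht (by linarith))
    gcongr
    exact mul_le_of_le_one_left (norm_nonneg _) this

theorem mem_parabolicLie_iff {s : Mat n} {d : Fin n → ℝ} (hd : cj c s = rdiag d) {A : Mat n} :
    A ∈ G.parabolicLie s ↔ A ∈ G.lie ∧ (cj c A).BlockTriangular d := by
  constructor
  · rintro ⟨hA, K, hK, h⟩
    exact ⟨hA, blockTriangular_of_bounded hd hK h⟩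
  · rintro ⟨hA, h⟩
    refine ⟨hA, cj c⁻¹ '' {B | nsq B ≤ nsq (cj c A)},
      (isCompact_nsq_le _).image (continuous_cj _), fun t ht => ?_⟩
    exact ⟨cj c (adExp s t A), nsq_cj_expGL_le hd h ht, cj_inv_cj _ _⟩

/-- Both g and g⁻¹ appear because a compact subset of GL(n) bounds inverses as well. -/
theorem mem_parabolic_iff {Q : Subgroup (GL (Fin n) ℂ)} {s : Mat n} {d : Fin n → ℝ}
    (hd : cj c s = rdiag d) {g : GL (Fin n) ℂ} :
    g ∈ parabolic Q s ↔ g ∈ Q ∧ (cj c g).BlockTriangular d ∧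
      (cj c (g⁻¹ : GL (Fin n) ℂ)).BlockTriangular d := by
  have key : ∀ h ∈ parabolic Q s, (cj c h).BlockTriangular d := by
    rintro h ⟨-, K, hK, hb⟩
    exact blockTriangular_of_bounded hd (hK.image Units.continuous_val)
      fun t ht => ⟨_, hb t ht, coe_conj _ _⟩
  constructor
  · intro hg
    exact ⟨hg.1, key g hg, key _ (inv_mem hg)⟩
  · rintro ⟨hg, h1, h2⟩
    refine ⟨hg, (fun x : GL (Fin n) ℂ => c⁻¹ * x * c) '' {x : GL (Fin n) ℂ |
      nsq (x : Mat n) ≤ nsq (cj c g) ∧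
      nsq ((x⁻¹ : GL (Fin n) ℂ) : Mat n) ≤ nsq (cj c (g⁻¹ : GL (Fin n) ℂ))},
      (isCompact_GL_nsq_le _ _).image (by fun_prop), fun t ht => ?_⟩
    refine ⟨c * (expGL (t • s) * g * (expGL (t • s))⁻¹) * c⁻¹, ⟨?_, ?_⟩, by group⟩
    · rw [coe_conj, coe_conj]
      exact nsq_cj_expGL_le hd h1 ht
    · have : (c * (expGL (t • s) * g * (expGL (t • s))⁻¹) * c⁻¹)⁻¹ =
          c * (expGL (t • s) * g⁻¹ * (expGL (t • s))⁻¹) * c⁻¹ := by group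
      rw [this, coe_conj, coe_conj]
      exact nsq_cj_expGL_le hd h2 ht

theorem blockTriangular_smul {A : Mat n} {d : Fin n → ℝ} (h : A.BlockTriangular d) (t : ℝ) :
    (t • A).BlockTriangular d := fun i j hij => by
  rw [Matrix.smul_apply, h hij, smul_zero]

theorem mem_lieSet_parabolic_iff {s : Mat n} {d : Fin n → ℝ} (hd : cj c s = rdiag d)
    {A : Mat n} : A ∈ lieSet (parabolic G.carrier s) ↔ A ∈ G.parabolicLie s := by
  rw [mem_parabolicLie_iff hd]
  constructor
  · intro h
    refine ⟨(G.mem_lie A).2 fun t => (h t).1, fun i j hij => ?_⟩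
    have h1 := hasDerivAt_exp_smul_apply (cj c A) i j
    have h2 : (fun t : ℝ => NormedSpace.exp (t • cj c A) i j) = fun _ => 0 := by
      ext1 t
      rw [← cj_real_smul, ← cj_exp]
      exact ((mem_parabolic_iff hd).1 (h t)).2.1 hij
    rw [h2] at h1
    exact h1.unique (hasDerivAt_const _ _)
  · rintro ⟨hA, h⟩ t
    refine (mem_parabolic_iff hd).2 ⟨expGL_smul_mem hA t, ?_, ?_⟩
    · rw [coe_expGL, cj_exp, cj_real_smul]
      exact (blockTriangular_smul h t).exp
    · rw [← expGL_neg, ← neg_smul, coe_expGL, cj_exp, cj_real_smul]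
      exact (blockTriangular_smul h _).exp

theorem mem_leviLie_iff {s : Mat n} {d : Fin n → ℝ} (hd : cj c s = rdiag d) {A : Mat n} :
    A ∈ G.leviLie s ↔ A ∈ G.lie ∧ Commute s A := by
  constructor
  · rintro ⟨hA, h⟩
    refine ⟨hA, (cj c).injective ?_⟩
    rw [map_mul, map_mul, hd]
    ext i j
    rw [rdiag_mul_apply, mul_rdiag_apply]
    by_cases hij : d i = d j
    · rw [hij, mul_comm]
    · have h1 : Filter.Tendsto (fun t : ℝ => (Real.exp (t * (d i - d j)) : ℝ) * cj c A i j)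
          Filter.atTop (𝓝 (cj c A i j)) := by
        have h2 : Continuous fun B : Mat n => cj c B i j := by
          have := continuous_cj c
          fun_prop
        have h3 := (h2.tendsto A).comp h
        refine h3.congr fun t => ?_
        exact cj_cj_expGL_smul hd t A i j
      suffices h0 : cj c A i j = 0 by rw [h0, mul_zero, zero_mul]
      rcases lt_or_gt_of_ne hij with hlt | hlt
      · have h2 : Filter.Tendsto (fun t : ℝ => ((Real.exp (t * (d i - d j)) : ℝ) : ℂ) * cj c A i j)
            Filter.atTop (𝓝 (((0 : ℝ) : ℂ) * cj c A i j)) := by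
          refine Filter.Tendsto.mul_const _ ?_
          refine (Complex.continuous_ofReal.tendsto 0).comp ?_
          exact Real.tendsto_exp_atBot.comp
            (Filter.tendsto_id.atTop_mul_const_of_neg (sub_neg.2 hlt))
        simpa using tendsto_nhds_unique h1 h2
      · by_contra h0
        have h2 := h1.norm
        simp only [norm_mul, Complex.norm_real, Real.norm_eq_abs, Real.abs_exp] at h2
        have h3 : Filter.Tendsto (fun t : ℝ => Real.exp (t * (d i - d j)) * ‖cj c A i j‖)
            Filter.atTop Filter.atTop :=
          (Real.tendsto_exp_atTop.comp
            (Filter.tendsto_id.atTop_mul_const (sub_pos.2 hlt))).atTop_mul_const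
              (norm_pos_iff.2 h0)
        exact not_tendsto_nhds_of_tendsto_atTop h3 _ h2
  · rintro ⟨hA, h⟩
    refine ⟨hA, ?_⟩
    have : (fun t : ℝ => adExp s t A) = fun _ => A := by
      ext1 t
      exact cj_expGL_of_commute (h.smul_left t)
    rw [this]
    exact tendsto_const_nhds

/-! ### Comparison of an invariant pairing with the trace form -/

variable {B : LinearMap.BilinForm ℂ G.lie}

theorem trace_coe_lie_mul (x y z : G.lie) :
    ((⁅x, y⁆ : G.lie) * (z : Mat n)).trace = ((x : Mat n) * (⁅y, z⁆ : G.lie)).trace :=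
  trace_lie_mul _ _ _

theorem lie_mem_derived (v w : G.lie) : ⁅v, w⁆ ∈ LieAlgebra.derivedSeries ℂ G.lie 1 := by
  rw [LieAlgebra.derivedSeries_def, LieAlgebra.derivedSeriesOfIdeal_succ]
  exact LieSubmodule.lie_mem_lie (LieSubmodule.mem_top _) (LieSubmodule.mem_top _)

theorem pairing_lie_eq_trace (hB : G.IsInvariantPairing B) {s s₁ : G.lie}
    (h : ∀ y : G.lie, B s y = ((s₁ : Mat n) * y).trace) (v w : G.lie) :
    B ⁅s, v⁆ w = ((⁅s₁, v⁆ : G.lie) * (w : Mat n)).trace := by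
  rw [hB.invariant, h, LieSubalgebra.coe_bracket, LieSubalgebra.coe_bracket, trace_lie_mul]

/-- Both forms are invariant, so `B`([s,v],w) = tr([s₁,v]w), and both are non-degenerate. Hence s
and s₁ have the same centraliser. -/
theorem lie_eq_zero_iff_of_pairing (hG : IsPolar G c) (hB : G.IsInvariantPairing B)
    {s s₁ : G.lie} (h : ∀ y : G.lie, B s y = ((s₁ : Mat n) * y).trace) (w : G.lie) :
    ⁅s, w⁆ = 0 ↔ ⁅s₁, w⁆ = 0 := by
  constructor
  · intro h0
    refine Subtype.ext (hG.eq_zero_of_trace (⁅s₁, w⁆ : G.lie).2 fun y hy => ?_)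
    have := pairing_lie_eq_trace hB h w ⟨y, hy⟩
    rw [h0, map_zero] at this
    exact this.symm
  · intro h0
    refine hB.nondegenerate.1 _ fun y => ?_
    rw [pairing_lie_eq_trace hB h, h0]
    simp

/-- On brackets `B` is the Killing form, which is compatible with the adjoint. Since s₁ is
self-adjoint, s and s† have the same Killing products [s,[a,b]] · [e,f]. Positivity then shows that
x = s - s† first kills the derived algebra and then all of 𝔤. This is needed because the behaviour
of `B` on the centre is not tied to the adjoint. -/
theorem sub_adj_mem_center (hG : IsPolar G c) (hB : G.IsInvariantPairing B)
    {s s₁ : G.lie} (h : ∀ y : G.lie, B s y = ((s₁ : Mat n) * y).trace)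
    (hs₁ : dag c (s₁ : Mat n) = s₁) (w : G.lie) : ⁅s - hG.adj s, w⁆ = 0 := by
  set x := s - hG.adj s
  have hK : ∀ a b e f : G.lie, killingForm ℂ G.lie ⁅s, ⁅a, b⁆⁆ ⁅e, f⁆ =
      ((⁅s₁, ⁅a, b⁆⁆ : G.lie) * (⁅e, f⁆ : G.lie) : Mat n).trace := by
    intro a b e f
    rw [← hB.killing _ (lie_mem_derived _ _) _ (lie_mem_derived _ _), pairing_lie_eq_trace hB h]
  have hK' : ∀ a b e f : G.lie, killingForm ℂ G.lie ⁅hG.adj s, ⁅a, b⁆⁆ ⁅e, f⁆ =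
      ((⁅s₁, ⁅a, b⁆⁆ : G.lie) * (⁅e, f⁆ : G.lie) : Mat n).trace := by
    intro a b e f
    have e1 : ⁅hG.adj s, ⁅a, b⁆⁆ = hG.adj (-⁅s, ⁅hG.adj b, hG.adj a⁆⁆) := by
      rw [lie_skew, hG.adj_lie, hG.adj_lie, hG.adj_adj, hG.adj_adj]
    have e2 : ⁅e, f⁆ = hG.adj ⁅hG.adj f, hG.adj e⁆ := by
      rw [hG.adj_lie, hG.adj_adj, hG.adj_adj]
    rw [e1, e2, hG.killingForm_adj_adj, map_neg, LinearMap.neg_apply, hK, ← Matrix.trace_neg,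
      ← neg_mul, ← trace_dag (c := c), dag_mul, Matrix.trace_mul_comm, ← hG.coe_adj,
      ← NegMemClass.coe_neg]
    rw [← hG.coe_adj, lie_skew, hG.adj_lie, hG.adj_lie, hG.adj_adj, hG.adj_adj]
    have : hG.adj s₁ = s₁ := Subtype.ext hs₁
    rw [this]
  have hx : hG.adj x = -x := by
    apply Subtype.ext
    simp [x, dag_sub]
  -- `x` centralizes the derived algebra
  have hD : ∀ a b : G.lie, ⁅x, ⁅a, b⁆⁆ = 0 := by
    intro a b
    set u := ⁅x, ⁅a, b⁆⁆ with hu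
    have h1 : killingForm ℂ G.lie u (hG.adj u) = 0 := by
      have hu' : u = ⁅s, ⁅a, b⁆⁆ - ⁅hG.adj s, ⁅a, b⁆⁆ := sub_lie _ _ _
      have hu'' : hG.adj u = ⁅hG.adj ⁅a, b⁆, hG.adj x⁆ := hG.adj_lie _ _
      rw [hu'', hu', map_sub, LinearMap.sub_apply, hK, hK', sub_self]
    obtain ⟨r, -, hr, hr0⟩ := hG.killingForm_adj u
    rw [h1] at hr
    have hcen := hr0 (by exact_mod_cast hr.symm)
    rw [LieModule.mem_maxTrivSubmodule] at hcen
    -- Vanishing of the Killing norm only makes u central; moving the bracket onto the central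
    -- element u† makes its trace norm vanish too.
    have h2 : ((⁅x, ⁅a, b⁆⁆ : G.lie) * hG.adj u : Mat n).trace = 0 := by
      rw [trace_coe_lie_mul]
      have h3 : ⁅⁅a, b⁆, hG.adj u⁆ = 0 := by
        have := congrArg hG.adj (hcen (hG.adj ⁅a, b⁆))
        rw [hG.adj_lie, hG.adj_adj] at this
        rw [← lie_skew, this]
        apply Subtype.ext; simp [dag]
      rw [h3]; simp
    rw [← hu, hG.coe_adj, trace_mul_dag] at h2
    exact Subtype.ext (nsq_cj_eq_zero.1 (by exact_mod_cast h2))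
  have h2 : ((⁅x, w⁆ : G.lie) * dag c (⁅x, w⁆ : G.lie) : Mat n).trace = 0 := by
    have h3 : hG.adj ⁅x, w⁆ = ⁅x, hG.adj w⁆ := by
      rw [hG.adj_lie, hx, lie_neg, lie_skew]
    rw [← hG.coe_adj, h3, ← lie_skew, NegMemClass.coe_neg, neg_mul, Matrix.trace_neg,
      trace_coe_lie_mul, hD]
    simp
  rw [trace_mul_dag] at h2
  exact Subtype.ext (nsq_cj_eq_zero.1 (by exact_mod_cast h2))

theorem adExp_of_sub_central {s s' v : Mat n} (hs : Commute (s - s') s') (hv : Commute (s - s') v)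
    (t : ℝ) : adExp s t v = adExp s' t v := by
  have h1 : t • s = t • s' + t • (s - s') := by rw [← smul_add]; congr 1; abel
  have h2 : expGL (t • s) = expGL (t • s') * expGL (t • (s - s')) := by
    rw [h1, expGL_add ((hs.symm.smul_left t).smul_right t)]
  rw [adExp_eq, adExp_eq, h2, cj_mul, cj_expGL_of_commute (hv.smul_left t)]

/-- A central shift of s acts trivially through Ad. -/
theorem parabolicLie_congr {s s' : G.lie} (h : ∀ w : G.lie, ⁅s - s', w⁆ = 0) :
    G.parabolicLie s = G.parabolicLie s' := by
  have hc : ∀ w : G.lie, Commute ((s : Mat n) - s') w := fun w =>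
    lie_eq_zero_iff_commute.1 (congrArg Subtype.val (h w))
  ext v
  refine and_congr_right fun hv => ?_
  refine exists_congr fun K => and_congr_right fun _ => forall_congr' fun t => ?_
  rw [adExp_of_sub_central (hc s') (hc ⟨v, hv⟩)]

/-- The parabolic subalgebra of `s` only depends on the linear functional that is represented by
`s`: it is also that of the element that represents the functional in the trace form. -/
theorem parabolicLie_eq_of_pairing (hG : IsPolar G c) (hB : G.IsInvariantPairing B)
    {s s₁ : G.lie} (h : ∀ y : G.lie, B s y = ((s₁ : Mat n) * y).trace)
    (hs₁ : dag c (s₁ : Mat n) = s₁) : G.parabolicLie s = G.parabolicLie s₁ := by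
  have hcen := sub_adj_mem_center hG hB h hs₁
  -- The Hermitian part of s differs from s by a central element and commutes with s₁, so it can be
  -- diagonalised together with s₁.
  set sh : G.lie := (1 / 2 : ℂ) • (s + hG.adj s) with hsh
  have hdiff : s - sh = (1 / 2 : ℂ) • (s - hG.adj s) := by rw [hsh]; module
  have hcen' : ∀ w : G.lie, ⁅s - sh, w⁆ = 0 := fun w => by rw [hdiff, smul_lie, hcen, smul_zero]
  have hshw : ∀ w : G.lie, ⁅sh, w⁆ = ⁅s, w⁆ := fun w => by
    have := hcen' w
    rw [sub_lie, sub_eq_zero] at this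
    exact this.symm
  rw [parabolicLie_congr hcen']
  have hshc : dag c (sh : Mat n) = sh := by
    have e1 : hG.adj sh = sh := by
      apply Subtype.ext
      have : ((1 / 2 : ℂ) • (s + hG.adj s) : G.lie) = ((1 / 2 : ℝ) • ((s : Mat n) + dag c s)) := by
        ext i j; simp
      rw [hG.coe_adj, hsh, this, dag_real_smul, dag_add, dag_dag, add_comm]
    exact congrArg Subtype.val e1
  have hcomm : ⁅sh, s₁⁆ = 0 := by
    rw [hshw, lie_eq_zero_iff_of_pairing hG hB h, lie_self]
  have hcomm' : cj c sh * cj c s₁ = cj c s₁ * cj c sh := by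
    rw [← map_mul, ← map_mul, (lie_eq_zero_iff_commute.1 (congrArg Subtype.val hcomm)).eq]
  obtain ⟨u, hu, f, d, hf, hd⟩ := exists_unitary_diag₂ (dag_eq_self_iff.1 hshc)
    (dag_eq_self_iff.1 hs₁) hcomm'
  rw [← cj_mul] at hf hd
  have hGu := hG.unitary_mul hu
  -- A joint weight vector w of weights κ for s and μ for s₁ satisfies κ K(w, w†) = μ tr(w w†),
  -- where K is the Killing form. Both factors are non-negative and the second is positive, so κ and
  -- μ cannot have opposite signs; equality of centralisers handles the zero case.
  have hsign : ∀ v : G.lie, ∀ i j, cj (u * c) v i j ≠ 0 → (0 < f i - f j ↔ 0 < d i - d j) := by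
    intro v i j hij
    obtain ⟨v₁, hv₁, hv₁'⟩ := exists_component s₁.2 hd v.2 (fun x => x = d i - d j)
    obtain ⟨v₂, hv₂, hv₂'⟩ := exists_component sh.2 hf hv₁ (fun x => x = f i - f j)
    set κ := f i - f j
    set μ := d i - d j
    let w : G.lie := ⟨v₂, hv₂⟩
    have hwij : cj (u * c) w i j = cj (u * c) v i j := by
      rw [hv₂', hv₁', if_pos rfl, if_pos rfl]
    have hw0 : 0 < nsq (cj (u * c) (w : Mat n)) := by
      refine lt_of_le_of_ne (nsq_nonneg _) fun h0 => hij ?_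
      rw [← hwij, nsq_cj_eq_zero.1 h0.symm]
      simp
    have hwd : ⁅s₁, w⁆ = (μ : ℂ) • w := by
      apply Subtype.ext
      apply (cj (u * c)).injective
      rw [LieSubalgebra.coe_bracket, LieRing.of_associative_ring_bracket, map_sub, map_mul,
        map_mul, hd, ← LieRing.of_associative_ring_bracket]
      ext k l
      rw [bracket_rdiag_apply]
      change _ * cj (u * c) v₂ k l = cj (u * c) ((μ : ℂ) • v₂) k l
      rw [map_smul, Matrix.smul_apply, hv₂', hv₁', smul_eq_mul]
      split_ifs with h1 h2
      · rw [h2]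
      all_goals simp
    have hwf : ⁅s, w⁆ = (κ : ℂ) • w := by
      rw [← hshw]
      apply Subtype.ext
      apply (cj (u * c)).injective
      rw [LieSubalgebra.coe_bracket, LieRing.of_associative_ring_bracket, map_sub, map_mul,
        map_mul, hf, ← LieRing.of_associative_ring_bracket]
      ext k l
      rw [bracket_rdiag_apply]
      change _ * cj (u * c) v₂ k l = cj (u * c) ((κ : ℂ) • v₂) k l
      rw [map_smul, Matrix.smul_apply, hv₂', hv₁', smul_eq_mul]
      split_ifs with h1 h2
      · rw [h1]
      all_goals simp
    have hw : w ≠ 0 := by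
      rintro h0
      rw [h0] at hw0
      simp at hw0
    have hzero : κ = 0 ↔ μ = 0 := by
      have := lie_eq_zero_iff_of_pairing hG hB h w
      rw [hwd, hwf, smul_eq_zero_iff_left hw, smul_eq_zero_iff_left hw] at this
      exact_mod_cast this
    by_cases hμ : μ = 0
    · rw [hμ, hzero.2 hμ]
    · have hwD : w ∈ LieAlgebra.derivedSeries ℂ G.lie 1 := by
        -- A vector of non-zero weight is a bracket, so `B` may be replaced by the Killing form on
        -- it.
        have : w = ⁅s₁, (μ : ℂ)⁻¹ • w⁆ := by
          rw [lie_smul, hwd, smul_smul, inv_mul_cancel₀ (by exact_mod_cast hμ), one_smul]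
        rw [this]; exact lie_mem_derived _ _
      have hwD' : hGu.adj w ∈ LieAlgebra.derivedSeries ℂ G.lie 1 := by
        have : w = ⁅s₁, (μ : ℂ)⁻¹ • w⁆ := by
          rw [lie_smul, hwd, smul_smul, inv_mul_cancel₀ (by exact_mod_cast hμ), one_smul]
        rw [this, hGu.adj_lie]; exact lie_mem_derived _ _
      obtain ⟨r, hr0, hr, -⟩ := hGu.killingForm_adj w
      have h1 := pairing_lie_eq_trace hB h w (hGu.adj w)
      rw [hwd, hwf, map_smul, LinearMap.smul_apply, hB.killing _ hwD _ hwD', hr,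
        show (((μ : ℂ) • w : G.lie) : Mat n) = (μ : ℂ) • (w : Mat n) from rfl, smul_mul_assoc, Matrix.trace_smul, hGu.coe_adj, trace_mul_dag,
        smul_eq_mul, smul_eq_mul] at h1
      have h2 : κ * r = μ * nsq (cj (u * c) (w : Mat n)) := by exact_mod_cast h1
      constructor
      · intro hκ
        by_contra hn
        have : μ < 0 := lt_of_le_of_ne (not_lt.1 hn) hμ
        nlinarith [mul_nonneg hκ.le hr0, mul_pos_of_neg_of_neg this (neg_neg_of_pos hw0)]
      · intro hμ'
        by_contra hn
        nlinarith [mul_pos hμ' hw0, mul_nonneg (neg_nonneg.2 (not_lt.1 hn)) hr0]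
  ext v
  rw [mem_parabolicLie_iff hf, mem_parabolicLie_iff hd]
  refine and_congr_right fun hv => ?_
  constructor
  · intro h1 i j hij
    by_contra hne
    exact hne (h1 (sub_pos.1 ((hsign ⟨v, hv⟩ i j hne).2 (sub_pos.2 hij))))
  · intro h1 i j hij
    by_contra hne
    exact hne (h1 (sub_pos.1 ((hsign ⟨v, hv⟩ i j hne).1 (sub_pos.2 hij))))

end GHiggs

/-! ### Closed subgroups, one-parameter subgroups and simultaneous approximation. -/

namespace GHiggs

/-! ### Closed subgroups -/

section ClosedSubgroup

open NormedSpace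

variable {𝔸 : Type*} [NormedRing 𝔸] [NormedAlgebra ℝ 𝔸] [FiniteDimensional ℝ 𝔸]
  [NormedAlgebra ℚ 𝔸]

/-- Otherwise there are u_k → 0 in ker q with exp u_k ∈ S. A limit v of their directions lies in ker
q. It also generates a one-parameter subgroup of S, hence lies in W, on which q is the identity; so
v = 0, against ‖v‖ = 1. -/
theorem eventually_eq_zero_of_exp_mem {S : Submonoid 𝔸} (hcl : IsClosed {A : 𝔸 | exp A ∈ S})
    (hinv : ∀ A : 𝔸, exp A ∈ S → exp (-A) ∈ S) {W : Submodule ℝ 𝔸}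
    (hW : ∀ A, (∀ t : ℝ, exp (t • A) ∈ S) → A ∈ W) {q : 𝔸 →ₗ[ℝ] W}
    (hq : ∀ A : W, q A = A) : ∀ᶠ A : 𝔸 in 𝓝 0, q A = 0 → exp A ∈ S → A = 0 := by
  have : CompleteSpace 𝔸 := FiniteDimensional.complete ℝ 𝔸
  have : ProperSpace 𝔸 := FiniteDimensional.proper ℝ 𝔸
  by_contra hcon
  rw [Filter.not_eventually] at hcon
  obtain ⟨u, hu, hu'⟩ := Filter.exists_seq_forall_of_frequently hcon
  push Not at hu'
  have hpow : ∀ (A : 𝔸) (k : ℤ), exp A ∈ S → exp (k • A) ∈ S := by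
    have hnat : ∀ (A : 𝔸) (k : ℕ), exp A ∈ S → exp (k • A) ∈ S := fun A k hA => by
      rw [exp_nsmul]; exact S.pow_mem hA k
    intro A k hA
    rcases Int.eq_nat_or_neg k with ⟨m, rfl | rfl⟩
    · rw [natCast_zsmul]; exact hnat A m hA
    · rw [neg_smul, natCast_zsmul]; exact hinv _ (hnat A m hA)
  have hpos : ∀ k, 0 < ‖u k‖ := fun k => norm_pos_iff.2 (hu' k).2.2
  have hsph : ∀ k, ‖u k‖⁻¹ • u k ∈ Metric.sphere (0 : 𝔸) 1 := fun k => by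
    simp [norm_smul, (hpos k).ne']
  obtain ⟨v, hv, φ, hφ, hlim⟩ := (isCompact_sphere (0 : 𝔸) 1).tendsto_subseq hsph
  have hqv : q v = 0 := by
    have h1 : Filter.Tendsto (fun k => q (‖u (φ k)‖⁻¹ • u (φ k))) Filter.atTop (𝓝 (q v)) :=
      ((LinearMap.continuous_of_finiteDimensional q).tendsto v).comp hlim
    have h2 : (fun k => q (‖u (φ k)‖⁻¹ • u (φ k))) = fun _ => 0 := by
      ext1 k; rw [map_smul, (hu' _).1, smul_zero]
    rw [h2] at h1
    exact tendsto_nhds_unique h1 tendsto_const_nhds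
  have hvW : v ∈ W := by
    refine hW v fun t => ?_
    have hn : Filter.Tendsto (fun k => ‖u (φ k)‖) Filter.atTop (𝓝 0) := by
      simpa using (hu.comp hφ.tendsto_atTop).norm
    -- Integer multiples of u_k approximate tv, and their exponentials are powers of exp u_k.
    have h1 : Filter.Tendsto (fun k => (⌊t / ‖u (φ k)‖⌋ : ℝ) * ‖u (φ k)‖) Filter.atTop (𝓝 t) := by
      rw [tendsto_iff_dist_tendsto_zero]
      refine squeeze_zero (fun _ => dist_nonneg) (fun k => ?_) hn
      rw [dist_comm, Real.dist_eq, abs_of_nonneg]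
      · have := Int.lt_floor_add_one (t / ‖u (φ k)‖)
        rw [div_lt_iff₀ (hpos _)] at this
        linarith
      · have := Int.floor_le (t / ‖u (φ k)‖)
        rw [le_div_iff₀ (hpos _)] at this
        linarith
    have h2 := h1.smul hlim
    refine hcl.mem_of_tendsto h2 (Filter.Eventually.of_forall fun k => ?_)
    have h3 : ((⌊t / ‖u (φ k)‖⌋ : ℝ) * ‖u (φ k)‖) • ((fun k => ‖u k‖⁻¹ • u k) ∘ φ) k =
        ⌊t / ‖u (φ k)‖⌋ • u (φ k) := by
      simp only [Function.comp]
      rw [smul_smul, mul_assoc, mul_inv_cancel₀ (hpos _).ne', mul_one, Int.cast_smul_eq_zsmul]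
    change exp _ ∈ S
    rw [h3]
    exact hpow _ _ (hu' _).2.1
  have h0 : v = 0 := by
    have := hq ⟨v, hvW⟩
    rw [hqv] at this
    exact (congrArg Subtype.val this).symm
  rw [h0] at hv
  simp at hv

/-- With a projection P onto W, the map A ↦ exp(PA) exp((1-P)A) is a local diffeomorphism at 0. If
its value lies in S, so does the second factor, which is then trivial by
`eventually_eq_zero_of_exp_mem`. -/
theorem eventually_exists_log {S : Submonoid 𝔸} (hcl : IsClosed {A : 𝔸 | exp A ∈ S})
    (hinv : ∀ A : 𝔸, exp A ∈ S → exp (-A) ∈ S) {W : Submodule ℝ 𝔸}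
    (hW : ∀ A, A ∈ W ↔ ∀ t : ℝ, exp (t • A) ∈ S) {N : Set 𝔸} (hN : N ∈ 𝓝 (0 : 𝔸)) :
    ∀ᶠ g : 𝔸 in 𝓝 1, g ∈ S → ∃ A ∈ W, A ∈ N ∧ g = exp A := by
  have : CompleteSpace 𝔸 := FiniteDimensional.complete ℝ 𝔸
  obtain ⟨q, hq⟩ := W.subtype.exists_leftInverse_of_injective W.ker_subtype
  have hq' : ∀ A : W, q A = A := fun A => congrArg (fun f => f A) hq
  let P : 𝔸 →L[ℝ] 𝔸 := LinearMap.toContinuousLinearMap (W.subtype ∘ₗ q)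
  have hexp : HasStrictFDerivAt (exp : 𝔸 → 𝔸) (1 : 𝔸 →L[ℝ] 𝔸) 0 := hasStrictFDerivAt_exp_zero
  have h1 : HasStrictFDerivAt (fun A => exp (P A)) P 0 := by
    have h : HasStrictFDerivAt (exp : 𝔸 → 𝔸) (1 : 𝔸 →L[ℝ] 𝔸) (P 0) := by rwa [map_zero]
    exact h.comp 0 P.hasStrictFDerivAt
  have h2 : HasStrictFDerivAt (fun A => exp ((1 - P) A)) (1 - P) 0 := by
    have h : HasStrictFDerivAt (exp : 𝔸 → 𝔸) (1 : 𝔸 →L[ℝ] 𝔸) ((1 - P) 0) := by rwa [map_zero]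
    exact h.comp 0 (1 - P).hasStrictFDerivAt
  have h3 := h1.mul' h2
  have h4 : HasStrictFDerivAt (fun A => exp (P A) * exp ((1 - P) A))
      ((ContinuousLinearEquiv.refl ℝ 𝔸 : 𝔸 ≃L[ℝ] 𝔸) : 𝔸 →L[ℝ] 𝔸) 0 := by
    have e : (exp (P 0) • (1 - P) + MulOpposite.op (exp ((1 - P) 0)) • P : 𝔸 →L[ℝ] 𝔸) =
        (ContinuousLinearEquiv.refl ℝ 𝔸 : 𝔸 ≃L[ℝ] 𝔸) := by
      ext A; simp
    rw [e] at h3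
    exact h3
  have h5 := h4.map_nhds_eq_of_equiv
  simp only [map_zero, exp_zero, mul_one] at h5
  have h6 : ∀ᶠ A : 𝔸 in 𝓝 0, exp (P A) * exp ((1 - P) A) ∈ S →
      ∃ A' ∈ W, A' ∈ N ∧ exp (P A) * exp ((1 - P) A) = exp A' := by
    have h7 : Filter.Tendsto (fun A : 𝔸 => (1 - P) A) (𝓝 0) (𝓝 0) := by
      have := (1 - P).continuous.tendsto 0
      rwa [map_zero] at this
    filter_upwards [h7.eventually (eventually_eq_zero_of_exp_mem hcl hinv
      (fun A => (hW A).2) hq'), hN] with A hA hAN hS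
    have hPW : P A ∈ W := (q A).2
    have h8 : exp ((1 - P) A) ∈ S := by
      have h9 : exp (-P A) ∈ S := by simpa using (hW _).1 hPW (-1)
      have h10 := S.mul_mem h9 hS
      rwa [← mul_assoc, ← exp_add_of_commute (Commute.refl (P A)).neg_left, neg_add_cancel,
        exp_zero, one_mul] at h10
    have h11 : q ((1 - P) A) = 0 := by
      have : q (P A) = q A := hq' (q A)
      simp [this]
    have h12 := hA h11 h8
    have h13 : A = P A := by
      simpa [sub_eq_zero] using h12
    refine ⟨A, h13 ▸ hPW, hAN, ?_⟩
    rw [h12, exp_zero, mul_one, ← h13]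
  rw [← h5, Filter.eventually_map]
  exact h6

theorem eventually_mem_of_exp_mem {S : Submonoid 𝔸} (hcl : IsClosed {A : 𝔸 | exp A ∈ S})
    (hinv : ∀ A : 𝔸, exp A ∈ S → exp (-A) ∈ S) {W : Submodule ℝ 𝔸}
    (hW : ∀ A, A ∈ W ↔ ∀ t : ℝ, exp (t • A) ∈ S) :
    ∀ᶠ A : 𝔸 in 𝓝 0, exp A ∈ S → A ∈ W := by
  have : CompleteSpace 𝔸 := FiniteDimensional.complete ℝ 𝔸
  have hexp : HasStrictFDerivAt (exp : 𝔸 → 𝔸)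
      ((ContinuousLinearEquiv.refl ℝ 𝔸 : 𝔸 ≃L[ℝ] 𝔸) : 𝔸 →L[ℝ] 𝔸) 0 := hasStrictFDerivAt_exp_zero
  have h1 := hexp.eventually_left_inverse
  have h2 := eventually_exists_log hcl hinv hW h1
  have h3 : Filter.Tendsto (exp : 𝔸 → 𝔸) (𝓝 0) (𝓝 1) := by
    simpa using (exp_continuous (𝔸 := 𝔸)).tendsto 0
  filter_upwards [h1, h3.eventually h2] with A hA hA2 hS
  obtain ⟨A', hA'W, hA', he⟩ := hA2 hS
  have : A = A' := by rw [← hA, he, hA']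
  exact this ▸ hA'W

end ClosedSubgroup

variable {n : ℕ}

theorem exp_mem_map_iff {C : Subgroup (GL (Fin n) ℂ)} (A : Mat n) :
    NormedSpace.exp A ∈ C.toSubmonoid.map (Units.coeHom (Mat n)) ↔ expGL A ∈ C := by
  constructor
  · rintro ⟨g, hg, hgA⟩
    have : expGL A = g := Units.ext hgA.symm
    exact this ▸ hg
  · intro h
    exact ⟨_, h, rfl⟩

theorem isClosed_exp_mem_map {C : Subgroup (GL (Fin n) ℂ)}
    (hC : IsClosed (C : Set (GL (Fin n) ℂ))) :
    IsClosed {A : Mat n | NormedSpace.exp A ∈ C.toSubmonoid.map (Units.coeHom (Mat n))} := by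
  simp only [exp_mem_map_iff]
  exact hC.preimage continuous_expGL

theorem exp_neg_mem_map {C : Subgroup (GL (Fin n) ℂ)} (A : Mat n)
    (hA : NormedSpace.exp A ∈ C.toSubmonoid.map (Units.coeHom (Mat n))) :
    NormedSpace.exp (-A) ∈ C.toSubmonoid.map (Units.coeHom (Mat n)) := by
  rw [exp_mem_map_iff] at hA ⊢
  rw [expGL_neg]; exact C.inv_mem hA

open scoped Matrix.Norms.Operator in
theorem eventually_mem_of_expGL_mem {C : Subgroup (GL (Fin n) ℂ)}
    (hC : IsClosed (C : Set (GL (Fin n) ℂ))) {W : Submodule ℝ (Mat n)}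
    (hW : ∀ A, A ∈ W ↔ A ∈ lieSet C) :
    ∀ᶠ A : Mat n in 𝓝 0, expGL A ∈ C → A ∈ W := by
  have h := eventually_mem_of_exp_mem (𝔸 := Mat n) (S := C.toSubmonoid.map (Units.coeHom (Mat n)))
    (isClosed_exp_mem_map hC) exp_neg_mem_map
    (W := W) (fun A => by rw [hW]; exact forall_congr' fun t => (exp_mem_map_iff _).symm)
  filter_upwards [h] with A hA hAC
  exact hA ((exp_mem_map_iff A).2 hAC)

open scoped Matrix.Norms.Operator in
theorem eventually_exists_expGL {C : Subgroup (GL (Fin n) ℂ)}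
    (hC : IsClosed (C : Set (GL (Fin n) ℂ))) {W : Submodule ℝ (Mat n)}
    (hW : ∀ A, A ∈ W ↔ A ∈ lieSet C) :
    ∀ᶠ g : GL (Fin n) ℂ in 𝓝 1, g ∈ C → ∃ A ∈ W, g = expGL A := by
  have h := eventually_exists_log (𝔸 := Mat n) (S := C.toSubmonoid.map (Units.coeHom (Mat n)))
    (isClosed_exp_mem_map hC) exp_neg_mem_map
    (W := W) (fun A => by rw [hW]; exact forall_congr' fun t => (exp_mem_map_iff _).symm)
    Filter.univ_mem
  have hval : Filter.Tendsto (fun g : GL (Fin n) ℂ => (g : Mat n)) (𝓝 1) (𝓝 1) :=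
    Units.continuous_val.tendsto 1
  filter_upwards [hval.eventually h] with g hg hgC
  obtain ⟨A, hA, -, he⟩ := hg ⟨g, hgC, rfl⟩
  exact ⟨A, hA, Units.ext he⟩

/-! ### Characters -/

theorem eq_exp_of_hasDerivAt {φ : ℝ → ℂ} {a : ℂ} (h0 : φ 0 = 1)
    (hadd : ∀ s t, φ (s + t) = φ s * φ t) (hd : HasDerivAt φ a 0) (t : ℝ) :
    φ t = Complex.exp (t * a) := by
  have hφ : ∀ t, HasDerivAt φ (φ t * a) t := by
    intro t
    have h1 : HasDerivAt (fun x => φ (x - t)) a t := by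
      have h := hd
      rw [← sub_self t] at h
      simpa using h.comp_sub_const t t
    have h2 := h1.const_mul (φ t)
    refine h2.congr_of_eventuallyEq (Filter.Eventually.of_forall fun x => ?_)
    change φ x = φ t * φ (x - t)
    rw [← hadd, add_sub_cancel]
  have he : ∀ t : ℝ, HasDerivAt (fun x : ℝ => Complex.exp (-(x * a))) (-(a) * Complex.exp (-(t * a))) t := by
    intro t
    have h1 : HasDerivAt (fun x : ℝ => -((x : ℂ) * a)) (-a) t := by
      have := ((Complex.ofRealCLM.hasDerivAt (x := t)).mul_const a).neg
      simpa using! this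
    have := h1.cexp
    rwa [mul_comm] at this
  have hprod : ∀ t : ℝ, HasDerivAt (fun x : ℝ => φ x * Complex.exp (-(x * a))) 0 t := by
    intro t
    have := (hφ t).mul (he t)
    have e : φ t * a * Complex.exp (-(t * a)) + φ t * (-a * Complex.exp (-(t * a))) = 0 := by ring
    rw [e] at this
    exact this
  have hconst := is_const_of_deriv_eq_zero (fun t => (hprod t).differentiableAt)
    (fun t => (hprod t).deriv) t 0
  simp only [h0, Complex.ofReal_zero, zero_mul, neg_zero, Complex.exp_zero, mul_one] at hconst
  rw [Complex.exp_neg] at hconst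
  field_simp at hconst
  exact hconst

variable {P : Subgroup (GL (Fin n) ℂ)} {χ : P →* ℂˣ}

theorem IsHolomorphicCharacter.continuous (hχ : IsHolomorphicCharacter χ) :
    Continuous fun h : P => (χ h : ℂ) := by
  rw [continuous_iff_continuousAt]
  intro g
  obtain ⟨F, hF, hFχ⟩ := hχ g
  have h1 : ContinuousAt (fun h : P => F fun i j => (h : GL (Fin n) ℂ) i j) g := by
    refine ContinuousAt.comp (f := fun h : P => fun i j => (h : GL (Fin n) ℂ) i j)
      hF.continuousAt ?_
    have : Continuous fun h : P => ((h : GL (Fin n) ℂ) : Mat n) :=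
      Units.continuous_val.comp continuous_subtype_val
    exact this.continuousAt
  exact h1.congr hFχ

theorem hasDerivAt_char (hχ : IsHolomorphicCharacter χ) (A : lieSet P) :
    HasDerivAt (fun t : ℝ => (χ ⟨expGL (t • (A : Mat n)), A.2 t⟩ : ℂ)) (charDeriv χ A) 0 := by
  refine DifferentiableAt.hasDerivAt ?_
  obtain ⟨F, hF, hFχ⟩ := hχ 1
  have hc : Continuous fun t : ℝ => (⟨expGL (t • (A : Mat n)), A.2 t⟩ : P) :=
    (continuous_expGL.comp (continuous_id.smul continuous_const)).subtype_mk _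
  have h1 : (⟨expGL ((0 : ℝ) • (A : Mat n)), A.2 0⟩ : P) = 1 := by
    apply Subtype.ext; simp
  have h2 := (hc.tendsto 0)
  rw [h1] at h2
  have h3 := h2.eventually hFχ
  have h4 : DifferentiableAt ℝ (fun t : ℝ => F fun i j => NormedSpace.exp (t • (A : Mat n)) i j) 0 := by
    have h5 : DifferentiableAt ℝ F (fun i j => NormedSpace.exp ((0 : ℝ) • (A : Mat n)) i j) := by
      have h6 : (fun i j => NormedSpace.exp ((0 : ℝ) • (A : Mat n)) i j) =
          fun i j => ((1 : P) : GL (Fin n) ℂ) i j := by simp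
      rw [h6]
      exact hF.differentiableAt.restrictScalars ℝ
    refine DifferentiableAt.comp (f := fun t : ℝ => fun i j => NormedSpace.exp (t • (A : Mat n)) i j)
      0 h5 ?_
    refine differentiableAt_pi.2 fun i => differentiableAt_pi.2 fun j => ?_
    exact (hasDerivAt_exp_smul_apply _ i j).differentiableAt
  exact h4.congr_of_eventuallyEq (h3.mono fun t ht => ht.symm)

theorem char_expGL (hχ : IsHolomorphicCharacter χ) (A : lieSet P) (t : ℝ) :
    (χ ⟨expGL (t • (A : Mat n)), A.2 t⟩ : ℂ) = Complex.exp (t * charDeriv χ A) := by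
  refine eq_exp_of_hasDerivAt (φ := fun t : ℝ => (χ ⟨expGL (t • (A : Mat n)), A.2 t⟩ : ℂ)) ?_ ?_
    (hasDerivAt_char hχ A) t
  · have h1 : (⟨expGL ((0 : ℝ) • (A : Mat n)), A.2 0⟩ : P) = 1 := by
      apply Subtype.ext; simp
    simp only [h1, map_one, Units.val_one]
  · intro s t
    rw [← Units.val_mul, ← map_mul]
    congr 2
    exact Subtype.ext (expGL_add_smul _ _ _)

/-! ### Rationality -/

theorem exists_approximation (d : Fin n → ℝ) {δ : ℝ} (hδ : 0 < δ) :
    ∃ (q : ℕ) (m : Fin n → ℤ), 0 < q ∧ ∀ i, |q * d i - m i| < δ := by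
  -- Two nearby fractional-part vectors are found by compactness, and the difference of their
  -- indices is the denominator.
  let x : ℕ → Fin n → ℝ := fun q i => Int.fract (q * d i)
  have hx : ∀ q, x q ∈ Set.univ.pi fun _ : Fin n => Set.Icc (0 : ℝ) 1 := fun q i _ =>
    ⟨Int.fract_nonneg _, (Int.fract_lt_one _).le⟩
  obtain ⟨y, -, φ, hφ, hlim⟩ := (isCompact_univ_pi fun _ : Fin n =>
    isCompact_Icc (a := (0 : ℝ)) (b := 1)).tendsto_subseq hx
  obtain ⟨N, hN⟩ := Metric.cauchySeq_iff'.1 hlim.cauchySeq δ hδ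
  have h1 := hN (N + 1) (Nat.le_succ N)
  have h2 : φ N < φ (N + 1) := hφ (Nat.lt_succ_self N)
  refine ⟨φ (N + 1) - φ N, fun i => ⌊(φ (N + 1) : ℝ) * d i⌋ - ⌊(φ N : ℝ) * d i⌋, by omega,
    fun i => ?_⟩
  have h3 := (dist_le_pi_dist _ _ i).trans_lt h1
  simp only [Function.comp, x, Real.dist_eq, Int.fract] at h3
  have e : ((φ (N + 1) - φ N : ℕ) : ℝ) * d i -
      ((⌊(φ (N + 1) : ℝ) * d i⌋ - ⌊(φ N : ℝ) * d i⌋ : ℤ) : ℝ) =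
      (φ (N + 1) : ℝ) * d i - ⌊(φ (N + 1) : ℝ) * d i⌋ -
        ((φ N : ℝ) * d i - ⌊(φ N : ℝ) * d i⌋) := by
    push_cast [Nat.cast_sub h2.le]
    ring
  rw [e]
  exact h3

/-- A vector is rational if the relevant subspace contains all its good rational approximation
errors and the vector has integral inner products with the integral vectors of the subspace. -/
theorem exists_integral_multiple {d : Fin n → ℝ} {T : Submodule ℝ (Fin n → ℝ)} (hd : d ∈ T)
    {δ : ℝ} (hδ : 0 < δ)
    (hT : ∀ (q : ℕ) (m : Fin n → ℤ), (∀ i, |q * d i - m i| < δ) →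
      (fun i => q * d i - m i) ∈ T)
    (hint : ∀ m : Fin n → ℤ, (fun i => (m i : ℝ)) ∈ T → ∃ k : ℤ, ∑ i, d i * m i = k) :
    ∃ (q : ℕ) (m : Fin n → ℤ), 0 < q ∧ ∀ i, q * d i = m i := by
  let S : Set (Fin n → ℝ) := {v | v ∈ T ∧ ∃ m : Fin n → ℤ, v = fun i => (m i : ℝ)}
  let V := Submodule.span ℝ S
  have hSq : ∀ (q : ℕ) (m : Fin n → ℤ), (∀ i, |q * d i - m i| < δ) →
      (fun i => (m i : ℝ)) ∈ S := by
    intro q m h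
    refine ⟨?_, m, rfl⟩
    have : (fun i => (m i : ℝ)) = (q : ℝ) • d - fun i => q * d i - m i := by
      ext i; simp
    rw [this]
    exact T.sub_mem (T.smul_mem _ hd) (hT q m h)
  -- The vectors m/q approximate d and lie in the closed span V of the integral vectors of T.
  have hdV : d ∈ V := by
    have hcl : IsClosed (V : Set (Fin n → ℝ)) := Submodule.closed_of_finiteDimensional V
    rw [← SetLike.mem_coe, ← hcl.closure_eq, Metric.mem_closure_iff]
    intro ε hε
    obtain ⟨q, m, hq, hqm⟩ := exists_approximation d (lt_min hδ hε)
    refine ⟨(q : ℝ)⁻¹ • fun i => (m i : ℝ), V.smul_mem _ (Submodule.subset_span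
      (hSq q m fun i => (hqm i).trans_le (min_le_left _ _))), ?_⟩
    rw [dist_pi_lt_iff hε]
    intro i
    have hq1 : (1 : ℝ) ≤ q := by exact_mod_cast hq
    have h1 : d i - ((q : ℝ)⁻¹ • fun i => (m i : ℝ)) i = (q : ℝ)⁻¹ * (q * d i - m i) := by
      simp only [Pi.smul_apply, smul_eq_mul]; field_simp
    rw [Real.dist_eq, h1, abs_mul, abs_inv, Nat.abs_cast]
    calc (q : ℝ)⁻¹ * |q * d i - m i| ≤ 1 * |q * d i - m i| := by
          gcongr; exact inv_le_one_of_one_le₀ hq1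
      _ < ε := by rw [one_mul]; exact (hqm i).trans_le (min_le_right _ _)
  obtain ⟨F, hFS, hF⟩ := (Submodule.fg_span_iff_fg_span_finset_subset (R := ℝ) S).1
    (Module.Finite.iff_fg.1 (inferInstance : Module.Finite ℝ V))
  -- With errors below η, the inner product of the error with each integral generator is an integer
  -- of absolute value below 1, hence 0. The error lies in V and is orthogonal to V, so it vanishes.
  obtain ⟨η, hη, hηF⟩ : ∃ η : ℝ, 0 < η ∧ ∀ v ∈ F, η * ∑ i, |v i| < 1 := by
    refine ⟨1 / (1 + ∑ v ∈ F, ∑ i, |v i|), by positivity, fun v hv => ?_⟩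
    have h1 : ∑ i, |v i| ≤ ∑ v ∈ F, ∑ i, |v i| :=
      Finset.single_le_sum (f := fun v => ∑ i, |v i|) (fun _ _ => by positivity) hv
    rw [div_mul_eq_mul_div, one_mul, div_lt_one (by positivity)]
    linarith
  obtain ⟨q, m, hq, hqm⟩ := exists_approximation d (lt_min hδ hη)
  refine ⟨q, m, hq, ?_⟩
  set ε : Fin n → ℝ := fun i => q * d i - m i with hε
  have hmS := hSq q m fun i => (hqm i).trans_le (min_le_left _ _)
  have hεV : ε ∈ V := by
    have : ε = (q : ℝ) • d - fun i => (m i : ℝ) := by ext i; simp [hε]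
    rw [this]
    exact V.sub_mem (V.smul_mem _ hdV) (Submodule.subset_span hmS)
  have hort : ∀ v ∈ F, ∑ i, ε i * v i = 0 := by
    intro v hv
    obtain ⟨hvT, m', rfl⟩ := hFS hv
    obtain ⟨k, hk⟩ := hint m' hvT
    have h1 : ∑ i, ε i * (m' i : ℝ) = ((q * k - ∑ i, m i * m' i : ℤ) : ℝ) := by
      push_cast
      rw [← hk, Finset.mul_sum, ← Finset.sum_sub_distrib]
      refine Finset.sum_congr rfl fun i _ => ?_
      simp only [hε]; ring
    have h2 : |∑ i, ε i * (m' i : ℝ)| < 1 := by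
      refine lt_of_le_of_lt ?_ (hηF _ hv)
      rw [Finset.mul_sum]
      refine (Finset.abs_sum_le_sum_abs _ _).trans (Finset.sum_le_sum fun i _ => ?_)
      rw [abs_mul]
      gcongr
      exact (hqm i).le.trans (min_le_right _ _)
    rw [h1] at h2 ⊢
    have h3 : |(q * k - ∑ i, m i * m' i : ℤ)| < 1 := by exact_mod_cast h2
    exact_mod_cast Int.abs_lt_one_iff.1 h3
  have hperp : ∀ v ∈ V, ∑ i, ε i * v i = 0 := by
    intro v hv
    change v ∈ Submodule.span ℝ S at hv
    rw [hF] at hv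
    induction hv using Submodule.span_induction with
    | mem x hx => exact hort x hx
    | zero => simp
    | add x y _ _ hx hy => simp [mul_add, Finset.sum_add_distrib, hx, hy]
    | smul a x _ hx =>
      have : ∑ i, ε i * (a • x) i = a * ∑ i, ε i * x i := by
        rw [Finset.mul_sum]
        refine Finset.sum_congr rfl fun i _ => ?_
        simp only [Pi.smul_apply, smul_eq_mul]; ring
      rw [this, hx, mul_zero]
  have h0 := (Finset.sum_eq_zero_iff_of_nonneg fun i _ => mul_self_nonneg (ε i)).1 (hperp ε hεV)
  intro i
  have := h0 i (Finset.mem_univ i)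
  exact sub_eq_zero.1 (mul_self_eq_zero.1 this)

end GHiggs

/-! ### Products of powers of block determinants as characters. -/

namespace GHiggs

/-! ### Block characters -/

section Det

variable {ι : Type*} [Fintype ι]

/-- A non-trivial permutation moves at least two indices, so after differentiating one factor an
off-diagonal entry of the identity remains. -/
theorem hasDerivAt_det [DecidableEq ι] {M : ℝ → Matrix ι ι ℂ} {M' : Matrix ι ι ℂ} (h1 : M 0 = 1)
    (hM : ∀ i j, HasDerivAt (fun t => M t i j) (M' i j) 0) :
    HasDerivAt (fun t => (M t).det) M'.trace 0 := by
  have hσ : ∀ σ : Equiv.Perm ι, HasDerivAt (fun t => ((Equiv.Perm.sign σ : ℤ) : ℂ) * ∏ i, M t (σ i) i)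
      (((Equiv.Perm.sign σ : ℤ) : ℂ) *
        ∑ i, (∏ k ∈ Finset.univ.erase i, M 0 (σ k) k) • M' (σ i) i) 0 := fun σ =>
    (HasDerivAt.fun_finsetProd fun i _ => hM (σ i) i).const_mul _
  have hsum := HasDerivAt.fun_sum fun σ (_ : σ ∈ Finset.univ) => hσ σ
  have e : ∑ σ : Equiv.Perm ι, (((Equiv.Perm.sign σ : ℤ) : ℂ) *
        ∑ i, (∏ k ∈ Finset.univ.erase i, M 0 (σ k) k) • M' (σ i) i) = M'.trace := by
    rw [Finset.sum_eq_single 1]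
    · simp [h1, Matrix.trace]
    · intro σ _ hne
      rw [Finset.sum_eq_zero, mul_zero]
      intro i _
      have hk : ∃ k ∈ Finset.univ.erase i, M 0 (σ k) k = 0 := by
        obtain ⟨k, hk⟩ : ∃ k, σ k ≠ k := by
          by_contra! hcon
          exact hne (Equiv.ext hcon)
        by_cases hki : k = i
        · refine ⟨σ k, ?_, ?_⟩
          · simpa [← hki] using hk
          · rw [h1, Matrix.one_apply_ne]
            exact fun h => hk (σ.injective h)
        · exact ⟨k, by simpa using hki, by rw [h1, Matrix.one_apply_ne hk]⟩
      obtain ⟨k, hk, h0⟩ := hk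
      rw [Finset.prod_eq_zero (f := fun k => M 0 (σ k) k) hk h0, zero_smul]
    · simp
  rw [e] at hsum
  simpa only [Matrix.det_apply'] using hsum

theorem toSquareBlock_mul {α R : Type*} [LinearOrder α] [CommRing R] {b : ι → α}
    {M N : Matrix ι ι R} (hM : M.BlockTriangular b) (hN : N.BlockTriangular b) (a : α) :
    (M * N).toSquareBlock b a = M.toSquareBlock b a * N.toSquareBlock b a := by
  ext i j
  simp only [Matrix.toSquareBlock_def, Matrix.mul_apply, Matrix.of_apply]
  rw [← Finset.sum_subtype (Finset.univ.filter (b · = a)) (by simp) (fun k => M i k * N k j)]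
  symm
  apply Finset.sum_filter_of_ne
  intro k _ hk
  have h1 : b i ≤ b k := not_lt.1 fun h => hk (by rw [hM h, zero_mul])
  have h2 : b k ≤ b j := not_lt.1 fun h => hk (by rw [hN h, mul_zero])
  exact le_antisymm (j.2 ▸ h2) (i.2 ▸ h1)

end Det

variable {n : ℕ} {c : GL (Fin n) ℂ} {m : Fin n → ℤ} {Q : Subgroup (GL (Fin n) ℂ)}

/-- The determinant of a diagonal block, as a character of a group of block triangular matrices. -/
noncomputable def blockDet (hQ : ∀ g ∈ Q, (cj c (g : Mat n)).BlockTriangular m) (a : ℤ) :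
    Q →* ℂˣ :=
  MonoidHom.toHomUnits
    { toFun := fun g => ((cj c ((g : GL (Fin n) ℂ) : Mat n)).toSquareBlock m a).det
      map_one' := by
        have : (1 : Mat n).toSquareBlock m a = 1 := by
          ext i j
          simp [Matrix.toSquareBlock_def, Matrix.one_apply, Subtype.ext_iff]
        simp [this]
      map_mul' := fun g h => by
        have : (((g * h : Q) : GL (Fin n) ℂ) : Mat n) =
            ((g : GL (Fin n) ℂ) : Mat n) * ((h : GL (Fin n) ℂ) : Mat n) := rfl
        rw [this, map_mul, toSquareBlock_mul (hQ _ g.2) (hQ _ h.2), Matrix.det_mul] }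

/-- The character of a group of block triangular matrices that is given by integral weights of
the blocks. -/
noncomputable def blockChar (hQ : ∀ g ∈ Q, (cj c (g : Mat n)).BlockTriangular m) : Q →* ℂˣ :=
  ∏ a ∈ Finset.univ.image m, blockDet hQ a ^ a

theorem coe_blockDet (hQ : ∀ g ∈ Q, (cj c (g : Mat n)).BlockTriangular m) (a : ℤ) (g : Q) :
    (blockDet hQ a g : ℂ) = ((cj c ((g : GL (Fin n) ℂ) : Mat n)).toSquareBlock m a).det := rfl

theorem coe_blockChar (hQ : ∀ g ∈ Q, (cj c (g : Mat n)).BlockTriangular m) (g : Q) :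
    (blockChar hQ g : ℂ) = ∏ a ∈ Finset.univ.image m,
      ((cj c ((g : GL (Fin n) ℂ) : Mat n)).toSquareBlock m a).det ^ a := by
  rw [blockChar, MonoidHom.finsetProd_apply, Units.coe_prod]
  refine Finset.prod_congr rfl fun a _ => ?_
  rw [MonoidHom.zpow_apply, Units.val_zpow_eq_zpow_val, coe_blockDet]

theorem analyticAt_block_det (c : GL (Fin n) ℂ) (m : Fin n → ℤ) (a : ℤ)
    (M : Fin n → Fin n → ℂ) :
    AnalyticAt ℂ (fun M : Fin n → Fin n → ℂ => ((cj c (Matrix.of M)).toSquareBlock m a).det) M := by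
  simp only [Matrix.det_apply', cj_apply, Matrix.toSquareBlock_def, Matrix.of_apply,
    Matrix.mul_apply]
  have hproj : ∀ i j, AnalyticAt ℂ (fun M : Fin n → Fin n → ℂ => M i j) M := fun i j =>
    ((ContinuousLinearMap.proj (R := ℂ) (φ := fun _ : Fin n => ℂ) j).comp
      (ContinuousLinearMap.proj (R := ℂ) (φ := fun _ : Fin n => Fin n → ℂ) i)).analyticAt M
  refine Finset.analyticAt_fun_sum _ fun σ _ => analyticAt_const.mul ?_
  refine Finset.analyticAt_fun_prod _ fun i _ => ?_
  refine Finset.analyticAt_fun_sum _ fun k _ => AnalyticAt.mul ?_ analyticAt_const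
  exact Finset.analyticAt_fun_sum _ fun l _ => analyticAt_const.mul (hproj _ _)

theorem isHolomorphicCharacter_blockChar
    (hQ : ∀ g ∈ Q, (cj c (g : Mat n)).BlockTriangular m) :
    IsHolomorphicCharacter (blockChar hQ) := by
  intro g
  refine ⟨fun M => ∏ a ∈ Finset.univ.image m, ((cj c (Matrix.of M)).toSquareBlock m a).det ^ a,
    ?_, Filter.Eventually.of_forall fun h => (coe_blockChar hQ h).symm⟩
  refine Finset.analyticAt_fun_prod _ fun a _ => ?_
  -- The exponent a may be negative, so the block determinant has to be non-zero at the point.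
  exact (analyticAt_block_det c m a _).fun_zpow
    (by exact (coe_blockDet hQ a g) ▸ (blockDet hQ a g).ne_zero)

theorem IsHolomorphicCharacter.pow {χ : Q →* ℂˣ} (hχ : IsHolomorphicCharacter χ) (k : ℕ) :
    IsHolomorphicCharacter (χ ^ k) := by
  intro g
  obtain ⟨F, hF, hFχ⟩ := hχ g
  refine ⟨fun M => F M ^ k, hF.fun_pow k, hFχ.mono fun h hh => ?_⟩
  simp [hh]

theorem charDeriv_pow {χ : Q →* ℂˣ} (hχ : IsHolomorphicCharacter χ) (k : ℕ) (A : lieSet Q) :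
    charDeriv (χ ^ k) A = k * charDeriv χ A := by
  have h := (hasDerivAt_char hχ A).fun_pow k
  have h1 : (⟨expGL ((0 : ℝ) • (A : Mat n)), A.2 0⟩ : Q) = 1 := by
    apply Subtype.ext; simp
  rw [h1] at h
  simp only [map_one, Units.val_one, one_pow, mul_one] at h
  simpa [charDeriv] using h.deriv

theorem charDeriv_blockChar (hQ : ∀ g ∈ Q, (cj c (g : Mat n)).BlockTriangular m)
    (A : lieSet Q) : charDeriv (blockChar hQ) A = ∑ i, (m i : ℂ) * cj c (A : Mat n) i i := by
  set D : ℤ → ℂ := fun a => ((cj c (A : Mat n)).toSquareBlock m a).trace with hD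
  have hblock : ∀ (a : ℤ) (t : ℝ),
      (blockDet hQ a ⟨expGL (t • (A : Mat n)), A.2 t⟩ : ℂ) = Complex.exp (t * D a) := by
    intro a
    refine eq_exp_of_hasDerivAt
      (φ := fun t : ℝ => (blockDet hQ a ⟨expGL (t • (A : Mat n)), A.2 t⟩ : ℂ)) ?_ ?_ ?_
    · have h1 : (⟨expGL ((0 : ℝ) • (A : Mat n)), A.2 0⟩ : Q) = 1 := by
        apply Subtype.ext; simp
      simp only [h1, map_one, Units.val_one]
    · intro s t
      rw [← Units.val_mul, ← map_mul]
      congr 2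
      exact Subtype.ext (expGL_add_smul _ _ _)
    · simp only [coe_blockDet, coe_expGL, cj_exp, cj_real_smul]
      refine hasDerivAt_det ?_ fun i j => hasDerivAt_exp_smul_apply _ _ _
      ext i j
      simp [Matrix.toSquareBlock_def, Matrix.one_apply, Subtype.ext_iff]
  have hsum : ∑ a ∈ Finset.univ.image m, (a : ℂ) * D a = ∑ i, (m i : ℂ) * cj c (A : Mat n) i i := by
    rw [← Finset.sum_fiberwise_of_maps_to (t := Finset.univ.image m) (g := m)
      (fun i _ => Finset.mem_image_of_mem m (Finset.mem_univ i))]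
    refine Finset.sum_congr rfl fun a _ => ?_
    have h1 : ∑ i ∈ Finset.univ.filter (m · = a), (m i : ℂ) * cj c (A : Mat n) i i =
        ∑ i ∈ Finset.univ.filter (m · = a), (a : ℂ) * cj c (A : Mat n) i i := by
      refine Finset.sum_congr rfl fun i hi => ?_
      rw [(Finset.mem_filter.1 hi).2]
    rw [h1, ← Finset.mul_sum, hD]
    congr 1
    symm
    exact Finset.sum_subtype (Finset.univ.filter (m · = a)) (p := fun k => m k = a) (by simp)
      (fun k => cj c (A : Mat n) k k)
  have hprod : ∀ t : ℝ, (blockChar hQ ⟨expGL (t • (A : Mat n)), A.2 t⟩ : ℂ) =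
      Complex.exp (t * ∑ i, (m i : ℂ) * cj c (A : Mat n) i i) := by
    intro t
    rw [coe_blockChar, ← hsum, Finset.mul_sum, Complex.exp_sum]
    refine Finset.prod_congr rfl fun a _ => ?_
    have := hblock a t
    rw [coe_blockDet] at this
    rw [this, ← Complex.exp_int_mul]
    ring_nf
  have hd : HasDerivAt (fun t : ℝ => Complex.exp (t * ∑ i, (m i : ℂ) * cj c (A : Mat n) i i))
      (∑ i, (m i : ℂ) * cj c (A : Mat n) i i) 0 := by
    have := ((Complex.ofRealCLM.hasDerivAt (x := (0 : ℝ))).mul_const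
      (∑ i, (m i : ℂ) * cj c (A : Mat n) i i)).cexp
    simpa using! this
  rw [charDeriv]
  simp only [hprod]
  exact hd.deriv

end GHiggs

/-! ### Characters restricted to compact Levi subgroups, and inclusion of parabolics. -/

namespace GHiggs

variable {n : ℕ} {G G' : ComplexReductiveGroup n} {c : GL (Fin n) ℂ}

/-! ### The compact form of a Levi subgroup -/

theorem cj_eq_self_iff {g : GL (Fin n) ℂ} {A : Mat n} : cj g A = A ↔ Commute (g : Mat n) A := by
  rw [cj_apply, Units.mul_inv_eq_iff_eq_mul]
  rfl

theorem expGL_commute {g : GL (Fin n) ℂ} {A : Mat n} (h : cj g A = A) (t : ℝ) :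
    expGL (t • A) * g * (expGL (t • A))⁻¹ = g := by
  have h1 : g * expGL (t • A) * g⁻¹ = expGL (t • A) := by rw [conj_expGL, cj_real_smul, h]
  rw [mul_inv_eq_iff_eq_mul] at h1 ⊢
  exact h1.symm

theorem mem_parabolic_of_cj_eq {Q : Subgroup (GL (Fin n) ℂ)} {s : Mat n} {g : GL (Fin n) ℂ}
    (hg : g ∈ Q) (h : cj g s = s) : g ∈ parabolic Q s :=
  ⟨hg, {g}, isCompact_singleton, fun t _ => expGL_commute h t⟩

/-- The elements of `G` that commute with `s` and become unitary after conjugation by `c`. -/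
def leviForm (G : ComplexReductiveGroup n) (c : GL (Fin n) ℂ) (s : Mat n) :
    Subgroup (GL (Fin n) ℂ) :=
  unitaryForm G c ⊓
    { carrier := {g | cj g s = s}
      one_mem' := cj_one s
      mul_mem' := fun {a b} ha hb => by
        change cj (a * b) s = s
        rw [cj_mul, show cj b s = s from hb, show cj a s = s from ha]
      inv_mem' := fun {a} ha => by
        change cj a⁻¹ s = s
        conv_lhs => rw [← show cj a s = s from ha]
        exact cj_inv_cj _ _ }

variable {s : Mat n}

theorem isCompact_leviForm (G : ComplexReductiveGroup n) (c : GL (Fin n) ℂ) (s : Mat n) :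
    IsCompact (leviForm G c s : Set (GL (Fin n) ℂ)) := by
  refine (isCompact_unitaryForm G c).of_isClosed_subset ?_ fun g hg => hg.1
  refine (isCompact_unitaryForm G c).isClosed.inter ?_
  have : Continuous fun g : GL (Fin n) ℂ => cj g s := by
    simp only [cj_apply]
    exact (Units.continuous_val.mul continuous_const).mul (Units.continuous_val.comp continuous_inv)
  exact isClosed_eq this continuous_const

theorem leviForm_le_parabolic : leviForm G c s ≤ parabolic G.carrier s := fun _ hg =>
  mem_parabolic_of_cj_eq hg.1.1 hg.2

theorem commute_of_mem_lieSet {H : Subgroup (GL (Fin n) ℂ)} (hH : ∀ h ∈ H, cj h s = s) {A : Mat n}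
    (hA : A ∈ lieSet H) : Commute A s := by
  ext i j
  have h1 : ∀ t : ℝ, (NormedSpace.exp (t • A) * s) i j = (s * NormedSpace.exp (t • A)) i j :=
    fun t => congrFun (congrFun (cj_eq_self_iff.1 (hH _ (hA t))).eq i) j
  have h2 : HasDerivAt (fun t : ℝ => (NormedSpace.exp (t • A) * s) i j) ((A * s) i j) 0 := by
    simp only [Matrix.mul_apply]
    exact HasDerivAt.fun_sum fun k _ => (hasDerivAt_exp_smul_apply A i k).mul_const _
  have h3 : HasDerivAt (fun t : ℝ => (s * NormedSpace.exp (t • A)) i j) ((s * A) i j) 0 := by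
    simp only [Matrix.mul_apply]
    exact HasDerivAt.fun_sum fun k _ => (hasDerivAt_exp_smul_apply A k j).const_mul _
  simp only [h1] at h2
  exact h2.unique h3

theorem mem_lieSet_leviForm_iff {A : Mat n} : A ∈ lieSet (leviForm G c s) ↔
    A ∈ G.lie ∧ (cj c A)ᴴ = -cj c A ∧ Commute A s := by
  constructor
  · intro h
    have h1 : leviForm G c s ≤ unitaryForm G c := inf_le_left
    have h2 : unitaryForm G c ≤ G.carrier := inf_le_left
    exact ⟨(G.mem_lie A).2 (lieSet_mono (h1.trans h2) h),
      skew_of_mem_lieSet (H := unitaryForm G c) (fun k hk => hk.2) (lieSet_mono h1 h),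
      commute_of_mem_lieSet (H := leviForm G c s) (fun h hh => hh.2) h⟩
  · rintro ⟨h1, h2, h3⟩ t
    refine ⟨⟨expGL_smul_mem h1 t, ?_⟩, cj_expGL_of_commute (h3.smul_left t)⟩
    change c * expGL (t • A) * c⁻¹ ∈ unitaryGL n
    rw [conj_expGL]
    apply expGL_mem_unitaryGL
    rw [cj_real_smul, Matrix.conjTranspose_smul, h2, smul_neg, star_trivial]

/-- The Lie algebra of `leviForm G c s`. -/
def leviFormLie (G : ComplexReductiveGroup n) (c : GL (Fin n) ℂ) (s : Mat n) :
    Submodule ℝ (Mat n) where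
  carrier := {A | A ∈ G.lie ∧ (cj c A)ᴴ = -cj c A ∧ Commute A s}
  zero_mem' := ⟨zero_mem _, by simp, Commute.zero_left _⟩
  add_mem' := by
    rintro a b ⟨ha, ha', ha''⟩ ⟨hb, hb', hb''⟩
    refine ⟨add_mem ha hb, ?_, ha''.add_left hb''⟩
    rw [map_add, Matrix.conjTranspose_add, ha', hb', neg_add]
  smul_mem' := by
    rintro t a ⟨ha, ha', ha''⟩
    refine ⟨real_smul_mem_lie ha t, ?_, ha''.smul_left t⟩
    rw [cj_real_smul, Matrix.conjTranspose_smul, ha', smul_neg, star_trivial]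

theorem mem_leviFormLie_iff {A : Mat n} :
    A ∈ leviFormLie G c s ↔ A ∈ lieSet (leviForm G c s) := mem_lieSet_leviForm_iff.symm

theorem mem_lieSet_parabolic_of_commute {Q : Subgroup (GL (Fin n) ℂ)} {A : Mat n}
    (hA : A ∈ lieSet Q) (h : Commute A s) : A ∈ lieSet (parabolic Q s) := fun t =>
  mem_parabolic_of_cj_eq (hA t) (cj_expGL_of_commute (h.smul_left t))

variable {χ : parabolic G.carrier s →* ℂˣ}

theorem char_leviForm_bounded (hχ : IsHolomorphicCharacter χ) :
    ∃ R : ℝ, ∀ g (hg : g ∈ leviForm G c s), ‖(χ ⟨g, leviForm_le_parabolic hg⟩ : ℂ)‖ ≤ R := by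
  have : CompactSpace (leviForm G c s) := isCompact_iff_compactSpace.1 (isCompact_leviForm G c s)
  have hc : Continuous fun g : leviForm G c s => ‖(χ (Subgroup.inclusion leviForm_le_parabolic g) : ℂ)‖ :=
    (hχ.continuous.comp (continuous_subtype_val.subtype_mk _)).norm
  obtain ⟨R, hR⟩ := (isCompact_range hc).bddAbove
  exact ⟨R, fun g hg => hR ⟨⟨g, hg⟩, rfl⟩⟩

/-- The character is bounded on the compact Levi form, while its norm at exp(tA) is exp(t Re
χ_*(A)). -/
theorem re_charDeriv_eq_zero (hχ : IsHolomorphicCharacter χ) {A : Mat n}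
    (hA : A ∈ lieSet (leviForm G c s)) :
    (charDeriv χ ⟨A, lieSet_mono leviForm_le_parabolic hA⟩).re = 0 := by
  obtain ⟨R, hR⟩ := char_leviForm_bounded (c := c) hχ
  set a := charDeriv χ ⟨A, lieSet_mono leviForm_le_parabolic hA⟩ with ha
  have h1 : ∀ t : ℝ, Real.exp (t * a.re) ≤ R := by
    intro t
    have h2 := hR _ (hA t)
    rw [char_expGL hχ ⟨A, lieSet_mono leviForm_le_parabolic hA⟩ t, Complex.norm_exp] at h2
    simpa using h2
  by_contra hne
  have h3 := h1 (R / a.re)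
  rw [div_mul_cancel₀ _ hne] at h3
  linarith [Real.add_one_le_exp R]

/-- The infinitesimal character is represented by a Hermitian element. -/
theorem IsPolar.dag_eq_self_of_charDeriv (h : IsPolar G c) (hχ : IsHolomorphicCharacter χ)
    (hsc : dag c s = s) {s₁ : Mat n} (hs₁ : s₁ ∈ G.lie) (hcomm : Commute s₁ s)
    (hχs : ∀ A : lieSet (parabolic G.carrier s), charDeriv χ A = (s₁ * (A : Mat n)).trace) :
    dag c s₁ = s₁ := by
  have hcomm' : Commute (dag c s₁) s := by
    have := congrArg (dag c) hcomm.eq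
    rw [dag_mul, dag_mul, hsc] at this
    exact this.symm
  set x := s₁ - dag c s₁ with hx
  have hxd : dag c x = -x := by rw [hx, dag_sub, dag_dag]; abel
  have hxg : x ∈ G.lie := sub_mem hs₁ (h.dag_mem hs₁)
  have hxs : Commute x s := hcomm.sub_left hcomm'
  have hskew : (cj c x)ᴴ = -cj c x := by rw [← cj_dag, hxd, map_neg]
  -- The skew element x = s₁ - s₁† is tangent to the compact Levi form, so Re tr(s₁x) = 0. This
  -- gives ‖x‖² = -tr(x²) = -2 Re tr(s₁x) = 0.
  have hxC : x ∈ lieSet (leviForm G c s) := mem_lieSet_leviForm_iff.2 ⟨hxg, hskew, hxs⟩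
  have h1 : ((s₁ * x).trace).re = 0 := by
    rw [← hχs ⟨x, lieSet_mono leviForm_le_parabolic hxC⟩]
    exact re_charDeriv_eq_zero hχ hxC
  have h2 : (dag c s₁ * x).trace = - star (s₁ * x).trace := by
    rw [← trace_dag (c := c), dag_mul, hxd, neg_mul, Matrix.trace_neg, neg_neg,
      Matrix.trace_mul_comm]
  have h3 : (x * x).trace.re = 0 := by
    rw [hx, sub_mul, ← hx, Matrix.trace_sub, h2, Complex.sub_re, Complex.neg_re]
    simp [h1]
  have h4 : (x * dag c x).trace = nsq (cj c x) := trace_mul_dag x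
  rw [hxd, mul_neg, Matrix.trace_neg] at h4
  have h5 : nsq (cj c x) = 0 := by
    have := congrArg Complex.re h4
    rw [Complex.neg_re, h3, neg_zero, Complex.ofReal_re] at this
    exact this.symm
  exact (sub_eq_zero.1 (nsq_cj_eq_zero.1 h5)).symm

/-- The target ℂˣ is commutative, so characters do not see conjugation. -/
theorem charDeriv_cj (χ : parabolic G.carrier s →* ℂˣ) (g : parabolic G.carrier s)
    (A : lieSet (parabolic G.carrier s)) :
    charDeriv χ ⟨cj (g : GL (Fin n) ℂ) A, cj_mem_lieSet A.2 g.2⟩ = charDeriv χ A := by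
  unfold charDeriv
  congr 1
  ext1 t
  have : (⟨expGL (t • cj (g : GL (Fin n) ℂ) (A : Mat n)), cj_mem_lieSet A.2 g.2 t⟩ :
      parabolic G.carrier s) = g * ⟨expGL (t • (A : Mat n)), A.2 t⟩ * g⁻¹ := by
    apply Subtype.ext
    change expGL (t • cj (g : GL (Fin n) ℂ) (A : Mat n)) =
      (g : GL (Fin n) ℂ) * expGL (t • (A : Mat n)) * (g : GL (Fin n) ℂ)⁻¹
    rw [conj_expGL, cj_real_smul]
  simp only [this, map_mul, map_inv]
  rw [mul_comm, inv_mul_cancel_left]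

/-- The parabolic subgroup of `s` is contained in that of `s₁`, if `s₁` represents a functional that
is invariant under the former and the corresponding inclusion of Lie algebras holds. -/
theorem blockTriangular_of_mem_parabolic {s₁ : Mat n} (hs : s ∈ G.lie)
    (hs₁ : s₁ ∈ G.lie) {d e : Fin n → ℝ} (he : cj c s = rdiag e) (hd : cj c s₁ = rdiag d)
    (h : IsPolar G c) (hle : G.parabolicLie s ⊆ G.parabolicLie s₁)
    (hinv : ∀ g ∈ parabolic G.carrier s, ∀ A ∈ G.parabolicLie s,
      (s₁ * cj g A).trace = (s₁ * A).trace)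
    {g : GL (Fin n) ℂ} (hg : g ∈ parabolic G.carrier s) : (cj c g).BlockTriangular d := by
  set N := cj g⁻¹ s₁ - s₁ with hN
  have hNg : N ∈ G.lie := sub_mem (cj_mem_lie hs₁ (G.carrier.inv_mem hg.1)) hs₁
  have htr : ∀ A ∈ G.parabolicLie s, (N * A).trace = 0 := by
    intro A hA
    rw [hN, sub_mul, Matrix.trace_sub, sub_eq_zero, ← hinv g hg A hA, ← trace_cj g, map_mul,
      cj_cj_inv]
  have hNe : ∀ i j, e j ≤ e i → cj c N i j = 0 := by
    obtain ⟨N', hN', hN'c⟩ := exists_component hs he hNg (fun x => 0 ≤ x)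
    have hA : dag c N' ∈ G.parabolicLie s := by
      rw [mem_parabolicLie_iff he]
      refine ⟨h.dag_mem hN', fun i j hij => ?_⟩
      rw [cj_dag, Matrix.conjTranspose_apply, hN'c, if_neg (by linarith), star_zero]
    have h1 := htr _ hA
    rw [← trace_cj c, map_mul, cj_dag] at h1
    have h2 : (cj c N * (cj c N')ᴴ).trace = nsq (cj c N') := by
      rw [← trace_mul_conjTranspose]
      simp only [Matrix.trace, Matrix.diag_apply, Matrix.mul_apply, Matrix.conjTranspose_apply]
      refine Finset.sum_congr rfl fun i _ => Finset.sum_congr rfl fun j _ => ?_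
      rw [hN'c]
      split_ifs <;> simp
    rw [h2, Complex.ofReal_eq_zero, nsq_eq_zero] at h1
    intro i j hij
    have h3 := hN'c i j
    rw [h1, if_pos (by linarith)] at h3
    exact h3.symm
  have hNd : (cj c N).BlockTriangular d := by
    have : N ∈ G.parabolicLie s := by
      rw [mem_parabolicLie_iff he]
      exact ⟨hNg, fun i j hij => hNe i j hij.le⟩
    exact ((mem_parabolicLie_iff hd).1 (hle this)).2
  -- This is [s₁, g] = gN in coordinates. As N strictly increases e and does not decrease d, the
  -- entries of g with dⱼ < dᵢ vanish by induction on eⱼ.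
  have heq : ∀ i j, ((d i - d j : ℝ) : ℂ) * cj c (g : Mat n) i j =
      ∑ k, cj c (g : Mat n) i k * cj c N k j := by
    intro i j
    rw [← bracket_rdiag_apply, ← Matrix.mul_apply, ← map_mul, ← hd,
      LieRing.of_associative_ring_bracket, ← map_mul, ← map_mul, ← map_sub]
    have : s₁ * (g : Mat n) = g * cj g⁻¹ s₁ := by
      rw [cj_apply, inv_inv, ← mul_assoc, ← mul_assoc, Units.mul_inv, one_mul]
    rw [hN, mul_sub, this]
  have hwf : WellFounded fun i j : Fin n => e i < e j :=
    @Finite.wellFounded_of_trans_of_irrefl _ _ _ ⟨fun _ _ _ => lt_trans⟩ ⟨fun _ => lt_irrefl _⟩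
  intro i j
  induction j using hwf.induction with
  | _ j ih =>
    intro hij
    have h1 := heq i j
    rw [Finset.sum_eq_zero, mul_eq_zero] at h1
    · refine h1.resolve_left ?_
      rw [Complex.ofReal_eq_zero]
      linarith
    · intro k _
      by_cases hk : cj c N k j = 0
      · rw [hk, mul_zero]
      · have h2 : e k < e j := not_le.1 fun h => hk (hNe k j h)
        have h3 : d k ≤ d j := not_lt.1 fun h => hk (hNd h)
        rw [ih k h2 (h3.trans_lt hij), zero_mul]

end GHiggs

/-! ### Rational weights, finite-order characters and extension of a power of χ. -/

namespace GHiggs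

variable {n : ℕ} {G G' : ComplexReductiveGroup n} {c : GL (Fin n) ℂ} {s s₁ : Mat n}
  {d e : Fin n → ℝ}

/-! ### Rationality of characters -/

/-- The matrix that becomes `2πi diag θ` after conjugation by `c`. -/
noncomputable def angleMatrix (c : GL (Fin n) ℂ) (θ : Fin n → ℝ) : Mat n :=
  (2 * Real.pi * Complex.I : ℂ) • cj c⁻¹ (rdiag θ)

theorem cj_angleMatrix (θ : Fin n → ℝ) :
    cj c (angleMatrix c θ) = Matrix.diagonal fun i => (2 * Real.pi * Complex.I : ℂ) * θ i := by
  rw [angleMatrix, map_smul, cj_cj_inv, rdiag, ← Matrix.diagonal_smul]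
  rfl

theorem angleMatrix_add (θ η : Fin n → ℝ) :
    angleMatrix c (θ + η) = angleMatrix c θ + angleMatrix c η := by
  apply (cj c).injective
  rw [map_add, cj_angleMatrix, cj_angleMatrix, cj_angleMatrix, Matrix.diagonal_add]
  congr 1
  ext i
  simp only [Pi.add_apply, Complex.ofReal_add, mul_add]

theorem commute_of_cj_diagonal {A B : Mat n} {a b : Fin n → ℂ} (hA : cj c A = Matrix.diagonal a)
    (hB : cj c B = Matrix.diagonal b) : Commute A B := by
  apply (cj c).injective
  rw [map_mul, map_mul, hA, hB, Matrix.diagonal_mul_diagonal, Matrix.diagonal_mul_diagonal]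
  congr 1
  ext i
  exact mul_comm _ _

theorem expGL_angleMatrix_add (θ η : Fin n → ℝ) :
    expGL (angleMatrix c (θ + η)) = expGL (angleMatrix c θ) * expGL (angleMatrix c η) := by
  rw [angleMatrix_add, expGL_add (commute_of_cj_diagonal (cj_angleMatrix θ) (cj_angleMatrix η))]

theorem expGL_angleMatrix_int (m : Fin n → ℤ) :
    expGL (angleMatrix c fun i => (m i : ℝ)) = 1 := by
  ext1
  apply (cj c).injective
  rw [coe_expGL, cj_exp, cj_angleMatrix, Matrix.exp_diagonal, Units.val_one, map_one,
    ← Matrix.diagonal_one]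
  congr 1
  ext i
  rw [Pi.coe_exp, ← Complex.exp_eq_exp_ℂ, Complex.exp_eq_one_iff]
  exact ⟨m i, by push_cast; ring⟩

theorem continuous_angleMatrix : Continuous (angleMatrix c) := by
  have h : Continuous (rdiag : (Fin n → ℝ) → Mat n) := by
    unfold rdiag
    exact Continuous.matrix_diagonal (by fun_prop)
  exact ((continuous_cj c⁻¹).comp h).const_smul (2 * Real.pi * Complex.I : ℂ)

/-- The real vectors that are diagonal elements of the Lie algebra, after conjugation by `c`. -/
noncomputable def diagonalLie (G : ComplexReductiveGroup n) (c : GL (Fin n) ℂ) :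
    Submodule ℝ (Fin n → ℝ) where
  carrier := {θ | cj c⁻¹ (rdiag θ) ∈ G.lie}
  zero_mem' := by
    have : rdiag (0 : Fin n → ℝ) = 0 := by ext i j; simp [rdiag]
    simp only [Set.mem_ofPred_eq, this, map_zero, zero_mem]
  add_mem' := by
    intro a b ha hb
    have : rdiag (a + b) = rdiag a + rdiag b := by
      rw [rdiag, rdiag, rdiag, Matrix.diagonal_add]
      congr 1; ext i; simp
    change cj c⁻¹ (rdiag (a + b)) ∈ G.lie
    rw [this, map_add]
    exact add_mem ha hb
  smul_mem' := by
    intro t a ha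
    change cj c⁻¹ (rdiag (t • a)) ∈ G.lie
    rw [← smul_rdiag, cj_real_smul]
    exact real_smul_mem_lie ha t

theorem mem_diagonalLie {θ : Fin n → ℝ} : θ ∈ diagonalLie G c ↔ cj c⁻¹ (rdiag θ) ∈ G.lie := Iff.rfl

theorem angleMatrix_mem_lieSet (he : cj c s = rdiag e) {θ : Fin n → ℝ}
    (hθ : θ ∈ diagonalLie G c) : angleMatrix c θ ∈ lieSet (leviForm G c s) := by
  rw [mem_lieSet_leviForm_iff]
  refine ⟨G.lie.smul_mem _ hθ, ?_, commute_of_cj_diagonal (cj_angleMatrix θ) he⟩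
  rw [cj_angleMatrix, Matrix.diagonal_conjTranspose, Matrix.diagonal_neg]
  congr 1
  ext i
  simp

theorem mem_diagonalLie_of_angleMatrix {θ : Fin n → ℝ} (h : angleMatrix c θ ∈ G.lie) :
    θ ∈ diagonalLie G c := by
  have h1 : (2 * Real.pi * Complex.I : ℂ) ≠ 0 := by
    simp [Real.pi_ne_zero]
  have := G.lie.smul_mem (2 * Real.pi * Complex.I : ℂ)⁻¹ h
  rwa [angleMatrix, smul_smul, inv_mul_cancel₀ h1, one_smul] at this

variable {χ : parabolic G.carrier s →* ℂˣ}

/-- The differential of a holomorphic character is a rational weight. -/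
theorem exists_integral_weights (hχ : IsHolomorphicCharacter χ)
    (he : cj c s = rdiag e) (hd : cj c s₁ = rdiag d) (hs₁ : s₁ ∈ G.lie)
    (hχs : ∀ A : lieSet (parabolic G.carrier s), charDeriv χ A = (s₁ * (A : Mat n)).trace) :
    ∃ (q : ℕ) (m : Fin n → ℤ), 0 < q ∧ ∀ i, q * d i = m i := by
  have hdT : d ∈ diagonalLie G c := by
    rw [mem_diagonalLie, ← hd, cj_inv_cj]; exact hs₁
  have h1 := eventually_mem_of_expGL_mem (isCompact_leviForm G c s).isClosed
    (W := leviFormLie G c s) (fun A => mem_leviFormLie_iff)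
  have h2 : Filter.Tendsto (angleMatrix c) (𝓝 0) (𝓝 0) := by
    have := (continuous_angleMatrix (c := c)).tendsto 0
    have h0 : angleMatrix c 0 = 0 := by
      apply (cj c).injective
      rw [cj_angleMatrix, map_zero]
      ext i j; simp
    rwa [h0] at this
  obtain ⟨δ, hδ, hball⟩ := Metric.eventually_nhds_iff.1 (h2.eventually h1)
  -- Here exp(2πi m) = 1 is used twice. It gives exp(2πi(qd - m)) = exp(2πi qd) in the Levi form, so
  -- a small error is tangent to it by the closed subgroup theorem. Applied to χ, it makes Σ dᵢmᵢ an
  -- integer.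
  refine exists_integral_multiple hdT hδ (fun q m hqm => ?_) fun m hm => ?_
  · set θ : Fin n → ℝ := fun i => q * d i - m i with hθ
    have h3 : dist θ 0 < δ := (dist_pi_lt_iff hδ).2 fun i => by
      rw [Real.dist_eq, Pi.zero_apply, sub_zero]
      exact hqm i
    have h4 : θ + (fun i => (m i : ℝ)) = (q : ℝ) • d := by
      ext i; simp [hθ]
    have h5 : expGL (angleMatrix c θ) = expGL (angleMatrix c ((q : ℝ) • d)) := by
      rw [← h4, expGL_angleMatrix_add, expGL_angleMatrix_int, mul_one]
    have h6 : angleMatrix c θ ∈ leviFormLie G c s := by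
      refine hball h3 ?_
      rw [h5]
      exact expGL_mem_of_mem_lieSet
        (angleMatrix_mem_lieSet he ((diagonalLie G c).smul_mem _ hdT))
    exact mem_diagonalLie_of_angleMatrix h6.1
  · have h3 := lieSet_mono leviForm_le_parabolic (angleMatrix_mem_lieSet he hm)
    have h4 := char_expGL hχ ⟨_, h3⟩ 1
    have h5 : (⟨expGL ((1 : ℝ) • angleMatrix c fun i => (m i : ℝ)), h3 1⟩ :
        parabolic G.carrier s) = 1 := by
      apply Subtype.ext
      change expGL ((1 : ℝ) • angleMatrix c fun i => (m i : ℝ)) = 1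
      rw [one_smul, expGL_angleMatrix_int]
    simp only at h4
    rw [h5, map_one, Units.val_one, hχs, eq_comm, Complex.exp_eq_one_iff] at h4
    obtain ⟨k, hk⟩ := h4
    refine ⟨k, ?_⟩
    rw [← trace_cj c, map_mul, hd, cj_angleMatrix, rdiag, Matrix.diagonal_mul_diagonal,
      Matrix.trace_diagonal, Complex.ofReal_one, one_mul] at hk
    have h6 : ((∑ i, d i * m i : ℝ) : ℂ) * (2 * Real.pi * Complex.I) =
        (k : ℂ) * (2 * Real.pi * Complex.I) := by
      rw [← hk]
      push_cast
      rw [Finset.sum_mul]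
      exact Finset.sum_congr rfl fun i _ => by ring
    have h7 := mul_right_cancel₀ (by simp [Real.pi_ne_zero]) h6
    exact_mod_cast h7

/-! ### Characters with trivial differential -/

/-- The kernel on the compact Levi form contains a neighbourhood of 1, so it is open of finite
index, and the index serves as exponent. -/
theorem exists_pow_eq_one_on_leviForm {ψ : parabolic G.carrier s →* ℂˣ}
    (h1 : ∀ A : Mat n, ∀ hA : A ∈ lieSet (parabolic G.carrier s),
      ψ ⟨expGL A, expGL_mem_of_mem_lieSet hA⟩ = 1) :
    ∃ k : ℕ, 0 < k ∧ ∀ g (hg : g ∈ leviForm G c s), ψ ⟨g, leviForm_le_parabolic hg⟩ ^ k = 1 := by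
  have : CompactSpace (leviForm G c s) := isCompact_iff_compactSpace.1 (isCompact_leviForm G c s)
  let ψC : leviForm G c s →* ℂˣ := ψ.comp (Subgroup.inclusion leviForm_le_parabolic)
  have h2 := eventually_exists_expGL (isCompact_leviForm G c s).isClosed
    (W := leviFormLie G c s) (fun A => mem_leviFormLie_iff)
  have h3 : (ψC.ker : Set (leviForm G c s)) ∈ 𝓝 1 := by
    have h4 : Filter.Tendsto (fun g : leviForm G c s => (g : GL (Fin n) ℂ)) (𝓝 1) (𝓝 1) :=
      continuous_subtype_val.tendsto 1
    filter_upwards [h4.eventually h2] with g hg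
    obtain ⟨A, hA, hgA⟩ := hg g.2
    have h5 := h1 A (lieSet_mono leviForm_le_parabolic (mem_leviFormLie_iff.1 hA))
    change ψ _ = 1
    rw [← h5]
    congr 1
    exact Subtype.ext hgA
  have h4 : IsOpen (ψC.ker : Set (leviForm G c s)) := ψC.ker.isOpen_of_mem_nhds h3
  have : Finite (leviForm G c s ⧸ ψC.ker) := Subgroup.quotient_finite_of_isOpen _ h4
  have : ψC.ker.FiniteIndex := Subgroup.finiteIndex_of_finite_quotient
  refine ⟨ψC.ker.index, Nat.pos_of_ne_zero Subgroup.FiniteIndex.index_ne_zero, fun g hg => ?_⟩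
  have h5 := ψC.ker.pow_index_mem (⟨g, hg⟩ : leviForm G c s)
  rw [MonoidHom.mem_ker, map_pow] at h5
  exact h5

/-- Every value of a continuous character of a parabolic subgroup with trivial differential is
taken on the compact form of the Levi subgroup. -/
theorem exists_leviForm_eq (hG : IsPolar G c) (he : cj c s = rdiag e) (hs : s ∈ G.lie)
    {ψ : parabolic G.carrier s →* ℂˣ} (hψ : Continuous fun g => (ψ g : ℂ))
    (h1 : ∀ A : Mat n, ∀ hA : A ∈ lieSet (parabolic G.carrier s),
      ψ ⟨expGL A, expGL_mem_of_mem_lieSet hA⟩ = 1) (g : parabolic G.carrier s) :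
    ∃ k, ∃ hk : k ∈ leviForm G c s, ψ g = ψ ⟨k, leviForm_le_parabolic hk⟩ := by
  have hsP : s ∈ lieSet (parabolic G.carrier s) :=
    mem_lieSet_parabolic_of_commute ((G.mem_lie s).1 hs) (Commute.refl s)
  -- Conjugation by exp(ts) does not change ψ and contracts g into the Levi subgroup. An ultrafilter
  -- picks a limit l in the compact set containing this orbit.
  let x : ℝ → parabolic G.carrier s := fun t =>
    ⟨expGL (t • s), hsP t⟩ * g * ⟨expGL (t • s), hsP t⟩⁻¹
  have hxψ : ∀ t, ψ (x t) = ψ g := fun t => by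
    simp only [x, map_mul, map_inv]
    rw [mul_comm, inv_mul_cancel_left]
  obtain ⟨K, hK, hgK⟩ := g.2.2
  let U : Ultrafilter ℝ := Ultrafilter.of Filter.atTop
  have hU : (U : Filter ℝ) ≤ Filter.atTop := Ultrafilter.of_le _
  obtain ⟨l, -, hl⟩ := hK.ultrafilter_le_nhds (U.map fun t => (x t : GL (Fin n) ℂ)) (by
    rw [Filter.le_principal_iff]
    exact hU ((Filter.eventually_ge_atTop 0).mono fun t ht => hgK t ht))
  have hl' : Filter.Tendsto (fun t => (x t : GL (Fin n) ℂ)) U (𝓝 l) := hl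
  have hlG : l ∈ G.carrier :=
    (isClosed_carrier G).mem_of_tendsto hl' (Filter.Eventually.of_forall fun t => (x t).2.1)
  have hls : Commute (l : Mat n) s := by
    apply (cj c).injective
    rw [map_mul, map_mul, he]
    ext i j
    rw [mul_rdiag_apply, rdiag_mul_apply]
    rcases lt_trichotomy (e i) (e j) with hij | hij | hij
    · have h2 : Filter.Tendsto (fun t => cj c ((x t : GL (Fin n) ℂ) : Mat n) i j) U
          (𝓝 (cj c (l : Mat n) i j)) := by
        have : Continuous fun y : GL (Fin n) ℂ => cj c (y : Mat n) i j :=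
          ((continuous_cj c).comp Units.continuous_val).matrix_elem i j
        exact (this.tendsto l).comp hl'
      have h3 : Filter.Tendsto (fun t => cj c ((x t : GL (Fin n) ℂ) : Mat n) i j) Filter.atTop
          (𝓝 0) := by
        have h4 : ∀ t, cj c ((x t : GL (Fin n) ℂ) : Mat n) i j =
            (Real.exp (t * (e i - e j)) : ℝ) * cj c ((g : GL (Fin n) ℂ) : Mat n) i j := fun t =>
          cj_cj_expGL_smul he t _ i j
        have h5 : Filter.Tendsto (fun t : ℝ => Real.exp (t * (e i - e j))) Filter.atTop (𝓝 0) :=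
          Real.tendsto_exp_atBot.comp
            (Filter.tendsto_id.atTop_mul_const_of_neg (sub_neg.2 hij))
        simp only [h4]
        have h6 := ((Complex.continuous_ofReal.tendsto 0).comp h5).mul_const
          (cj c ((g : GL (Fin n) ℂ) : Mat n) i j)
        simpa using! h6
      rw [tendsto_nhds_unique h2 (h3.mono_left hU), zero_mul, mul_zero]
    · rw [hij, mul_comm]
    · have h2 : ∀ t, cj c ((x t : GL (Fin n) ℂ) : Mat n) i j = 0 := fun t =>
        ((mem_parabolic_iff he).1 (x t).2).2.1 hij
      have h3 : Filter.Tendsto (fun t => cj c ((x t : GL (Fin n) ℂ) : Mat n) i j) U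
          (𝓝 (cj c (l : Mat n) i j)) := by
        have : Continuous fun y : GL (Fin n) ℂ => cj c (y : Mat n) i j :=
          ((continuous_cj c).comp Units.continuous_val).matrix_elem i j
        exact (this.tendsto l).comp hl'
      simp only [h2] at h3
      rw [← tendsto_nhds_unique tendsto_const_nhds h3, zero_mul, mul_zero]
  have hlP : l ∈ parabolic G.carrier s := mem_parabolic_of_cj_eq hlG (cj_eq_self_iff.2 hls)
  have hψl : ψ g = ψ ⟨l, hlP⟩ := by
    have h2 : Filter.Tendsto x U (𝓝 ⟨l, hlP⟩) := tendsto_subtype_rng.2 hl'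
    have h3 := (hψ.tendsto _).comp h2
    have h4 : (fun t => (ψ t : ℂ)) ∘ x = fun _ => (ψ g : ℂ) := by
      ext1 t; simp only [Function.comp, hxψ]
    rw [h4] at h3
    exact Units.ext (tendsto_nhds_unique tendsto_const_nhds h3)
  obtain ⟨k, hk, hku, Y, hY, hYc, hlY⟩ := hG l hlG
  -- After conjugation by c, exp(2Y) = lᴴ l commutes with the Hermitian s because l does, and then
  -- so does Y. Thus both polar factors of l stay in the Levi subgroup.
  have hYs : Commute Y s := by
    have hu := mem_unitaryGL.1 hku
    rw [coe_conj] at hu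
    have h2 : cj c (l : Mat n) = cj c (k : Mat n) * NormedSpace.exp (cj c Y) := by
      rw [hlY, Units.val_mul, coe_expGL, map_mul, cj_exp]
    have hexp : (NormedSpace.exp (cj c Y))ᴴ = NormedSpace.exp (cj c Y) := by
      rw [← Matrix.exp_conjTranspose, hYc]
    have h3 : (cj c (l : Mat n))ᴴ * cj c (l : Mat n) = NormedSpace.exp ((2 : ℝ) • cj c Y) := by
      rw [h2, Matrix.conjTranspose_mul, hexp, mul_assoc, ← mul_assoc _ (cj c (k : Mat n)), hu,
        one_mul, two_smul, Matrix.exp_add_of_commute _ _ (Commute.refl _)]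
    have h4 : Commute (cj c s) (cj c (l : Mat n)) := (hls.map (cj c)).symm
    have h5 : Commute (cj c s) (cj c (l : Mat n))ᴴ := by
      have := congrArg Matrix.conjTranspose h4.eq
      rw [Matrix.conjTranspose_mul, Matrix.conjTranspose_mul, he, rdiag_conjTranspose] at this
      rw [he]
      exact this.symm
    have h6 := h5.mul_right h4
    rw [h3] at h6
    have h7 := commute_of_commute_exp (by rw [Matrix.conjTranspose_smul, hYc, star_trivial]) h6
    have h8 : Commute (cj c s) (cj c Y) := by
      have := h7.smul_right (2⁻¹ : ℝ)
      rwa [smul_smul, inv_mul_cancel₀ two_ne_zero, one_smul] at this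
    apply (cj c).injective
    rw [map_mul, map_mul]
    exact h8.symm.eq
  have hYP := mem_lieSet_parabolic_of_commute ((G.mem_lie Y).1 hY) hYs
  have hkl : k = l * (expGL Y)⁻¹ := by rw [hlY, mul_inv_cancel_right]
  have hks : cj k s = s := by
    rw [hkl, cj_mul, ← expGL_neg, cj_expGL_of_commute hYs.neg_left]
    exact cj_eq_self_iff.2 hls
  have hkC : k ∈ leviForm G c s := ⟨⟨hk, hku⟩, hks⟩
  refine ⟨k, hkC, ?_⟩
  rw [hψl]
  have h2 : (⟨l, hlP⟩ : parabolic G.carrier s) =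
      ⟨k, leviForm_le_parabolic hkC⟩ * ⟨expGL Y, expGL_mem_of_mem_lieSet hYP⟩ :=
    Subtype.ext hlY
  rw [h2, map_mul, h1 Y hYP, mul_one]

theorem exists_pow_eq_one (hG : IsPolar G c) (he : cj c s = rdiag e) (hs : s ∈ G.lie)
    {ψ : parabolic G.carrier s →* ℂˣ} (hψ : Continuous fun g => (ψ g : ℂ))
    (h1 : ∀ A : Mat n, ∀ hA : A ∈ lieSet (parabolic G.carrier s),
      ψ ⟨expGL A, expGL_mem_of_mem_lieSet hA⟩ = 1) :
    ∃ k : ℕ, 0 < k ∧ ∀ g, ψ g ^ k = 1 := by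
  obtain ⟨k, hk, hkψ⟩ := exists_pow_eq_one_on_leviForm (c := c) h1
  refine ⟨k, hk, fun g => ?_⟩
  obtain ⟨k', hk', h2⟩ := exists_leviForm_eq hG he hs hψ h1 g
  rw [h2, hkψ k' hk']

/-- Some power of a holomorphic character extends to the parabolic subgroup of the element that
represents its differential. -/
theorem exists_char_extension (hG : IsPolar G c)
    (he : cj c s = rdiag e) (hs : s ∈ G.lie)
    (hd : cj c s₁ = rdiag d) (hs₁ : s₁ ∈ G.lie) (hχ : IsHolomorphicCharacter χ)
    (hχs : ∀ A : lieSet (parabolic G.carrier s), charDeriv χ A = (s₁ * (A : Mat n)).trace)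
    (hle : parabolic G.carrier s ≤ parabolic G'.carrier s₁) :
    ∃ (M : ℕ) (χ' : parabolic G'.carrier s₁ →* ℂˣ), 0 < M ∧ IsHolomorphicCharacter χ' ∧
      (∀ A : lieSet (parabolic G'.carrier s₁),
        charDeriv χ' A = M * (s₁ * (A : Mat n)).trace) ∧
      ∀ g : parabolic G.carrier s, χ' (Subgroup.inclusion hle g) = χ g ^ M := by
  obtain ⟨q, m, hq, hqm⟩ := exists_integral_weights hχ he hd hs₁ hχs
  have hq' : (0 : ℝ) < q := by exact_mod_cast hq
  have hQ : ∀ g ∈ parabolic G'.carrier s₁, (cj c (g : Mat n)).BlockTriangular m := by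
    intro g hg i j hij
    refine ((mem_parabolic_iff hd).1 hg).2.1 ?_
    have : ((m j : ℤ) : ℝ) < m i := by exact_mod_cast hij
    rw [← hqm, ← hqm] at this
    exact lt_of_mul_lt_mul_left this hq'.le
  set b := blockChar hQ with hb
  have hbh : IsHolomorphicCharacter b := isHolomorphicCharacter_blockChar hQ
  have hbd : ∀ A : lieSet (parabolic G'.carrier s₁),
      charDeriv b A = q * (s₁ * (A : Mat n)).trace := by
    intro A
    rw [hb, charDeriv_blockChar, ← trace_cj c, map_mul, hd, Matrix.trace, Finset.mul_sum]
    refine Finset.sum_congr rfl fun i _ => ?_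
    rw [Matrix.diag_apply, rdiag_mul_apply, ← mul_assoc]
    congr 1
    exact_mod_cast (hqm i).symm
  -- The block character b has differential q χ_*, so ψ has trivial differential. It may be
  -- non-trivial on other components, which costs a further exponent k and gives M = qk.
  let ψ : parabolic G.carrier s →* ℂˣ := b.comp (Subgroup.inclusion hle) * (χ ^ q)⁻¹
  have hψ : Continuous fun g => (ψ g : ℂ) := by
    have h1 : Continuous fun g : parabolic G.carrier s => (b (Subgroup.inclusion hle g) : ℂ) :=
      hbh.continuous.comp (continuous_subtype_val.subtype_mk _)
    have h2 : Continuous fun g : parabolic G.carrier s => ((χ g : ℂ) ^ q)⁻¹ :=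
      (hχ.continuous.pow q).inv₀ fun g => pow_ne_zero _ (χ g).ne_zero
    have h3 : (fun g => (ψ g : ℂ)) = fun g => (b (Subgroup.inclusion hle g) : ℂ) * ((χ g : ℂ) ^ q)⁻¹ := by
      ext g
      simp [ψ]
    rw [h3]
    exact h1.mul h2
  have hψ1 : ∀ A : Mat n, ∀ hA : A ∈ lieSet (parabolic G.carrier s),
      ψ ⟨expGL A, expGL_mem_of_mem_lieSet hA⟩ = 1 := by
    intro A hA
    have h1 := char_expGL hχ ⟨A, hA⟩ 1
    have h2 := char_expGL hbh ⟨A, lieSet_mono hle hA⟩ 1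
    simp only [one_smul, Complex.ofReal_one, one_mul] at h1 h2
    change b (Subgroup.inclusion hle _) * ((χ _) ^ q)⁻¹ = 1
    rw [mul_inv_eq_one]
    apply Units.ext
    rw [Units.val_pow_eq_pow_val, h1, ← Complex.exp_nat_mul, hχs, ← hbd ⟨A, lieSet_mono hle hA⟩,
      ← h2]
    rfl
  obtain ⟨k, hk, hkψ⟩ := exists_pow_eq_one hG he hs hψ hψ1
  refine ⟨q * k, b ^ k, Nat.mul_pos hq hk, hbh.pow k, fun A => ?_, fun g => ?_⟩
  · rw [charDeriv_pow hbh, hbd]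
    push_cast
    ring
  · have h1 := hkψ g
    have h2 : ψ g = b (Subgroup.inclusion hle g) * (χ g ^ q)⁻¹ := rfl
    rw [h2, mul_pow, inv_pow, mul_inv_eq_one] at h1
    rw [MonoidHom.pow_apply, h1, pow_mul]

end GHiggs

/-! ### Transfer of reductions, degrees, parameters and test data from G' to G. -/

namespace GHiggs

variable {n : ℕ} {X : Type u} [TopologicalSpace X] [ChartedSpace ℂ X]

/-! ### Extension of reductions of the structure group -/

namespace PrincipalBundle

variable {G : Subgroup (GL (Fin n) ℂ)} (E : PrincipalBundle.{u, v} X G)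

theorem act_cancel {e : E.E} {g h : G} (hgh : E.act e g = E.act e h) : g = h :=
  (E.simply_transitive e (E.act e h) (E.proj_act e h).symm).unique hgh rfl

end PrincipalBundle

variable {G G' : ComplexReductiveGroup n} {hG : G'.carrier ≤ G.carrier}
  {E : HiggsBundle.{u, v} X G} {E' : HiggsBundle.{u, v'} X G'} {j : E'.E → E.E}

namespace HiggsBundle.IsReduction

variable {Q' Q : Subgroup (GL (Fin n) ℂ)}

theorem exists_transition (hj : IsReduction hG E' E j)
    (σ : E'.toPrincipalBundle.Reduction Q') {e e' : E'.E} (he : e ∈ σ.F) (he' : e' ∈ σ.F)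
    {p p' : G.carrier} (h : E.act (j e) p = E.act (j e') p') :
    ∃ g : G'.carrier, (g : GL (Fin n) ℂ) ∈ Q' ∧ e' = E'.act e g ∧
      p = Subgroup.inclusion hG g * p' := by
  have h1 : E'.proj e = E'.proj e' := by
    rw [← hj.proj, ← hj.proj, ← E.proj_act _ p, h, E.proj_act]
  obtain ⟨g, hg, -⟩ := E'.simply_transitive e e' h1
  refine ⟨g, σ.mem_of_act_mem e he g (by rw [hg]; exact he'), hg.symm, ?_⟩
  rw [← hg, hj.act, ← E.act_mul] at h
  exact E.toPrincipalBundle.act_cancel h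

/-- The extension of a reduction of the structure group. -/
def extend (hj : IsReduction hG E' E j) (hQ : Q' ≤ Q)
    (σ : E'.toPrincipalBundle.Reduction Q') : E.toPrincipalBundle.Reduction Q where
  F := {e | ∃ e' ∈ σ.F, ∃ p : G.carrier, (p : GL (Fin n) ℂ) ∈ Q ∧ e = E.act (j e') p}
  act_mem := by
    rintro _ ⟨e', he', p, hp, rfl⟩ g hg
    exact ⟨e', he', p * g, Q.mul_mem hp hg, (E.act_mul _ _ _).symm⟩
  mem_of_act_mem := by
    rintro _ ⟨e', he', p, hp, rfl⟩ g ⟨e'', he'', p'', hp'', h⟩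
    rw [← E.act_mul] at h
    obtain ⟨k, hk, -, hpk⟩ := hj.exists_transition σ he' he'' h
    have h1 : (g : GL (Fin n) ℂ) = (p : GL (Fin n) ℂ)⁻¹ * (k * p'') := by
      rw [eq_inv_mul_iff_mul_eq]
      exact congrArg Subtype.val hpk
    rw [h1]
    exact Q.mul_mem (Q.inv_mem hp) (Q.mul_mem (hQ hk) hp'')
  exists_section := fun x => by
    obtain ⟨U, s, hx, hs, hsF⟩ := σ.exists_section x
    exact ⟨U, fun y => j (s y), hx, hj.holomorphic s U hs,
      fun y hy => ⟨s y, hsF y hy, 1, Q.one_mem, (E.act_one _).symm⟩⟩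

/-- A meromorphic section f induces f₁(j(e')p) = χ(p)⁻¹ f(e')^M, whose divisor is M times that of f.
-/
theorem hasDegree_extend (hj : IsReduction hG E' E j) (hQ : Q' ≤ Q)
    {σ : E'.toPrincipalBundle.Reduction Q'} {χ' : Q' →* ℂˣ} {χ : Q →* ℂˣ} {M : ℕ}
    (hχ : ∀ g : Q', χ (Subgroup.inclusion hQ g) = χ' g ^ M) {d : ℤ} (hd : σ.HasDegree χ' d) :
    (hj.extend hQ σ).HasDegree χ (M * d) := by
  classical
  obtain ⟨f, D, hf, hD, hdD⟩ := hd
  let f₁ : E.E → ℂ := fun e =>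
    if h : ∃ (e' : E'.E) (p : G.carrier) (_ : (p : GL (Fin n) ℂ) ∈ Q),
      e' ∈ σ.F ∧ e = E.act (j e') p
    then ((χ ⟨h.choose_spec.choose, h.choose_spec.choose_spec.choose⟩)⁻¹ : ℂˣ) * f h.choose ^ M
    -- The value off the extended reduction is arbitrary: only points of that reduction enter the
    -- degree.
    else 0
  have hwd : ∀ e' ∈ σ.F, ∀ (p : G.carrier) (hp : (p : GL (Fin n) ℂ) ∈ Q), ∀ e'' ∈ σ.F,
      ∀ (p'' : G.carrier) (hp'' : (p'' : GL (Fin n) ℂ) ∈ Q), E.act (j e') p = E.act (j e'') p'' →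
      (((χ ⟨p'', hp''⟩)⁻¹ : ℂˣ) : ℂ) * f e'' ^ M = ((χ ⟨p, hp⟩)⁻¹ : ℂˣ) * f e' ^ M := by
    intro e' he' p hp e'' he'' p'' hp'' h1
    obtain ⟨g, hg, hge, hgp⟩ := hj.exists_transition σ he' he'' h1
    have h2 : (⟨p, hp⟩ : Q) = Subgroup.inclusion hQ ⟨g, hg⟩ * ⟨p'', hp''⟩ :=
      Subtype.ext (congrArg (fun x : G.carrier => (x : GL (Fin n) ℂ)) hgp)
    rw [hge, hf e' he' g hg, h2, map_mul, hχ, mul_inv, mul_pow, Units.val_mul,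
      ← inv_pow, Units.val_pow_eq_pow_val]
    ring
  have hf₁ : ∀ e' ∈ σ.F, ∀ (p : G.carrier) (hp : (p : GL (Fin n) ℂ) ∈ Q),
      f₁ (E.act (j e') p) = ((χ ⟨p, hp⟩)⁻¹ : ℂˣ) * f e' ^ M := by
    intro e' he' p hp
    have h : ∃ (e'' : E'.E) (p' : G.carrier) (_ : (p' : GL (Fin n) ℂ) ∈ Q),
      e'' ∈ σ.F ∧ E.act (j e') p = E.act (j e'') p' := ⟨e', p, hp, he', rfl⟩
    simp only [f₁, dif_pos h]
    obtain ⟨he'', h1⟩ := h.choose_spec.choose_spec.choose_spec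
    exact hwd e' he' p hp _ he'' _ _ h1
  refine ⟨f₁, (M : ℤ) • D, ?_, fun x => ?_, ?_⟩
  · rintro _ ⟨e', he', p, hp, rfl⟩ g hg
    rw [← E.act_mul, hf₁ e' he' _ (Q.mul_mem hp hg), hf₁ e' he' p hp]
    have h2 : (⟨(p * g : G.carrier), Q.mul_mem hp hg⟩ : Q) = ⟨p, hp⟩ * ⟨g, hg⟩ := rfl
    rw [h2, map_mul, mul_inv, Units.val_mul]
    ring
  · obtain ⟨U, s, hx, hs, hsF, hmer, hord⟩ := hD x
    have hev : (fun z : ℂ => f₁ (j (s ((chartAt ℂ x).symm z)))) =ᶠ[𝓝 (chartAt ℂ x x)]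
        (fun z : ℂ => f (s ((chartAt ℂ x).symm z))) ^ M := by
      have h1 : ContinuousAt (chartAt ℂ x).symm (chartAt ℂ x x) :=
        (chartAt ℂ x).continuousAt_symm (mem_chart_target ℂ x)
      have h2 : U ∈ 𝓝 ((chartAt ℂ x).symm (chartAt ℂ x x)) := by
        rw [(chartAt ℂ x).left_inv (mem_chart_source ℂ x)]
        exact hs.1.mem_nhds hx
      filter_upwards [h1 h2] with z hz
      have h3 := hf₁ _ (hsF _ hz) 1 Q.one_mem
      have h4 : (⟨((1 : G.carrier) : GL (Fin n) ℂ), Q.one_mem⟩ : Q) = 1 := rfl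
      rw [E.act_one, h4, map_one, inv_one, Units.val_one, one_mul] at h3
      exact h3
    refine ⟨U, fun y => j (s y), hx, hj.holomorphic s U hs,
      fun y hy => ⟨s y, hsF y hy, 1, Q.one_mem, (E.act_one _).symm⟩, ?_, ?_⟩
    · exact (hmer.pow M).congr (hev.filter_mono nhdsWithin_le_nhds).symm
    · rw [meromorphicOrderAt_congr (hev.filter_mono nhdsWithin_le_nhds), meromorphicOrderAt_pow hmer,
        hord]
      simp
  · rw [hdD, Finsupp.sum_smul_index (h := fun _ k => k) (fun _ => rfl), Finsupp.mul_sum]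

/-- The points of the extension are P-translates of points of σ, and 𝔭_s is stable under Ad(P). -/
theorem higgs_mem_extend (hj : IsReduction hG E' E j) {c : GL (Fin n) ℂ} {s : Mat n}
    {d : Fin n → ℝ} (hd : cj c s = rdiag d) (hQ : Q' ≤ parabolic G.carrier s)
    {σ : E'.toPrincipalBundle.Reduction Q'}
    (hσ : ∀ c ∈ atlas ℂ X, ∀ e ∈ σ.F, E'.proj e ∈ c.source → E'.coeff c e ∈ G'.parabolicLie s) :
    ∀ c ∈ atlas ℂ X, ∀ e ∈ (hj.extend hQ σ).F, E.proj e ∈ c.source →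
      E.coeff c e ∈ G.parabolicLie s := by
  rintro φ hφ _ ⟨e', he', p, hp, rfl⟩ hsrc
  rw [E.proj_act] at hsrc
  rw [E.coeff_act φ hφ _ hsrc p]
  rw [hj.proj] at hsrc
  rw [hj.higgs φ hφ e' hsrc]
  have h1 := hσ φ hφ e' he' hsrc
  have h2 : E'.coeff φ e' ∈ G.parabolicLie s := ⟨lie_le hG h1.1, h1.2⟩
  rw [← mem_lieSet_parabolic_iff hd] at h2 ⊢
  have h3 := cj_mem_lieSet h2 (inv_mem hp)
  rwa [cj_apply, inv_inv] at h3

end HiggsBundle.IsReduction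

/-! ### Projection of stability parameters -/

theorem zero_mem_iCompact (G : ComplexReductiveGroup n) : (0 : Mat n) ∈ iCompact G.carrier := by
  obtain ⟨c, hc⟩ := exists_isPolar G
  exact hc.mem_iCompact (zero_mem _) (by simp)

theorem mem_lie_of_mem_iCompact {s : Mat n} (hs : s ∈ iCompact G.carrier) : s ∈ G.lie := by
  obtain ⟨H, hH, hsH⟩ := hs
  have h1 : Complex.I • s ∈ G.lie := (G.mem_lie _).2 (lieSet_mono hH.prop.1 hsH)
  have h2 := G.lie.smul_mem (-Complex.I) h1
  rwa [smul_smul, neg_mul, Complex.I_mul_I, neg_neg, one_smul] at h2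

/-- The projection of α to 𝔤' inherits centrality from tr([α',w]y) = tr([α,w]y) = 0. It is Hermitian
because α is and 𝔤' is closed under the same adjoint. -/
theorem exists_parameter (hG : G'.carrier ≤ G.carrier) {α : G.lie} (hα : G.IsParameter α) :
    ∃ α' : G'.lie, G'.IsParameter α' ∧
      ∀ y : G'.lie, ((α' : Mat n) * y).trace = ((α : Mat n) * y).trace := by
  obtain ⟨c, hc, hc', -⟩ := exists_common_isPolar hG (zero_mem_iCompact G')
  have hcen : ∀ w ∈ G.lie, Commute w (α : Mat n) := fun w hw => by
    have := (LieModule.mem_maxTrivSubmodule ℂ G.lie G.lie α).1 hα.1 ⟨w, hw⟩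
    exact lie_eq_zero_iff_commute.1 (congrArg Subtype.val this)
  have hαd : dag c (α : Mat n) = α := dag_eq_self_iff.2 (hc.hermitian_of_central hα.2 hcen)
  let ℓ : G'.lie →ₗ[ℂ] ℂ :=
    Matrix.traceLinearMap (Fin n) ℂ ℂ ∘ₗ LinearMap.mulLeft ℂ (α : Mat n) ∘ₗ G'.lie.toSubmodule.subtype
  obtain ⟨α', hα'⟩ := hc'.exists_trace_dual ℓ
  replace hα' : ∀ y : G'.lie, ((α' : Mat n) * y).trace = ((α : Mat n) * y).trace :=
    fun y => (hα' y).symm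
  refine ⟨α', ⟨?_, ?_⟩, hα'⟩
  · refine (LieModule.mem_maxTrivSubmodule ℂ G'.lie G'.lie α').2 fun w => ?_
    rw [← lie_skew, neg_eq_zero]
    apply Subtype.ext
    refine hc'.eq_zero_of_trace (⁅α', w⁆ : G'.lie).2 fun y hy => ?_
    rw [LieSubalgebra.coe_bracket, trace_lie_mul]
    have h1 := hα' ⁅w, ⟨y, hy⟩⁆
    rw [LieSubalgebra.coe_bracket] at h1
    rw [h1, ← trace_lie_mul, lie_eq_zero_iff_commute.2 (hcen _ (lie_le hG w.2)).symm, zero_mul,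
      Matrix.trace_zero]
  · refine hc'.mem_iCompact α'.2 (dag_eq_self_iff.1 ?_)
    rw [← sub_eq_zero]
    refine hc'.eq_zero_of_trace (sub_mem (hc'.dag_mem α'.2) α'.2) fun y hy => ?_
    rw [sub_mul, Matrix.trace_sub, hα' ⟨y, hy⟩, sub_eq_zero]
    have h1 := hα' ⟨dag c y, hc'.dag_mem hy⟩
    have h2 := congrArg star h1
    rw [← trace_dag (c := c), ← trace_dag (c := c), dag_mul, dag_mul, dag_dag, hαd,
      Matrix.trace_mul_comm, Matrix.trace_mul_comm y] at h2
    exact h2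

/-! ### Test data of the extended bundle -/

variable {B : LinearMap.BilinForm ℂ G.lie} {B' : LinearMap.BilinForm ℂ G'.lie}

/-- A test datum of the reduced bundle gives rise to an element of `𝔤'` that represents the
differential of the character with respect to the trace form. -/
theorem exists_trace_representative (hG : G'.carrier ≤ G.carrier) (hB' : G'.IsInvariantPairing B')
    {s₀ : Mat n} (hs₀ : s₀ ∈ iCompact G'.carrier) {χ : parabolic G'.carrier s₀ →* ℂˣ}
    (hχ : IsHolomorphicCharacter χ) {s : G'.lie} (hs : IsDualElement G' B' s₀ χ s)
    (hanti : G'.parabolicLie s₀ ⊆ G'.parabolicLie (s : Mat n)) :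
    ∃ (c : GL (Fin n) ℂ) (s₁ : G'.lie) (d e : Fin n → ℝ), IsPolar G c ∧ IsPolar G' c ∧
      cj c s₀ = rdiag e ∧ cj c (s₁ : Mat n) = rdiag d ∧
      (∀ y : G'.lie, B' s y = ((s₁ : Mat n) * y).trace) ∧
      (∀ A : lieSet (parabolic G'.carrier s₀), charDeriv χ A = ((s₁ : Mat n) * (A : Mat n)).trace) ∧
      G'.parabolicLie s₀ ⊆ G'.parabolicLie (s₁ : Mat n) ∧
      parabolic G'.carrier s₀ ≤ parabolic G.carrier (s₁ : Mat n) := by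
  obtain ⟨c, hc, hc', hsc⟩ := exists_common_isPolar hG hs₀
  have hs₀G := mem_lie_of_mem_iCompact hs₀
  obtain ⟨s₁, hs₁⟩ := hc'.exists_trace_dual (B' s)
  have hχs : ∀ A : lieSet (parabolic G'.carrier s₀),
      charDeriv χ A = ((s₁ : Mat n) * (A : Mat n)).trace := by
    intro A
    have hP : parabolic G'.carrier s₀ ≤ G'.carrier := fun g hg => hg.1
    have hA : (A : Mat n) ∈ G'.lie := (G'.mem_lie _).2 (lieSet_mono hP A.2)
    rw [← hs.2 ⟨A, hA⟩ A.2, hs₁]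
  -- The element s is central in the Levi algebra of s₀, which contains s₀, and s₁ has the same
  -- centraliser as s.
  have hcomm : Commute (s₁ : Mat n) s₀ := by
    obtain ⟨u, -, e, he⟩ := exists_unitary_diag hsc
    rw [← cj_mul] at he
    have h1 : ⁅(s : Mat n), s₀⁆ = 0 := hs.1.2 s₀ ((mem_leviLie_iff he).2 ⟨hs₀G, Commute.refl _⟩)
    have h2 : ⁅s, (⟨s₀, hs₀G⟩ : G'.lie)⁆ = 0 := Subtype.ext h1
    have h3 := (lie_eq_zero_iff_of_pairing hc' hB' hs₁ _).1 h2
    exact lie_eq_zero_iff_commute.1 (congrArg Subtype.val h3)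
  have hs₁d : dag c (s₁ : Mat n) = s₁ :=
    hc'.dag_eq_self_of_charDeriv hχ (dag_eq_self_iff.2 hsc) s₁.2 hcomm hχs
  obtain ⟨u, hu, e, d, he, hd⟩ := exists_unitary_diag₂ hsc (dag_eq_self_iff.1 hs₁d) (by
    rw [← map_mul, ← map_mul, hcomm.eq])
  rw [← cj_mul] at he hd
  have hle : G'.parabolicLie s₀ ⊆ G'.parabolicLie (s₁ : Mat n) := by
    rwa [← parabolicLie_eq_of_pairing hc' hB' hs₁ hs₁d]
  have hbt : ∀ g ∈ parabolic G'.carrier s₀, (cj (u * c) (g : Mat n)).BlockTriangular d := by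
    intro g hg
    refine blockTriangular_of_mem_parabolic hs₀G s₁.2 he hd (hc'.unitary_mul hu) hle ?_ hg
    intro g hg A hA
    have hA' := (mem_lieSet_parabolic_iff he).2 hA
    have h1 := charDeriv_cj χ ⟨g, hg⟩ ⟨A, hA'⟩
    rwa [hχs, hχs] at h1
  refine ⟨u * c, s₁, d, e, hc.unitary_mul hu, hc'.unitary_mul hu, he, hd, hs₁, hχs, hle, ?_⟩
  intro g hg
  exact (mem_parabolic_iff hd).2 ⟨hG hg.1, hbt g hg, hbt _ (inv_mem hg)⟩

/-- A test datum of the reduced bundle extends, up to a positive multiple, to a test datum of the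
original bundle. -/
theorem HiggsBundle.IsReduction.exists_testDatum (hj : IsReduction hG E' E j)
    (hB : G.IsInvariantPairing B) (hB' : G'.IsInvariantPairing B') {s₀ : Mat n}
    {χ : parabolic G'.carrier s₀ →* ℂˣ} {s : G'.lie}
    {σ : E'.toPrincipalBundle.Reduction (parabolic G'.carrier s₀)}
    (h : E'.IsTestDatum B' s₀ χ s σ) {δ : ℤ} (hδ : σ.HasDegree χ δ) :
    ∃ (M : ℕ) (s₁ : G'.lie) (χ₁ : parabolic G.carrier (s₁ : Mat n) →* ℂˣ) (t : G.lie)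
      (τ : E.toPrincipalBundle.Reduction (parabolic G.carrier (s₁ : Mat n))),
      0 < M ∧ (∀ y : G'.lie, B' s y = ((s₁ : Mat n) * y).trace) ∧
      (∀ y : G.lie, B t y = M * ((s₁ : Mat n) * y).trace) ∧
      E.IsTestDatum B s₁ χ₁ t τ ∧ τ.HasDegree χ₁ (M * δ) ∧
      (t ∈ LieAlgebra.center ℂ G.lie → s ∈ LieAlgebra.center ℂ G'.lie) := by
  obtain ⟨c, s₁, d, e, hc, hc', he, hd, hs₁, hχs, hle, hP⟩ :=
    exists_trace_representative hG hB' h.mem_iCompact h.holomorphic h.dual h.antidominant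
  obtain ⟨M, χ₁, hM, hχ₁, hχ₁s, hχ₁χ⟩ := exists_char_extension hc' he
    (mem_lie_of_mem_iCompact h.mem_iCompact) hd s₁.2 h.holomorphic hχs hP
  have hM' : (0 : ℝ) < M := by exact_mod_cast hM
  let a : G.lie := ⟨s₁, lie_le hG s₁.2⟩
  let b : G.lie := (M : ℂ) • a
  have hb : (b : Mat n) = (M : ℝ) • (s₁ : Mat n) := by
    change (M : ℂ) • (s₁ : Mat n) = (M : ℝ) • (s₁ : Mat n)
    ext i k
    simp
  have hbd : cj c (b : Mat n) = rdiag ((M : ℝ) • d) := by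
    rw [hb, cj_real_smul, hd, smul_rdiag]
  have hdag : dag c (b : Mat n) = b := by
    rw [dag_eq_self_iff, hbd, rdiag_conjTranspose]
  let ℓ : G.lie →ₗ[ℂ] ℂ :=
    Matrix.traceLinearMap (Fin n) ℂ ℂ ∘ₗ LinearMap.mulLeft ℂ (b : Mat n) ∘ₗ G.lie.toSubmodule.subtype
  -- This t represents the differential of χ₁ in the pairing `B`. It has the same centraliser as s₁
  -- and the same parabolic subalgebra, which yields duality and antidominance on P_{s₁}.
  obtain ⟨t, ht⟩ : ∃ t : G.lie, ∀ y : G.lie, B t y = ((b : Mat n) * y).trace :=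
    ⟨(B.toDual hB.nondegenerate).symm ℓ, fun y =>
      LinearMap.BilinForm.apply_toDual_symm_apply (hB := hB.nondegenerate) ℓ y⟩
  have ht' : ∀ y : G.lie, B t y = M * ((s₁ : Mat n) * y).trace := by
    intro y
    rw [ht, hb, smul_mul_assoc, Matrix.trace_smul, Complex.real_smul, Complex.ofReal_natCast]
  have hlie : ∀ w : G.lie, ⁅t, w⁆ = 0 ↔ Commute (s₁ : Mat n) w := by
    intro w
    rw [lie_eq_zero_iff_of_pairing hc hB ht]
    have h1 : ⁅b, w⁆ = (M : ℂ) • ⁅a, w⁆ := smul_lie _ _ _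
    rw [h1, smul_eq_zero_iff_right (by exact_mod_cast hM.ne'), ← lie_eq_zero_iff_commute]
    exact Subtype.ext_iff
  refine ⟨M, s₁, χ₁, t, hj.extend hP σ, hM, hs₁, ht', ?_, hj.hasDegree_extend hP hχ₁χ hδ, ?_⟩
  · refine ⟨hc.mem_iCompact a.2 (by rw [hd, rdiag_conjTranspose]), hχ₁, ⟨⟨?_, ?_⟩, ?_⟩, ?_, ?_⟩
    · rw [mem_leviLie_iff hd]
      refine ⟨t.2, (lie_eq_zero_iff_commute.1 ?_).symm⟩
      exact congrArg Subtype.val ((hlie a).2 (Commute.refl _))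
    · intro w hw
      rw [mem_leviLie_iff hd] at hw
      exact congrArg Subtype.val ((hlie ⟨w, hw.1⟩).2 hw.2)
    · intro A hA
      rw [ht', hχ₁s]
    · intro A hA
      rw [parabolicLie_eq_of_pairing hc hB ht hdag, mem_parabolicLie_iff hbd]
      rw [mem_parabolicLie_iff hd] at hA
      refine ⟨hA.1, fun i k hik => hA.2 ?_⟩
      simp only [Pi.smul_apply, smul_eq_mul] at hik
      exact lt_of_mul_lt_mul_left hik hM'.le
    · exact hj.higgs_mem_extend hd hP fun φ hφ e he hsrc => hle (h.higgs_mem φ hφ e he hsrc)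
  · intro htc
    refine (LieModule.mem_maxTrivSubmodule ℂ G'.lie G'.lie s).2 fun w => ?_
    rw [← lie_skew, neg_eq_zero, lie_eq_zero_iff_of_pairing hc' hB' hs₁]
    have h1 := (LieModule.mem_maxTrivSubmodule ℂ G.lie G.lie t).1 htc ⟨w, lie_le hG w.2⟩
    rw [← lie_skew, neg_eq_zero, hlie, ← lie_eq_zero_iff_commute] at h1
    exact Subtype.ext h1

end GHiggs

theorem mainTheorem10 {X : Type u} [TopologicalSpace X] [T2Space X] [CompactSpace X]
    [ConnectedSpace X] [ChartedSpace ℂ X] [IsManifold 𝓘(ℂ, ℂ) ω X] {n : ℕ}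
    (G G' : GHiggs.ComplexReductiveGroup n) (hG : G'.carrier ≤ G.carrier)
    (B : LinearMap.BilinForm ℂ G.lie) (hB : G.IsInvariantPairing B)
    (B' : LinearMap.BilinForm ℂ G'.lie) (hB' : G'.IsInvariantPairing B')
    (E : GHiggs.HiggsBundle.{u, v} X G) (E' : GHiggs.HiggsBundle.{u, v'} X G')
    (j : E'.E → E.E) (hj : GHiggs.HiggsBundle.IsReduction hG E' E j)
    (hE : E.IsStable B) :
    E'.IsStable B' := by
  obtain ⟨α, hα, hss, hst⟩ := hE
  obtain ⟨α', hα', hαα'⟩ := GHiggs.exists_parameter hG hα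
  -- Both pairings with the parameters reduce to tr(s₁α), so the two stability numbers differ by the
  -- factor M.
  have key : ∀ (M : ℕ) (s s₁ : G'.lie) (t : G.lie),
      (∀ y : G'.lie, B' s y = ((s₁ : GHiggs.Mat n) * y).trace) →
      (∀ y : G.lie, B t y = M * ((s₁ : GHiggs.Mat n) * y).trace) → ∀ δ : ℤ,
      ((M * δ : ℤ) : ℝ) - (B α t).re = M * ((δ : ℝ) - (B' α' s).re) := by
    intro M s s₁ t hs ht δ
    have h1 : B α t = M * B' α' s := by
      rw [hB.symm, ht, hB'.symm, hs, Matrix.trace_mul_comm, ← hαα', Matrix.trace_mul_comm]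
    have h2 : (B α t).re = M * (B' α' s).re := by
      rw [h1, ← Complex.ofReal_natCast, Complex.re_ofReal_mul]
    rw [h2]
    push_cast
    ring
  refine ⟨α', hα', fun s₀ χ s σ h δ hδ => ?_, fun s₀ χ s σ h hsc δ hδ => ?_⟩
  · obtain ⟨M, s₁, χ₁, t, τ, hM, hs, ht, hτ, hτδ, -⟩ := hj.exists_testDatum hB hB' h hδ
    have h1 := hss _ _ _ _ hτ _ hτδ
    rw [key M s s₁ t hs ht] at h1
    exact nonneg_of_mul_nonneg_right h1 (by exact_mod_cast hM)
  · obtain ⟨M, s₁, χ₁, t, τ, hM, hs, ht, hτ, hτδ, hcen⟩ := hj.exists_testDatum hB hB' h hδ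
    have h1 := hst _ _ _ _ hτ (fun htc => hsc (hcen htc)) _ hτδ
    rw [key M s s₁ t hs ht] at h1
    exact pos_of_mul_pos_right h1 (Nat.cast_nonneg M)
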